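/- \textbf{Setting.} Let $X$ be a shelf: a set with an operation $(x,y)\mapsto x^y$ such that $(x^y)^z=(x^z)^{(y^z)}$. Let $M=M(X)=\langle X : y\,x^y=xy\rangle$ be its structure monoid, and let $K$ be a commutative ring (for instance $\mathbb Z$, or a field $k$). For $S$ the one-point set with trivial action, or $S=M$ acted upon by right multiplication, let $C_n(X,S)$ be the free $K$-module on $S\times X^n$, with $$\partial(s\,x_1\cdots x_n)=\sum_{i=1}^n(-1)^{i-1}\bigl(s\,x_1\cdots\widehat{x_i}\cdots x_n-(s\cdot x_i)\,x_1^{x_i}\cdots x_{i-1}^{x_i}x_{i+1}\cdots x_n\bigr),$$ and let $C^n(X,S)=\mathrm{Hom}_K(C_n(X,S),K)$ with $\partial^*f=(-1)^{|f|}f\circ\partial$. Write $C_\bullet(X)$ for $S$ a point and $C_\bullet(X,M)$ for $S=M$, and $H_*$, $H^*$ for homology and cohomology. All algebras are associative and unital, all coalgebras coassociative and counital, everything is graded, and the Koszul sign rule is used: $(a\otimes b)(a'\otimes b')=(-1)^{|b||a'|}aa'\otimes bb'$ and $(f\otimes g)(a\otimes b)=(-1)^{|g||a|}f(a)g(b)$.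 In a d.g. (bi/co)algebra the differential is a (co)derivation for the given (co)product. \textbf{Theorem.} On the level of complexes: \begin{enumerate} \item $C_\bullet(X,M)$ carries a d.g. bialgebra structure, transported from $B(X)=K\langle x,e_y : y\,x^y=xy,\ y\,e_{x^y}=e_x\,y\rangle$ with $\Delta(x)=x\otimes x$, $\Delta(e_x)=e_x\otimes x+1\otimes e_x$, $\varepsilon(x)=1$, $\varepsilon(e_x)=0$, along $a\,x_1\cdots x_n\leftrightarrow a\,e_{x_1}\cdots e_{x_n}$ $(a\in M)$; \item $C_\bullet(X)$ carries a d.g. coalgebra structure, the quotient of the preceding one along $a\,x_1\cdots x_n\mapsto x_1\cdots x_n$; \item the cochain complex $C^\bullet(X)$ is a d.g. algebra for the cup product $f\smile g=(f\otimes g)\circ\Delta$, with unit $\varepsilon$; \item the cochain complex $C^\bullet(X,M)$ is a d.g. algebra for the cup product. Together with the transpose $\delta$ of the product of $C_\bullet(X,M)$, $(\delta f)(a\otimes b)=f(ab)$, and the counit $f\mapsto f(1)$, it is moreover a d.g. bialgebra in the completed sense: $\delta$ takes its values in the completed tensor square, formed by the functionals on $C_\bullet(X,M)\otimes C_\bullet(X,M)$,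 and it is coassociative, counital, multiplicative, unital, and compatible with degrees and differentials. \end{enumerate} These structures induce: \begin{enumerate} \item graded algebra structures on $H^*(X)$, $H^*(X,M)$ and $H_*(X,M)$, with coefficients in any $K$ (so in particular on $H^*(X)$, $H^*(X,M)$, $H_*(X,M)$ over $\mathbb Z$ and on $H^*(X,k)$, $H^*(X,kM)$ over a field $k$); \item if $K=k$ is a field, a graded coalgebra structure on $H_*(X,k)$; \item if $K=k$ is a field, a graded bialgebra structure on $H_*(X,kM)$; \item if $K=k$ is a field and $X$ is finite, a graded bialgebra structure on $H^*(X,kM)$, whose product is the cup product and whose coproduct is the transpose of the product of $H_*(X,kM)$. \end{enumerate} -/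

import Mathlib

open scoped DirectSum TensorProduct

noncomputable section

namespace RackCohom

universe u v w

/-! ### Graded modules, graded (co)algebras and graded bialgebras

A graded module is a family `V : ℕ → Type*` of modules; its total space is `⨁ n, V n`. -/

section Graded

variable (K : Type v) [CommRing K] (V : ℕ → Type w) [∀ n, AddCommGroup (V n)]
  [∀ n, Module K (V n)]

/-- The total space of a graded module. -/
abbrev Tot (V : ℕ → Type w) [∀ n, AddCommGroup (V n)] : Type w := ⨁ n, V n

/-- The inclusion of the degree `n` component. -/
abbrev inc (n : ℕ) : V n →ₗ[K] Tot V := DirectSum.lof K ℕ V n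

/-- The projection of the total space onto its odd part. -/
def oddPart : Tot V →ₗ[K] Tot V :=
  DirectSum.lmap (R := K) (fun n => if Odd n then (LinearMap.id : V n →ₗ[K] V n) else 0)

/-- The sign `v ↦ (-1)^|v| v`. -/
def signMap : Tot V →ₗ[K] Tot V :=
  DirectSum.lmap (fun n => ((-1 : K) ^ n) • (LinearMap.id : V n →ₗ[K] V n))

/-- For the projections `P`, `Q` onto the odd parts, the sign `a ⊗ b ↦ (-1)^(|a||b|) a ⊗ b`, written
as `1 - 2 [a odd] [b odd]`. -/
def koszulSign {A : Type*} {B : Type*} [AddCommGroup A] [AddCommGroup B] [Module K A] [Module K B]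
    (P : A →ₗ[K] A) (Q : B →ₗ[K] B) : (A ⊗[K] B) →ₗ[K] (A ⊗[K] B) :=
  LinearMap.id - (2 : K) • TensorProduct.map P Q

theorem koszulSign_tmul {A : Type*} {B : Type*} [AddCommGroup A] [AddCommGroup B] [Module K A]
    [Module K B] (P : A →ₗ[K] A) (Q : B →ₗ[K] B) (a : A) (b : B) :
    koszulSign K P Q (a ⊗ₜ b) = a ⊗ₜ b - (2 : K) • (P a ⊗ₜ Q b) := by
  simp [koszulSign]

/-- The projection of the tensor square onto its part of odd total degree. -/
def oddPartTensor : (Tot V ⊗[K] Tot V) →ₗ[K] (Tot V ⊗[K] Tot V) :=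
  TensorProduct.map (oddPart K V) LinearMap.id + TensorProduct.map LinearMap.id (oddPart K V)
    - (2 : K) • TensorProduct.map (oddPart K V) (oddPart K V)

/-- The differential `d ⊗ 1 + 1 ⊗ d` on the tensor square, where by the Koszul rule
`(1 ⊗ d) (a ⊗ b) = (-1)^|a| a ⊗ d b`. -/
def tensorD (d : Tot V →ₗ[K] Tot V) : (Tot V ⊗[K] Tot V) →ₗ[K] (Tot V ⊗[K] Tot V) :=
  TensorProduct.map d LinearMap.id + TensorProduct.map (signMap K V) d

/-- `(a₁ ⊗ b₁) ⊗ (a₂ ⊗ b₂) ↦ (-1)^(|b₁||a₂|) (a₁ ⊗ a₂) ⊗ (b₁ ⊗ b₂)`. -/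
def koszulMiddle : ((Tot V ⊗[K] Tot V) ⊗[K] (Tot V ⊗[K] Tot V)) →ₗ[K]
    ((Tot V ⊗[K] Tot V) ⊗[K] (Tot V ⊗[K] Tot V)) :=
  (TensorProduct.tensorTensorTensorComm K (Tot V) (Tot V) (Tot V) (Tot V)).toLinearMap ∘ₗ
    koszulSign K (TensorProduct.map (LinearMap.id : Tot V →ₗ[K] Tot V) (oddPart K V))
      (TensorProduct.map (oddPart K V) (LinearMap.id : Tot V →ₗ[K] Tot V))

/-- The product of the tensor square of a graded algebra:
`(a₁ ⊗ b₁)(a₂ ⊗ b₂) = (-1)^(|b₁||a₂|) a₁a₂ ⊗ b₁b₂`. -/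
def tensorMul (mul : (Tot V ⊗[K] Tot V) →ₗ[K] Tot V) :
    ((Tot V ⊗[K] Tot V) ⊗[K] (Tot V ⊗[K] Tot V)) →ₗ[K] (Tot V ⊗[K] Tot V) :=
  TensorProduct.map mul mul ∘ₗ koszulMiddle K V

/-- The degree `n` part of the tensor square. -/
def tensorDeg (n : ℕ) : Submodule K (Tot V ⊗[K] Tot V) :=
  ⨆ p : {p : ℕ × ℕ // p.1 + p.2 = n},
    LinearMap.range (TensorProduct.map (inc K V p.1.1) (inc K V p.1.2))

/-- A graded associative unital algebra. -/
structure GrAlg where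
  mul : (Tot V ⊗[K] Tot V) →ₗ[K] Tot V
  one : Tot V
  mul_deg : ∀ (p q : ℕ) (a : V p) (b : V q),
    mul (inc K V p a ⊗ₜ inc K V q b) ∈ LinearMap.range (inc K V (p + q))
  one_deg : one ∈ LinearMap.range (inc K V 0)
  mul_assoc : ∀ a b c : Tot V, mul (mul (a ⊗ₜ b) ⊗ₜ c) = mul (a ⊗ₜ mul (b ⊗ₜ c))
  one_mul : ∀ a : Tot V, mul (one ⊗ₜ a) = a
  mul_one : ∀ a : Tot V, mul (a ⊗ₜ one) = a

/-- A graded coassociative counital coalgebra. -/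
structure GrCoalg where
  comul : Tot V →ₗ[K] (Tot V ⊗[K] Tot V)
  counit : Tot V →ₗ[K] K
  comul_deg : ∀ (n : ℕ) (a : V n), comul (inc K V n a) ∈ tensorDeg K V n
  counit_deg : ∀ (n : ℕ) (a : V (n + 1)), counit (inc K V (n + 1) a) = 0
  coassoc :
    (TensorProduct.assoc K (Tot V) (Tot V) (Tot V)).toLinearMap ∘ₗ
      TensorProduct.map comul LinearMap.id ∘ₗ comul =
    TensorProduct.map LinearMap.id comul ∘ₗ comul
  counit_comul : ∀ a : Tot V,
    TensorProduct.lid K (Tot V) (TensorProduct.map counit LinearMap.id (comul a)) = a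
  comul_counit : ∀ a : Tot V,
    TensorProduct.rid K (Tot V) (TensorProduct.map LinearMap.id counit (comul a)) = a

/-- A graded bialgebra: coproduct and counit are morphisms of graded algebras. -/
structure GrBialg extends GrAlg K V, GrCoalg K V where
  comul_mul : ∀ a b : Tot V,
    comul (mul (a ⊗ₜ b)) = tensorMul K V mul (comul a ⊗ₜ comul b)
  comul_one : comul one = one ⊗ₜ one
  counit_mul : ∀ a b : Tot V, counit (mul (a ⊗ₜ b)) = counit a * counit b
  counit_one : counit one = 1

variable {K V}

/-- `d` is a differential and a derivation. -/
structure IsDGAlg (d : Tot V →ₗ[K] Tot V) (A : GrAlg K V) : Prop where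
  d_sq : d ∘ₗ d = 0
  leibniz : d ∘ₗ A.mul = A.mul ∘ₗ tensorD K V d

/-- `d` is a differential and a coderivation. -/
structure IsDGCoalg (d : Tot V →ₗ[K] Tot V) (C : GrCoalg K V) : Prop where
  d_sq : d ∘ₗ d = 0
  coleibniz : C.comul ∘ₗ d = tensorD K V d ∘ₗ C.comul

/-- `d` is a differential, a derivation and a coderivation. -/
structure IsDGBialg (d : Tot V →ₗ[K] Tot V) (B : GrBialg K V) : Prop where
  alg : IsDGAlg d B.toGrAlg
  coalg : IsDGCoalg d B.toGrCoalg

/-! ### Homology -/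

/-- The (co)cycles of degree `n`. -/
def cyc (d : Tot V →ₗ[K] Tot V) (n : ℕ) : Submodule K (V n) := LinearMap.ker (d ∘ₗ inc K V n)

/-- The (co)boundaries of degree `n`. -/
def bdry (d : Tot V →ₗ[K] Tot V) (n : ℕ) : Submodule K (V n) :=
  (LinearMap.range d).comap (inc K V n)

/-- The degree `n` (co)homology. -/
abbrev Hlgy (d : Tot V →ₗ[K] Tot V) (n : ℕ) : Type w :=
  (cyc d n) ⧸ (bdry d n).submoduleOf (cyc d n)

/-- The graded module of (co)cycles. -/
abbrev Cyc (d : Tot V →ₗ[K] Tot V) (n : ℕ) : Type w := cyc d n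

/-- The inclusion of the (co)cycles. -/
def cycInc (d : Tot V →ₗ[K] Tot V) : Tot (Cyc d) →ₗ[K] Tot V :=
  DirectSum.lmap (fun n => (cyc d n).subtype)

/-- The (co)homology class of a (co)cycle. -/
def cls (d : Tot V →ₗ[K] Tot V) : Tot (Cyc d) →ₗ[K] Tot (Hlgy d) :=
  DirectSum.lmap (fun n => ((bdry d n).submoduleOf (cyc d n)).mkQ)

/-- The product `H` on (co)homology is induced by the product `A`: products of (co)cycles are
(co)cycles, and `[a][b] = [ab]`, `1 = [1]`. -/
structure InducesMul (d : Tot V →ₗ[K] Tot V) (A : GrAlg K V) (H : GrAlg K (Hlgy d)) : Prop where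
  mul : ∀ a b : Tot (Cyc d), ∃ c : Tot (Cyc d),
    cycInc d c = A.mul (cycInc d a ⊗ₜ cycInc d b) ∧ cls d c = H.mul (cls d a ⊗ₜ cls d b)
  one : ∃ e : Tot (Cyc d), cycInc d e = A.one ∧ cls d e = H.one

/-- The coproduct `H` on homology is induced by the coproduct `C`: for a cycle `z`, the element
`Δ z` agrees with some `w ∈ Ker d ⊗ Ker d` up to `Im d ⊗ V + V ⊗ Im d`, and `Δ [z] = [w]`;
moreover `ε [z] = ε z`. -/
structure InducesComul (d : Tot V →ₗ[K] Tot V) (C : GrCoalg K V) (H : GrCoalg K (Hlgy d)) :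
    Prop where
  comul : ∀ z : Tot (Cyc d), ∃ w : Tot (Cyc d) ⊗[K] Tot (Cyc d),
    C.comul (cycInc d z) - TensorProduct.map (cycInc d) (cycInc d) w ∈
      LinearMap.range (TensorProduct.map d (LinearMap.id : Tot V →ₗ[K] Tot V)) ⊔
        LinearMap.range (TensorProduct.map (LinearMap.id : Tot V →ₗ[K] Tot V) d) ∧
    H.comul (cls d z) = TensorProduct.map (cls d) (cls d) w
  counit : ∀ z : Tot (Cyc d), H.counit (cls d z) = C.counit (cycInc d z)

/-! ### Graded duals -/

variable (K V) in
/-- The graded dual. -/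
abbrev GrDual (n : ℕ) : Type (max w v) := Module.Dual K (V n)

variable (K V) in
/-- The evaluation of the graded dual on the graded module; `Hom(V n, K)` vanishes on `V m` for
`m ≠ n`. -/
def ev : Tot (GrDual K V) →ₗ[K] Module.Dual K (Tot V) :=
  DirectSum.toModule K ℕ (Module.Dual K (Tot V)) (fun n => (DirectSum.component K ℕ V n).dualMap)

variable (K V) in
/-- The Koszul evaluation `(f ⊗ g)(a ⊗ b) = (-1)^(|g||a|) f(a) g(b)`.  Since `f(a) = 0` unless
`|a| = |f|`, the sign is `(-1)^(|f||g|)`. -/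
def evTensor : (Tot (GrDual K V) ⊗[K] Tot (GrDual K V)) →ₗ[K]
    Module.Dual K (Tot V ⊗[K] Tot V) :=
  TensorProduct.dualDistrib K (Tot V) (Tot V) ∘ₗ TensorProduct.map (ev K V) (ev K V) ∘ₗ
    koszulSign K (oddPart K (GrDual K V)) (oddPart K (GrDual K V))

/-- The dual differential `d* f = (-1)^|f| f ∘ d` of a differential `d` of degree `-1`. -/
def codiff (d : Tot V →ₗ[K] Tot V) : Tot (GrDual K V) →ₗ[K] Tot (GrDual K V) :=
  DirectSum.toModule K ℕ _ (fun n => ((-1 : K) ^ n) • (inc K (GrDual K V) (n + 1) ∘ₗ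
    (DirectSum.component K ℕ V n ∘ₗ d ∘ₗ inc K V (n + 1)).dualMap))

/-- `cup` is the convolution product dual to the coproduct of `C`:
`f ⌣ g = (f ⊗ g) ∘ Δ`, with unit `ε`. -/
structure IsCup (C : GrCoalg K V) (cup : GrAlg K (GrDual K V)) : Prop where
  mul : ∀ f g : Tot (GrDual K V), ev K V (cup.mul (f ⊗ₜ g)) = evTensor K V (f ⊗ₜ g) ∘ₗ C.comul
  one : ev K V cup.one = C.counit

/-- The product of two functionals on the tensor square of a coalgebra:
`F * G = (F ⊗ G) ∘ Δ`, where `Δ` is the coproduct of the tensor square coalgebra and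
`(F ⊗ G)(s ⊗ t) = (-1)^(|s||t|) F(s) G(t)`. -/
def convTensor (C : GrCoalg K V) (F G : Module.Dual K (Tot V ⊗[K] Tot V)) :
    Module.Dual K (Tot V ⊗[K] Tot V) :=
  TensorProduct.dualDistrib K (Tot V ⊗[K] Tot V) (Tot V ⊗[K] Tot V) (F ⊗ₜ G) ∘ₗ
    koszulSign K (oddPartTensor K V) (oddPartTensor K V) ∘ₗ
    koszulMiddle K V ∘ₗ TensorProduct.map C.comul C.comul

/-- The transpose of the product, `(δ f)(a ⊗ b) = f(ab)`, with values in the completed tensor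
square of the graded dual, that is in the functionals on the tensor square. -/
def transposeMul (A : GrAlg K V) :
    Tot (GrDual K V) →ₗ[K] Module.Dual K (Tot V ⊗[K] Tot V) :=
  A.mul.dualMap ∘ₗ ev K V

/-- The transpose `δ` of the product of `B` and the cup product make the graded dual of `B` a
d.g. bialgebra, the target of `δ` being the completed tensor square. -/
structure IsCompletedDGBialg (d : Tot V →ₗ[K] Tot V) (B : GrBialg K V)
    (cup : GrAlg K (GrDual K V)) : Prop where
  /-- the product of the completed tensor square extends that of the tensor square -/
  extends_mul : ∀ s t : Tot (GrDual K V) ⊗[K] Tot (GrDual K V),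
    evTensor K V (tensorMul K (GrDual K V) cup.mul (s ⊗ₜ t)) =
      convTensor B.toGrCoalg (evTensor K V s) (evTensor K V t)
  comul_deg : ∀ (n p q : ℕ) (f : GrDual K V n) (a : V p) (b : V q), p + q ≠ n →
    transposeMul B.toGrAlg (inc K (GrDual K V) n f) (inc K V p a ⊗ₜ inc K V q b) = 0
  comul_mul : ∀ f g : Tot (GrDual K V),
    transposeMul B.toGrAlg (cup.mul (f ⊗ₜ g)) =
      convTensor B.toGrCoalg (transposeMul B.toGrAlg f) (transposeMul B.toGrAlg g)
  comul_one : transposeMul B.toGrAlg cup.one = evTensor K V (cup.one ⊗ₜ cup.one)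
  coassoc : ∀ f : Tot (GrDual K V),
    transposeMul B.toGrAlg f ∘ₗ TensorProduct.map B.mul LinearMap.id =
      transposeMul B.toGrAlg f ∘ₗ TensorProduct.map LinearMap.id B.mul ∘ₗ
        (TensorProduct.assoc K (Tot V) (Tot V) (Tot V)).toLinearMap
  counit_comul : ∀ (f : Tot (GrDual K V)) (a : Tot V),
    transposeMul B.toGrAlg f (B.one ⊗ₜ a) = ev K V f a
  comul_counit : ∀ (f : Tot (GrDual K V)) (a : Tot V),
    transposeMul B.toGrAlg f (a ⊗ₜ B.one) = ev K V f a
  counit_mul : ∀ f g : Tot (GrDual K V),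
    ev K V (cup.mul (f ⊗ₜ g)) B.one = ev K V f B.one * ev K V g B.one
  counit_one : ev K V cup.one B.one = 1
  /-- `δ (d* f) = (-1)^|f| (δ f) ∘ (d ⊗ 1 + 1 ⊗ d)` -/
  coleibniz : ∀ f : Tot (GrDual K V),
    transposeMul B.toGrAlg (codiff d f) =
      transposeMul B.toGrAlg (signMap K (GrDual K V) f) ∘ₗ tensorD K V d

/-- The coproduct `H` on the cohomology of the graded dual of `A` is the transpose of the product
on homology: if `Δ [z] = [w]` with `w` a tensor of cocycles, then `w (a ⊗ b) = z (ab)` for all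
cycles `a`, `b`; the counit is `[z] ↦ z(1)`. -/
structure InducesDualComul (d : Tot V →ₗ[K] Tot V) (A : GrAlg K V)
    (H : GrCoalg K (Hlgy (codiff d))) : Prop where
  comul : ∀ z : Tot (Cyc (codiff d)), ∃ w : Tot (Cyc (codiff d)) ⊗[K] Tot (Cyc (codiff d)),
    H.comul (cls (codiff d) z) = TensorProduct.map (cls (codiff d)) (cls (codiff d)) w ∧
    ∀ a b : Tot (Cyc d),
      evTensor K V (TensorProduct.map (cycInc (codiff d)) (cycInc (codiff d)) w)
        (cycInc d a ⊗ₜ cycInc d b) =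
      ev K V (cycInc (codiff d) z) (A.mul (cycInc d a ⊗ₜ cycInc d b))
  counit : ∀ z : Tot (Cyc (codiff d)),
    H.counit (cls (codiff d) z) = ev K V (cycInc (codiff d) z) A.one

end Graded

/-! ### Shelves, the structure monoid, and the rack complexes

In terms of Mathlib's left operation, `x ^ y = x ◁ y` is `Shelf.act y x`. -/

section Shelves

variable (K : Type v) [CommRing K] (X : Type u) [Shelf X]

/-- The right operation `x ^ y = x ◁ y` of a shelf. -/
abbrev shelfPow {X : Type u} [Shelf X] (x y : X) : X := Shelf.act y x

/-- The defining relations `y x^y = x y` of the structure monoid. -/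
inductive StructRel : FreeMonoid X → FreeMonoid X → Prop
  | rel (x y : X) :
      StructRel (FreeMonoid.of y * FreeMonoid.of (shelfPow x y)) (FreeMonoid.of x * FreeMonoid.of y)

/-- The structure monoid `M(X) = ⟨X : y x^y = x y⟩`. -/
abbrev StructMonoid : Type u := PresentedMonoid (StructRel X)

variable {X} in
/-- The generator of the structure monoid given by an element of the shelf. -/
abbrev gen (x : X) : StructMonoid X := PresentedMonoid.of (StructRel X) x

/-- A set `S` with an action of the shelf `X`: `(s ◂ y) ◂ z = (s ◂ z) ◂ y^z`. -/
class ShelfSet (S : Type u) where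
  act : S → X → S
  act_act : ∀ (s : S) (y z : X), act (act s y) z = act (act s z) (shelfPow y z)

/-- The one-point set. -/
abbrev Pt (_ : Type u) : Type u := PUnit

/-- The one-point set with the trivial action. -/
instance trivialShelfSet : ShelfSet X (Pt X) where
  act _ _ := PUnit.unit
  act_act _ _ _ := rfl

/-- The structure monoid with the action by concatenation. -/
instance structMonoidShelfSet : ShelfSet X (StructMonoid X) where
  act a x := a * gen x
  act_act a y z := by
    have h : gen z * gen (shelfPow y z) = gen y * gen z :=
      PresentedMonoid.mk_eq_mk_of_rel (StructRel.rel y z)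
    rw [mul_assoc, mul_assoc, h]

/-- `C_n(X, S)` with coefficients in `K`: the free module on `S × X^n`. -/
abbrev Chain (S : Type u) (n : ℕ) : Type (max u v) := (S × (Fin n → X)) →₀ K

variable {X} in
/-- `(x_1, …, x_{n+1}) ↦ (x_1^{x_i}, …, x_{i-1}^{x_i}, x_{i+1}, …, x_{n+1})`. -/
def face {n : ℕ} (i : Fin (n + 1)) (x : Fin (n + 1) → X) : Fin n → X :=
  fun j => if j.castSucc < i then shelfPow (x (i.succAbove j)) (x i) else x (i.succAbove j)

/-- The rack differential `C_{n+1}(X, S) → C_n(X, S)`.  Indices start at `0`, so the sign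
`(-1)^(i-1)` becomes `(-1)^i`. -/
def chainD (S : Type u) [ShelfSet X S] (n : ℕ) : Chain K X S (n + 1) →ₗ[K] Chain K X S n :=
  Finsupp.linearCombination K (fun c : S × (Fin (n + 1) → X) =>
    ∑ i : Fin (n + 1), ((-1 : K) ^ (i : ℕ)) •
      (Finsupp.single (c.1, i.removeNth c.2) (1 : K) -
        Finsupp.single (ShelfSet.act c.1 (c.2 i), face i c.2) (1 : K)))

/-- The rack differential on the total space. -/
def rackD (S : Type u) [ShelfSet X S] : Tot (Chain K X S) →ₗ[K] Tot (Chain K X S) :=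
  DirectSum.toModule K ℕ _ (fun n => match n with
    | 0 => 0
    | n + 1 => inc K (Chain K X S) n ∘ₗ chainD K X S n)

variable {X} in
/-- The basis element `s x_1 ⋯ x_n`. -/
def cell {S : Type u} {n : ℕ} (s : S) (x : Fin n → X) : Tot (Chain K X S) :=
  inc K (Chain K X S) n (Finsupp.single (s, x) 1)

/-- The map `C(X, M(X)) → C(X)`, `a x_1 ⋯ x_n ↦ x_1 ⋯ x_n`. -/
def forget : Tot (Chain K X (StructMonoid X)) →ₗ[K] Tot (Chain K X (Pt X)) :=
  DirectSum.lmap (fun _ => Finsupp.lmapDomain K K (fun c => (PUnit.unit, c.2)))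

variable {K X} in
/-- The bialgebra structure on `C(X, M(X))` transported from
`B(X) = ⟨x, e_y : y x^y = x y, y e_{x^y} = e_x y⟩`, where `Δ x = x ⊗ x`,
`Δ e_x = e_x ⊗ x + 1 ⊗ e_x`, `ε x = 1`, `ε e_x = 0`, along the bijection
`a x_1 ⋯ x_n ↔ a e_{x_1} ⋯ e_{x_n}` for `a ∈ M(X)`. -/
structure IsRackBialg (B : GrBialg K (Chain K X (StructMonoid X))) : Prop where
  one_eq : B.one = cell K 1 ![]
  monoid_mul : ∀ (a b : StructMonoid X) (n : ℕ) (x : Fin n → X),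
    B.mul (cell K a ![] ⊗ₜ cell K b x) = cell K (a * b) x
  mul_e : ∀ (a : StructMonoid X) (n : ℕ) (x : Fin n → X) (y : X),
    B.mul (cell K a x ⊗ₜ cell K 1 ![y]) = cell K a (Fin.snoc x y : Fin (n + 1) → X)
  e_mul : ∀ x y : X,
    B.mul (cell K 1 ![x] ⊗ₜ cell K (gen y) ![]) = cell K (gen y) ![shelfPow x y]
  comul_gen : ∀ x : X,
    B.comul (cell K (gen x) ![]) = cell K (gen x) ![] ⊗ₜ cell K (gen x) ![]
  comul_e : ∀ x : X,
    B.comul (cell K 1 ![x]) =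
      cell K 1 ![x] ⊗ₜ cell K (gen x) ![] + cell K 1 ![] ⊗ₜ cell K 1 ![x]
  counit_gen : ∀ x : X, B.counit (cell K (gen x) ![]) = 1
  counit_e : ∀ x : X, B.counit (cell K 1 ![x]) = 0

variable {K X} in
/-- The coalgebra structure on `C(X)` is the quotient of that of `C(X, M(X))`. -/
structure IsRackCoalg (B : GrBialg K (Chain K X (StructMonoid X)))
    (C : GrCoalg K (Chain K X (Pt X))) : Prop where
  comul : C.comul ∘ₗ forget K X = TensorProduct.map (forget K X) (forget K X) ∘ₗ B.comul
  counit : C.counit ∘ₗ forget K X = B.counit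

/-- The rack differential of `C(X)`. -/
abbrev dPt : Tot (Chain K X (Pt X)) →ₗ[K] Tot (Chain K X (Pt X)) := rackD K X (Pt X)

/-- The rack differential of `C(X, M(X))`. -/
abbrev dM : Tot (Chain K X (StructMonoid X)) →ₗ[K] Tot (Chain K X (StructMonoid X)) :=
  rackD K X (StructMonoid X)

end Shelves

end RackCohom

end

open RackCohom

open scoped DirectSum TensorProduct

noncomputable section

namespace RackCohom

universe u v

/-! ### Extensionality and signs on graded modules -/

section GradedBasics

variable {K : Type*} [CommRing K] {V : ℕ → Type*} [∀ n, AddCommGroup (V n)]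
  [∀ n, Module K (V n)]

/-! On C(X, M) everything is governed by two right multiplications: by e_y (`snocOp`) and by an
element b of M (`rmulOp`), which satisfy (c e_y) b = (c b) e_{y^b}. Product and coproduct are
defined recursively on the normal form a e_{x_1} ⋯ e_{x_n}, the coproduct by Δ(c e_y) = Δ(c) Δ(e_y).
The rack differential is determined by ∂(c e_y) = ∂(c) e_y + (-1)^|c| (c - c y), that is, ∂ e_y = 1
- y. Since every cell arises from degree 0 by successive right multiplications by e_y, almost every
identity follows from `chain_hom_ext_snoc`: it holds in degree 0, and both sides react in the same
way to e_y. Compatibility of ∂ with Δ reduces to (1 - y) ⊗ y + 1 ⊗ (1 - y) = 1 ⊗ 1 - y ⊗ y.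
Forgetting the M-coordinate is compatible with all of this and gives the coalgebra C(X).

The cochain statements are transposes. The graded dual embeds in the full dual (`ev_injective`), so
identities between cochains are checked on chains; the axioms for the cup product come from those of
Δ, and the axioms for δ from those of the product. With functionals on the tensor square as target
of δ, no finiteness is needed.

Products pass to (co)homology over any ring by the Leibniz rule. Coproducts need H(C ⊗ C) to be H(C)
⊗ H(C), which over a field is replaced by an explicit contraction (i, p, h) of the complex onto its
homology (`Lowers.nonempty_contraction`): the coproduct on homology is (p ⊗ p) Δ i. Since p ⊗ p
kills boundaries of the tensor square, the error terms involving h disappear and the bialgebra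
axioms descend.

For cohomology, the contraction identifies H^* with the graded dual of H_*
(`Contraction.exists_cohomology_equiv`). The transposed product lands in the algebraic tensor square
as soon as each H_n is finite dimensional, and this is the point where X must be finite
(`finite_homology`). The complex itself is not of finite type, because M may be infinite. But M acts
trivially on homology: for a cycle z, ∂(e_y z) = z - y z. Twisting by an element b whose action on X
has the smallest possible image Y moves cycles, up to boundaries, to chains with coefficients in the
submonoid generated by Y. Elements of Y permute Y, so their N-th powers commute for suitable N, and
these chains form a finite module over the commutative Noetherian ring generated by the y^N. The
cycles are then finitely generated over this ring, which acts on homology through scalars, so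
homology is finitely generated over K. -/

theorem tot_hom_ext {W : Type*} [AddCommGroup W] [Module K W] {f g : Tot V →ₗ[K] W}
    (h : ∀ (n : ℕ) (a : V n), f (inc K V n a) = g (inc K V n a)) : f = g :=
  DirectSum.linearMap_ext _ fun n => LinearMap.ext (h n)

theorem tot_tensor_ext {V' : ℕ → Type*} [∀ n, AddCommGroup (V' n)] [∀ n, Module K (V' n)]
    {W : Type*} [AddCommGroup W] [Module K W] {f g : (Tot V ⊗[K] Tot V') →ₗ[K] W}
    (h : ∀ (p q : ℕ) (a : V p) (b : V' q),
      f (inc K V p a ⊗ₜ inc K V' q b) = g (inc K V p a ⊗ₜ inc K V' q b)) : f = g :=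
  TensorProduct.ext (tot_hom_ext fun p a => tot_hom_ext fun q b => h p q a b)

theorem tot_tensor_ext_four {W : Type*} [AddCommGroup W] [Module K W]
    {f g : ((Tot V ⊗[K] Tot V) ⊗[K] (Tot V ⊗[K] Tot V)) →ₗ[K] W}
    (h : ∀ (p q r s : ℕ) (a : V p) (b : V q) (a' : V r) (b' : V s),
      f ((inc K V p a ⊗ₜ inc K V q b) ⊗ₜ (inc K V r a' ⊗ₜ inc K V s b')) =
        g ((inc K V p a ⊗ₜ inc K V q b) ⊗ₜ (inc K V r a' ⊗ₜ inc K V s b'))) : f = g :=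
  TensorProduct.ext (tot_tensor_ext fun p q a b => tot_tensor_ext fun r s a' b' =>
    h p q r s a b a' b')

@[simp] theorem signMap_inc (n : ℕ) (a : V n) :
    signMap K V (inc K V n a) = (-1 : K) ^ n • inc K V n a := by
  simp [signMap, DirectSum.lmap_lof]

theorem oddPart_inc (n : ℕ) (a : V n) :
    oddPart K V (inc K V n a) = if Odd n then inc K V n a else 0 := by
  rw [oddPart, DirectSum.lmap_lof]
  split_ifs <;> simp

@[simp] theorem signMap_signMap (v : Tot V) : signMap K V (signMap K V v) = v := by
  have : signMap K V ∘ₗ signMap K V = LinearMap.id := tot_hom_ext fun n a => by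
    simp [smul_smul, ← mul_pow]
  exact LinearMap.congr_fun this v

/-- On odd ⊗ odd the operator is 1 - 2 = -1, elsewhere it is 1. Only the parities of the two
elements enter, so the lemma serves equally for `oddPart`, for `oddPartTensor` and for tensors of
these with the identity. -/
theorem koszulSign_tmul_of_parity {A B : Type*} [AddCommGroup A] [AddCommGroup B] [Module K A]
    [Module K B] {P : A →ₗ[K] A} {Q : B →ₗ[K] B} {a : A} {b : B} {p q : ℕ}
    (ha : P a = if Odd p then a else 0) (hb : Q b = if Odd q then b else 0) :
    koszulSign K P Q (a ⊗ₜ b) = (-1 : K) ^ (p * q) • (a ⊗ₜ[K] b) := by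
  rw [koszulSign_tmul, ha, hb]
  by_cases hp : Odd p <;> by_cases hq : Odd q
  · rw [if_pos hp, if_pos hq, (hp.mul hq).neg_one_pow]
    module
  all_goals
    have : Even (p * q) := by grind
    simp [hp, hq, this.neg_one_pow]

theorem oddPartTensor_inc (p q : ℕ) (a b) :
    oddPartTensor K V (inc K V p a ⊗ₜ inc K V q b) =
      if Odd (p + q) then inc K V p a ⊗ₜ inc K V q b else 0 := by
  simp only [oddPartTensor, LinearMap.sub_apply, LinearMap.add_apply, LinearMap.smul_apply,
    TensorProduct.map_tmul, oddPart_inc, LinearMap.id_apply]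
  by_cases hp : Odd p <;> by_cases hq : Odd q
  · rw [if_pos hp, if_pos hq, if_neg (by simpa using hp.add_odd hq)]
    module
  · simp [hp, hq, hp.add_even (Nat.not_odd_iff_even.1 hq)]
  · simp [hp, hq, (Nat.not_odd_iff_even.1 hp).add_odd hq]
  · simp [hp, hq, (Nat.not_odd_iff_even.1 hp).add (Nat.not_odd_iff_even.1 hq)]

theorem koszulMiddle_inc (p q r s : ℕ) (a b a' b') :
    koszulMiddle K V ((inc K V p a ⊗ₜ inc K V q b) ⊗ₜ (inc K V r a' ⊗ₜ inc K V s b')) =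
      (-1 : K) ^ (q * r) •
        ((inc K V p a ⊗ₜ inc K V r a') ⊗ₜ (inc K V q b ⊗ₜ[K] inc K V s b')) := by
  rw [koszulMiddle, LinearMap.comp_apply, koszulSign_tmul_of_parity (p := q) (q := r)]
  · simp
  · rw [TensorProduct.map_tmul, oddPart_inc]; split_ifs <;> simp
  · rw [TensorProduct.map_tmul, oddPart_inc]; split_ifs <;> simp

theorem tensorMul_inc (mul : (Tot V ⊗[K] Tot V) →ₗ[K] Tot V) (p q r s : ℕ) (a b a' b') :
    tensorMul K V mul ((inc K V p a ⊗ₜ inc K V q b) ⊗ₜ (inc K V r a' ⊗ₜ inc K V s b')) =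
      (-1 : K) ^ (q * r) •
        (mul (inc K V p a ⊗ₜ inc K V r a') ⊗ₜ[K] mul (inc K V q b ⊗ₜ inc K V s b')) := by
  rw [tensorMul, LinearMap.comp_apply, koszulMiddle_inc]
  simp

theorem koszulSign_oddPartTensor_inc (p q r s : ℕ) (a b a' b') :
    koszulSign K (oddPartTensor K V) (oddPartTensor K V)
      ((inc K V p a ⊗ₜ inc K V q b) ⊗ₜ (inc K V r a' ⊗ₜ inc K V s b')) =
      (-1 : K) ^ ((p + q) * (r + s)) •
        ((inc K V p a ⊗ₜ inc K V q b) ⊗ₜ (inc K V r a' ⊗ₜ[K] inc K V s b')) :=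
  koszulSign_tmul_of_parity (oddPartTensor_inc _ _ _ _) (oddPartTensor_inc _ _ _ _)

/-- Taking φ to be a quotient map composed with an operator turns claims such as "this operator
respects tensor degrees" into checks on homogeneous tensors. -/
theorem tensorDeg_le_ker {W : Type*} [AddCommGroup W] [Module K W]
    {φ : (Tot V ⊗[K] Tot V) →ₗ[K] W} {n : ℕ}
    (h : ∀ (p q : ℕ) (a : V p) (b : V q), p + q = n → φ (inc K V p a ⊗ₜ inc K V q b) = 0) :
    tensorDeg K V n ≤ LinearMap.ker φ := by
  refine iSup_le fun ⟨⟨p, q⟩, hpq⟩ => ?_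
  rw [LinearMap.range_le_ker_iff]
  exact TensorProduct.ext' fun a b => by simpa using h p q a b hpq

theorem tmul_mem_tensorDeg {n : ℕ} (p q : ℕ) (hpq : p + q = n) (a : V p) (b : V q) :
    inc K V p a ⊗ₜ[K] inc K V q b ∈ tensorDeg K V n :=
  Submodule.mem_iSup_of_mem ⟨(p, q), hpq⟩ ⟨a ⊗ₜ b, by simp⟩

end GradedBasics

/-! ### Evaluation of the graded dual -/

section Evaluation

variable {K : Type*} [CommRing K] {V : ℕ → Type*} [∀ n, AddCommGroup (V n)]
  [∀ n, Module K (V n)]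

@[simp] theorem ev_inc_inc (n : ℕ) (f : GrDual K V n) (a : V n) :
    ev K V (inc K (GrDual K V) n f) (inc K V n a) = f a := by
  simp [ev, DirectSum.component.lof_self]

theorem ev_inc_of_ne {m n : ℕ} (h : m ≠ n) (f : GrDual K V n) (a : V m) :
    ev K V (inc K (GrDual K V) n f) (inc K V m a) = 0 := by
  simp [ev, DirectSum.component.of, h]

theorem ev_apply_inc (F : Tot (GrDual K V)) (n : ℕ) (a : V n) :
    ev K V F (inc K V n a) = DirectSum.component K ℕ (GrDual K V) n F a := by
  have : (LinearMap.applyₗ (inc K V n a)) ∘ₗ ev K V =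
      (LinearMap.applyₗ a) ∘ₗ DirectSum.component K ℕ (GrDual K V) n :=
    tot_hom_ext fun m f => by
      rcases eq_or_ne n m with rfl | h
      · simp [DirectSum.component.lof_self]
      · simp [DirectSum.component.of, ev_inc_of_ne h, h.symm]
  exact LinearMap.congr_fun this F

/-- Each component of a graded functional is its restriction to one degree. This allows identities
in the graded dual to be verified in the full dual, where composition of linear maps is available.
-/
theorem ev_injective : Function.Injective (ev K V) := by
  intro F G h
  refine DirectSum.ext_component K fun n => LinearMap.ext fun a => ?_
  rw [← ev_apply_inc, ← ev_apply_inc, h]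

theorem ev_inc_comp_inc {φ : Module.Dual K (Tot V)} {n : ℕ}
    (h : ∀ m ≠ n, ∀ a : V m, φ (inc K V m a) = 0) :
    ev K V (inc K (GrDual K V) n (φ ∘ₗ inc K V n)) = φ :=
  tot_hom_ext fun m a => by
    rcases eq_or_ne m n with rfl | hm
    · simp
    · rw [ev_inc_of_ne hm, h m hm]

theorem ev_signMap (F : Tot (GrDual K V)) :
    ev K V (signMap K (GrDual K V) F) = ev K V F ∘ₗ signMap K V := by
  have : ev K V ∘ₗ signMap K (GrDual K V) = (signMap K V).dualMap ∘ₗ ev K V :=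
    tot_hom_ext fun n f => tot_hom_ext fun m a => by
      rcases eq_or_ne m n with rfl | hm
      · simp
      · simp [ev_inc_of_ne hm]
  exact LinearMap.congr_fun this F

theorem evTensor_inc (p q : ℕ) (f : GrDual K V p) (g : GrDual K V q) :
    evTensor K V (inc K _ p f ⊗ₜ inc K _ q g) = (-1 : K) ^ (p * q) •
      TensorProduct.dualDistrib K (Tot V) (Tot V)
        (ev K V (inc K _ p f) ⊗ₜ ev K V (inc K _ q g)) := by
  rw [evTensor, LinearMap.comp_apply, LinearMap.comp_apply,
    koszulSign_tmul_of_parity (oddPart_inc p f) (oddPart_inc q g)]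
  simp

theorem dualDistrib_comp_map {A B A' B' : Type*} [AddCommGroup A] [AddCommGroup B]
    [AddCommGroup A'] [AddCommGroup B'] [Module K A] [Module K B] [Module K A'] [Module K B']
    (φ : Module.Dual K A') (ψ : Module.Dual K B') (f : A →ₗ[K] A') (g : B →ₗ[K] B') :
    TensorProduct.dualDistrib K A' B' (φ ⊗ₜ ψ) ∘ₗ TensorProduct.map f g =
      TensorProduct.dualDistrib K A B ((φ ∘ₗ f) ⊗ₜ (ψ ∘ₗ g)) :=
  TensorProduct.ext' fun a b => by simp

end Evaluation

/-! ### The cup product dual to a graded coalgebra -/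

section Cup

variable {K : Type*} [CommRing K] {V : ℕ → Type*} [∀ n, AddCommGroup (V n)]
  [∀ n, Module K (V n)]

theorem tot_tensor_ext_three {W : Type*} [AddCommGroup W] [Module K W]
    {f g : ((Tot V ⊗[K] Tot V) ⊗[K] Tot V) →ₗ[K] W}
    (h : ∀ (p q r : ℕ) (a : V p) (b : V q) (c : V r),
      f ((inc K V p a ⊗ₜ inc K V q b) ⊗ₜ inc K V r c) =
        g ((inc K V p a ⊗ₜ inc K V q b) ⊗ₜ inc K V r c)) : f = g :=
  TensorProduct.ext (tot_tensor_ext fun p q a b => tot_hom_ext fun r c => h p q r a b c)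

/-- Associativity of a product on the total space follows from that on homogeneous elements. -/
theorem mul_assoc_of_homogeneous (mul : (Tot V ⊗[K] Tot V) →ₗ[K] Tot V)
    (h : ∀ (p q r : ℕ) (a : V p) (b : V q) (c : V r),
      mul (mul (inc K V p a ⊗ₜ inc K V q b) ⊗ₜ inc K V r c) =
        mul (inc K V p a ⊗ₜ mul (inc K V q b ⊗ₜ inc K V r c))) (a b c : Tot V) :
    mul (mul (a ⊗ₜ b) ⊗ₜ c) = mul (a ⊗ₜ mul (b ⊗ₜ c)) := by
  have : mul ∘ₗ TensorProduct.map mul LinearMap.id =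
      mul ∘ₗ TensorProduct.map LinearMap.id mul ∘ₗ
        (TensorProduct.assoc K (Tot V) (Tot V) (Tot V)).toLinearMap :=
    tot_tensor_ext_three fun p q r a b c => by simpa using h p q r a b c
  simpa using LinearMap.congr_fun this ((a ⊗ₜ b) ⊗ₜ c)

theorem GrCoalg.dualDistrib_comul_of_ne (C : GrCoalg K V) {p q n : ℕ} (h : n ≠ p + q)
    (f : GrDual K V p) (g : GrDual K V q) (a : V n) :
    TensorProduct.dualDistrib K (Tot V) (Tot V) (ev K V (inc K _ p f) ⊗ₜ ev K V (inc K _ q g))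
      (C.comul (inc K V n a)) = 0 := by
  refine LinearMap.mem_ker.1 (tensorDeg_le_ker (fun p' q' a b hpq => ?_) (C.comul_deg n a))
  rw [TensorProduct.dualDistrib_apply]
  rcases eq_or_ne p' p with rfl | hp
  · rw [ev_inc_of_ne (m := q') (n := q) (by omega), mul_zero]
  · rw [ev_inc_of_ne hp, zero_mul]

theorem GrCoalg.exists_ev_eq_evTensor_comp_comul (C : GrCoalg K V) (p q : ℕ) (f : GrDual K V p)
    (g : GrDual K V q) :
    ∃ x, ev K V (inc K (GrDual K V) (p + q) x) =
      evTensor K V (inc K _ p f ⊗ₜ inc K _ q g) ∘ₗ C.comul := by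
  refine ⟨_, ev_inc_comp_inc fun m hm a => ?_⟩
  rw [evTensor_inc, LinearMap.comp_apply, LinearMap.smul_apply, C.dualDistrib_comul_of_ne hm,
    smul_zero]

theorem GrCoalg.evTensor_comp_comul_mem_range (C : GrCoalg K V)
    (s : Tot (GrDual K V) ⊗[K] Tot (GrDual K V)) :
    (C.comul.dualMap ∘ₗ evTensor K V) s ∈ LinearMap.range (ev K V) := by
  -- Composing with the quotient by the range turns membership into the vanishing of a linear map,
  -- which can be tested on homogeneous tensors.
  have : (LinearMap.range (ev K V)).mkQ ∘ₗ C.comul.dualMap ∘ₗ evTensor K V = 0 :=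
    tot_tensor_ext fun p q f g => by
      obtain ⟨x, hx⟩ := C.exists_ev_eq_evTensor_comp_comul p q f g
      exact (Submodule.Quotient.mk_eq_zero _).2 ⟨_, hx⟩
  exact (Submodule.Quotient.mk_eq_zero _).1 (LinearMap.congr_fun this s)

/-- The cup product. -/
def cupMul (C : GrCoalg K V) :
    (Tot (GrDual K V) ⊗[K] Tot (GrDual K V)) →ₗ[K] Tot (GrDual K V) :=
  LinearMap.codRestrictOfInjective (C.comul.dualMap ∘ₗ evTensor K V) (ev K V) ev_injective
    C.evTensor_comp_comul_mem_range

theorem ev_cupMul (C : GrCoalg K V) (s : Tot (GrDual K V) ⊗[K] Tot (GrDual K V)) :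
    ev K V (cupMul C s) = evTensor K V s ∘ₗ C.comul :=
  LinearMap.codRestrictOfInjective_comp_apply (C.comul.dualMap ∘ₗ evTensor K V) (ev K V)
    ev_injective C.evTensor_comp_comul_mem_range s

theorem cupMul_inc_mem (C : GrCoalg K V) (p q : ℕ) (f : GrDual K V p) (g : GrDual K V q) :
    cupMul C (inc K _ p f ⊗ₜ inc K _ q g) ∈ LinearMap.range (inc K (GrDual K V) (p + q)) := by
  obtain ⟨x, hx⟩ := C.exists_ev_eq_evTensor_comp_comul p q f g
  exact ⟨x, ev_injective (by rw [hx, ev_cupMul])⟩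

theorem ev_cupMul_inc (C : GrCoalg K V) (p q : ℕ) (f : GrDual K V p) (g : GrDual K V q) :
    ev K V (cupMul C (inc K _ p f ⊗ₜ inc K _ q g)) = (-1 : K) ^ (p * q) •
      (TensorProduct.dualDistrib K (Tot V) (Tot V)
        (ev K V (inc K _ p f) ⊗ₜ ev K V (inc K _ q g)) ∘ₗ C.comul) := by
  rw [ev_cupMul, evTensor_inc, LinearMap.smul_comp]

theorem ev_inc_counit (C : GrCoalg K V) :
    ev K V (inc K (GrDual K V) 0 (C.counit ∘ₗ inc K V 0)) = C.counit :=
  ev_inc_comp_inc fun m hm a => by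
    obtain ⟨m, rfl⟩ := Nat.exists_eq_succ_of_ne_zero hm
    exact C.counit_deg m a

/-- The sign-free form of associativity of convolution, a direct transpose of coassociativity. The
Koszul signs are added afterwards, on homogeneous elements. -/
theorem GrCoalg.dualDistrib_assoc (C : GrCoalg K V) (φ ψ χ : Module.Dual K (Tot V)) :
    TensorProduct.dualDistrib K (Tot V) (Tot V)
      ((TensorProduct.dualDistrib K (Tot V) (Tot V) (φ ⊗ₜ ψ) ∘ₗ C.comul) ⊗ₜ χ) ∘ₗ C.comul =
    TensorProduct.dualDistrib K (Tot V) (Tot V)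
      (φ ⊗ₜ (TensorProduct.dualDistrib K (Tot V) (Tot V) (ψ ⊗ₜ χ) ∘ₗ C.comul)) ∘ₗ C.comul := by
  have h1 := dualDistrib_comp_map (TensorProduct.dualDistrib K (Tot V) (Tot V) (φ ⊗ₜ ψ)) χ
    C.comul LinearMap.id
  have h2 := dualDistrib_comp_map φ (TensorProduct.dualDistrib K (Tot V) (Tot V) (ψ ⊗ₜ χ))
    LinearMap.id C.comul
  have h3 : TensorProduct.dualDistrib K (Tot V) (Tot V ⊗[K] Tot V)
      (φ ⊗ₜ TensorProduct.dualDistrib K (Tot V) (Tot V) (ψ ⊗ₜ χ)) ∘ₗ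
      (TensorProduct.assoc K (Tot V) (Tot V) (Tot V)).toLinearMap =
      TensorProduct.dualDistrib K (Tot V ⊗[K] Tot V) (Tot V)
        (TensorProduct.dualDistrib K (Tot V) (Tot V) (φ ⊗ₜ ψ) ⊗ₜ χ) :=
    TensorProduct.ext_threefold fun a b c => by simp [mul_assoc]
  rw [LinearMap.comp_id] at h1 h2
  rw [← h1, ← h2, LinearMap.comp_assoc, LinearMap.comp_assoc, ← C.coassoc, ← h3,
    LinearMap.comp_assoc]

theorem GrCoalg.dualDistrib_counit_left (C : GrCoalg K V) (φ : Module.Dual K (Tot V)) :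
    TensorProduct.dualDistrib K (Tot V) (Tot V) (C.counit ⊗ₜ φ) ∘ₗ C.comul = φ := by
  have h : TensorProduct.dualDistrib K (Tot V) (Tot V) (C.counit ⊗ₜ φ) =
      φ ∘ₗ (TensorProduct.lid K (Tot V)).toLinearMap ∘ₗ
        TensorProduct.map C.counit LinearMap.id :=
    TensorProduct.ext' fun a b => by simp
  refine LinearMap.ext fun a => ?_
  conv_rhs => rw [← C.counit_comul a]
  rw [h]
  rfl

theorem GrCoalg.dualDistrib_counit_right (C : GrCoalg K V) (φ : Module.Dual K (Tot V)) :
    TensorProduct.dualDistrib K (Tot V) (Tot V) (φ ⊗ₜ C.counit) ∘ₗ C.comul = φ := by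
  have h : TensorProduct.dualDistrib K (Tot V) (Tot V) (φ ⊗ₜ C.counit) =
      φ ∘ₗ (TensorProduct.rid K (Tot V)).toLinearMap ∘ₗ
        TensorProduct.map LinearMap.id C.counit :=
    TensorProduct.ext' fun a b => by simp [mul_comm]
  refine LinearMap.ext fun a => ?_
  conv_rhs => rw [← C.comul_counit a]
  rw [h]
  rfl

/-- The cup product algebra. -/
def cupAlg (C : GrCoalg K V) : GrAlg K (GrDual K V) where
  mul := cupMul C
  one := inc K (GrDual K V) 0 (C.counit ∘ₗ inc K V 0)
  mul_deg := cupMul_inc_mem C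
  one_deg := ⟨_, rfl⟩
  mul_assoc := mul_assoc_of_homogeneous _ fun p q r f g h => by
    -- The inner products have to be exhibited as homogeneous, so that the outer sign is known. The
    -- exponents pq + (p+q)r and qr + p(q+r) then agree.
    obtain ⟨x, hx⟩ := cupMul_inc_mem C p q f g
    obtain ⟨y, hy⟩ := cupMul_inc_mem C q r g h
    apply ev_injective
    rw [← hx, ← hy, ev_cupMul_inc, ev_cupMul_inc, hx, hy, ev_cupMul_inc, ev_cupMul_inc]
    simp only [← TensorProduct.smul_tmul', TensorProduct.tmul_smul, map_smul, LinearMap.smul_comp,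
      smul_smul, C.dualDistrib_assoc]
    congr 1
    ring
  one_mul F := by
    have : cupMul C ∘ₗ TensorProduct.mk K _ _ (inc K (GrDual K V) 0 (C.counit ∘ₗ inc K V 0)) =
        LinearMap.id := tot_hom_ext fun p f => ev_injective <| by
      rw [LinearMap.comp_apply, TensorProduct.mk_apply, ev_cupMul_inc, ev_inc_counit, zero_mul,
        pow_zero, one_smul]
      exact C.dualDistrib_counit_left _
    exact LinearMap.congr_fun this F
  mul_one F := by
    have : cupMul C ∘ₗ (TensorProduct.mk K _ _).flip
        (inc K (GrDual K V) 0 (C.counit ∘ₗ inc K V 0)) = LinearMap.id :=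
      tot_hom_ext fun p f => ev_injective <| by
        rw [LinearMap.comp_apply, LinearMap.flip_apply, TensorProduct.mk_apply, ev_cupMul_inc,
          ev_inc_counit, mul_zero, pow_zero, one_smul]
        exact C.dualDistrib_counit_right _
    exact LinearMap.congr_fun this F

theorem isCup_cupAlg (C : GrCoalg K V) : IsCup C (cupAlg C) where
  mul f g := ev_cupMul C (f ⊗ₜ g)
  one := ev_inc_counit C

end Cup

/-! ### The dual differential and the completed bialgebra -/

section Codiff

variable {K : Type*} [CommRing K] {V : ℕ → Type*} [∀ n, AddCommGroup (V n)]
  [∀ n, Module K (V n)]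

/-- `d` is homogeneous of degree `-1`, with components `δ`. -/
structure Lowers (d : Tot V →ₗ[K] Tot V) (δ : ∀ n, V (n + 1) →ₗ[K] V n) : Prop where
  zero : ∀ a : V 0, d (inc K V 0 a) = 0
  succ : ∀ (n : ℕ) (a : V (n + 1)), d (inc K V (n + 1) a) = inc K V n (δ n a)

variable {d : Tot V →ₗ[K] Tot V} {δ : ∀ n, V (n + 1) →ₗ[K] V n}

theorem Lowers.codiff_inc (hd : Lowers d δ) (n : ℕ) (f : GrDual K V n) :
    codiff d (inc K (GrDual K V) n f) =
      (-1 : K) ^ n • inc K (GrDual K V) (n + 1) (f ∘ₗ δ n) := by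
  have : DirectSum.component K ℕ V n ∘ₗ d ∘ₗ inc K V (n + 1) = δ n :=
    LinearMap.ext fun a => by simp [hd.succ, DirectSum.component.lof_self]
  rw [codiff, DirectSum.toModule_lof, this]
  rfl

theorem Lowers.ev_comp (hd : Lowers d δ) (n : ℕ) (f : GrDual K V n) :
    ev K V (inc K (GrDual K V) n f) ∘ₗ d = ev K V (inc K (GrDual K V) (n + 1) (f ∘ₗ δ n)) :=
  tot_hom_ext fun m a => by
    cases m with
    | zero => rw [LinearMap.comp_apply, hd.zero, map_zero, ev_inc_of_ne (by omega)]
    | succ m =>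
      rw [LinearMap.comp_apply, hd.succ]
      rcases eq_or_ne m n with rfl | h
      · simp
      · rw [ev_inc_of_ne h, ev_inc_of_ne (by omega)]

/-- For inhomogeneous functionals the factor (-1)^|f| has to be carried by `signMap`. -/
theorem Lowers.ev_codiff (hd : Lowers d δ) (F : Tot (GrDual K V)) :
    ev K V (codiff d F) = ev K V (signMap K (GrDual K V) F) ∘ₗ d := by
  have : ev K V ∘ₗ codiff d = d.dualMap ∘ₗ ev K V ∘ₗ signMap K (GrDual K V) :=
    tot_hom_ext fun n f => by
      simp only [LinearMap.comp_apply, signMap_inc, hd.codiff_inc, map_smul]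
      rw [← hd.ev_comp]
      rfl
  exact LinearMap.congr_fun this F

theorem Lowers.ev_codiff_inc (hd : Lowers d δ) (n : ℕ) (f : GrDual K V n) :
    ev K V (codiff d (inc K _ n f)) = (-1 : K) ^ n • (ev K V (inc K _ n f) ∘ₗ d) := by
  rw [hd.ev_codiff, signMap_inc, map_smul, LinearMap.smul_comp]

theorem Lowers.codiff_codiff (hd : Lowers d δ) (hsq : d ∘ₗ d = 0) : codiff d ∘ₗ codiff d = 0 :=
  tot_hom_ext fun n f => ev_injective <| by
    rw [LinearMap.comp_apply, hd.codiff_inc, map_smul, map_smul, hd.ev_codiff_inc, ← hd.ev_comp,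
      LinearMap.comp_assoc, hsq]
    simp

theorem Lowers.signMap_comp (hd : Lowers d δ) (v : Tot V) :
    d (signMap K V v) = - signMap K V (d v) := by
  have : d ∘ₗ signMap K V = - (signMap K V ∘ₗ d) := tot_hom_ext fun n a => by
    cases n with
    | zero => simp [hd.zero]
    | succ n => simp [hd.succ, pow_succ]
  exact LinearMap.congr_fun this v

theorem Lowers.signMap_codiff (hd : Lowers d δ) (F : Tot (GrDual K V)) :
    codiff d (signMap K (GrDual K V) F) = - signMap K (GrDual K V) (codiff d F) := by
  have : codiff d ∘ₗ signMap K (GrDual K V) = - (signMap K (GrDual K V) ∘ₗ codiff d) :=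
    tot_hom_ext fun n a => by
      simp [hd.codiff_inc, pow_succ]
  exact LinearMap.congr_fun this F

theorem ev_inc_comp_signMap (n : ℕ) (f : GrDual K V n) :
    ev K V (inc K _ n f) ∘ₗ signMap K V = (-1 : K) ^ n • ev K V (inc K _ n f) := by
  rw [← ev_signMap, signMap_inc, map_smul]

theorem IsCup.eq_cupAlg {C : GrCoalg K V} {cup : GrAlg K (GrDual K V)} (h : IsCup C cup) :
    cup.mul = cupMul C :=
  TensorProduct.ext' fun f g => ev_injective (by rw [h.mul, ev_cupMul])

/-- The transpose of the coderivation property: composing a convolution with d splits it into two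
convolutions, and the signs are matched on homogeneous cochains. -/
theorem Lowers.isDGAlg_codiff (hd : Lowers d δ) {C : GrCoalg K V} (hC : IsDGCoalg d C)
    {cup : GrAlg K (GrDual K V)} (hcup : IsCup C cup) : IsDGAlg (codiff d) cup where
  d_sq := hd.codiff_codiff hC.d_sq
  leibniz := by
    rw [hcup.eq_cupAlg]
    refine tot_tensor_ext fun p q f g => ev_injective ?_
    obtain ⟨x, hx⟩ := cupMul_inc_mem C p q f g
    have hco : ∀ φ ψ : Module.Dual K (Tot V),
        TensorProduct.dualDistrib K _ _ (φ ⊗ₜ ψ) ∘ₗ C.comul ∘ₗ d =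
          TensorProduct.dualDistrib K _ _ ((φ ∘ₗ d) ⊗ₜ ψ) ∘ₗ C.comul +
          TensorProduct.dualDistrib K _ _ ((φ ∘ₗ signMap K V) ⊗ₜ (ψ ∘ₗ d)) ∘ₗ C.comul := by
      intro φ ψ
      rw [hC.coleibniz, tensorD, LinearMap.add_comp, LinearMap.comp_add, ← LinearMap.comp_assoc,
        ← LinearMap.comp_assoc, dualDistrib_comp_map, dualDistrib_comp_map, LinearMap.comp_id]
    simp only [LinearMap.comp_apply, tensorD, LinearMap.add_apply, TensorProduct.map_tmul,
      LinearMap.id_apply, map_add, signMap_inc, hd.codiff_inc, ← TensorProduct.smul_tmul',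
      TensorProduct.tmul_smul, map_smul]
    rw [ev_cupMul_inc, ev_cupMul_inc, ← hd.ev_comp, ← hd.ev_comp, ← hx, hd.ev_codiff_inc, hx,
      ev_cupMul_inc, LinearMap.smul_comp, LinearMap.comp_assoc, hco, ev_inc_comp_signMap]
    simp only [← TensorProduct.smul_tmul', map_smul, LinearMap.smul_comp, smul_add, smul_smul]
    have hp : ((-1 : K) ^ p) * (-1) ^ p = 1 := by rw [← mul_pow]; simp
    have hq : ((-1 : K) ^ q) * (-1) ^ q = 1 := by rw [← mul_pow]; simp
    congr 2
    · ring_nf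
    · ring_nf

end Codiff

/-! ### The transposed product with values in the completed tensor square. -/

section Completed

variable {K : Type*} [CommRing K] {V : ℕ → Type*} [∀ n, AddCommGroup (V n)]
  [∀ n, Module K (V n)]

theorem IsCup.extends_mul {C : GrCoalg K V} {cup : GrAlg K (GrDual K V)} (hcup : IsCup C cup)
    (s t : Tot (GrDual K V) ⊗[K] Tot (GrDual K V)) :
    evTensor K V (tensorMul K (GrDual K V) cup.mul (s ⊗ₜ t)) =
      convTensor C (evTensor K V s) (evTensor K V t) := by
  have key : evTensor K V ∘ₗ tensorMul K (GrDual K V) cup.mul =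
      (koszulSign K (oddPartTensor K V) (oddPartTensor K V) ∘ₗ
        koszulMiddle K V ∘ₗ TensorProduct.map C.comul C.comul).dualMap ∘ₗ
      TensorProduct.dualDistrib K _ _ ∘ₗ TensorProduct.map (evTensor K V) (evTensor K V) := by
    rw [hcup.eq_cupAlg]
    refine tot_tensor_ext_four fun p₁ q₁ p₂ q₂ f₁ g₁ f₂ g₂ => ?_
    obtain ⟨x, hx⟩ := cupMul_inc_mem C p₁ p₂ f₁ f₂
    obtain ⟨y, hy⟩ := cupMul_inc_mem C q₁ q₂ g₁ g₂
    rw [LinearMap.comp_apply, tensorMul_inc, map_smul, ← hx, ← hy, evTensor_inc, hx, hy,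
      ev_cupMul_inc, ev_cupMul_inc]
    simp only [← TensorProduct.smul_tmul', TensorProduct.tmul_smul, map_smul, smul_smul]
    rw [← dualDistrib_comp_map]
    simp only [LinearMap.comp_apply, TensorProduct.map_tmul, evTensor_inc,
      ← TensorProduct.smul_tmul', TensorProduct.tmul_smul, map_smul, smul_smul,
      LinearMap.dualMap_apply']
    rw [← LinearMap.comp_assoc, ← LinearMap.comp_assoc, ← LinearMap.smul_comp,
      ← LinearMap.smul_comp]
    congr 1
    refine tot_tensor_ext_four fun p q r s a b a' b' => ?_
    rw [LinearMap.smul_apply, LinearMap.smul_apply, LinearMap.comp_apply, LinearMap.comp_apply,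
      koszulMiddle_inc, map_smul, koszulSign_oddPartTensor_inc, map_smul]
    simp only [TensorProduct.dualDistrib_apply, smul_eq_mul]
    -- Unless all four degrees match, both sides vanish. When they match, the two total sign
    -- exponents are equal as polynomials in the degrees.
    rcases eq_or_ne p p₁ with rfl | h
    swap
    · simp [ev_inc_of_ne h]
    rcases eq_or_ne q p₂ with rfl | h
    swap
    · simp [ev_inc_of_ne h]
    rcases eq_or_ne r q₁ with rfl | h
    swap
    · simp [ev_inc_of_ne h]
    rcases eq_or_ne s q₂ with rfl | h
    swap
    · simp [ev_inc_of_ne h]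
    simp only [map_smul, TensorProduct.dualDistrib_apply, smul_eq_mul]
    ring
  exact LinearMap.congr_fun key (s ⊗ₜ t)

theorem transposeMul_inc_of_ne (A : GrAlg K V) {n p q : ℕ} (h : p + q ≠ n) (f : GrDual K V n)
    (a : V p) (b : V q) :
    transposeMul A (inc K (GrDual K V) n f) (inc K V p a ⊗ₜ inc K V q b) = 0 := by
  obtain ⟨x, hx⟩ := A.mul_deg p q a b
  exact (congrArg _ hx.symm).trans (ev_inc_of_ne h f x)

/-- The product is graded, so a functional of degree m sees only a ⊗ b with |a| + |b| = m. The sign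
attached to the degrees of the functionals may therefore be read on the arguments. -/
theorem evTensor_comp_map_mul (A : GrAlg K V) (F G : Tot (GrDual K V)) :
    evTensor K V (F ⊗ₜ G) ∘ₗ TensorProduct.map A.mul A.mul =
      TensorProduct.dualDistrib K _ _ (transposeMul A F ⊗ₜ transposeMul A G) ∘ₗ
        koszulSign K (oddPartTensor K V) (oddPartTensor K V) := by
  have key : (TensorProduct.map A.mul A.mul).dualMap ∘ₗ evTensor K V =
      (koszulSign K (oddPartTensor K V) (oddPartTensor K V)).dualMap ∘ₗ
        TensorProduct.dualDistrib K _ _ ∘ₗ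
          TensorProduct.map (transposeMul A) (transposeMul A) := by
    refine tot_tensor_ext fun m n f g => tot_tensor_ext_four fun p q r s a b a' b' => ?_
    simp only [LinearMap.comp_apply, LinearMap.dualMap_apply, evTensor_inc, TensorProduct.map_tmul,
      koszulSign_oddPartTensor_inc, map_smul, TensorProduct.dualDistrib_apply,
      LinearMap.smul_apply]
    have h (n p q : ℕ) (f : GrDual K V n) (a : V p) (b : V q) :
      ev K V (inc K _ n f) (A.mul (inc K V p a ⊗ₜ inc K V q b)) =
        transposeMul A (inc K _ n f) (inc K V p a ⊗ₜ inc K V q b) := rfl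
    rw [h, h]
    rcases eq_or_ne (p + q) m with rfl | hm
    swap
    · simp [transposeMul_inc_of_ne A hm]
    rcases eq_or_ne (r + s) n with rfl | hn
    swap
    · simp [transposeMul_inc_of_ne A hn]
    rfl
  exact LinearMap.congr_fun key (F ⊗ₜ G)

theorem evTensor_one_one {C : GrCoalg K V} {cup : GrAlg K (GrDual K V)} (hcup : IsCup C cup) :
    evTensor K V (cup.one ⊗ₜ cup.one) =
      TensorProduct.dualDistrib K _ _ (C.counit ⊗ₜ C.counit) := by
  obtain ⟨e, he⟩ := cup.one_deg
  rw [← he, evTensor_inc, he, hcup.one, zero_mul, pow_zero, one_smul]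

theorem evTensor_apply_one (A : GrAlg K V) (F G : Tot (GrDual K V)) :
    evTensor K V (F ⊗ₜ G) (A.one ⊗ₜ A.one) = ev K V F A.one * ev K V G A.one := by
  obtain ⟨e, he⟩ := A.one_deg
  have key : LinearMap.applyₗ (A.one ⊗ₜ A.one) ∘ₗ evTensor K V =
      LinearMap.applyₗ (A.one ⊗ₜ A.one) ∘ₗ TensorProduct.dualDistrib K _ _ ∘ₗ
        TensorProduct.map (ev K V) (ev K V) := by
    refine tot_tensor_ext fun m n f g => ?_
    rw [← he]
    simp only [LinearMap.comp_apply, evTensor_inc, LinearMap.applyₗ_apply_apply,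
      TensorProduct.map_tmul, LinearMap.smul_apply, TensorProduct.dualDistrib_apply]
    rcases eq_or_ne 0 m with rfl | hm
    · simp
    · simp [ev_inc_of_ne hm]
  exact LinearMap.congr_fun key (F ⊗ₜ G)

/-- Each axiom transposes one of `B`: associativity gives coassociativity, multiplicativity of Δ
gives that of δ, multiplicativity of ε gives unitality of δ, and the Leibniz rule gives
compatibility with the differential. -/
theorem Lowers.isCompletedDGBialg {d : Tot V →ₗ[K] Tot V} {δ : ∀ n, V (n + 1) →ₗ[K] V n}
    (hd : Lowers d δ) {B : GrBialg K V} (hB : IsDGAlg d B.toGrAlg)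
    {cup : GrAlg K (GrDual K V)} (hcup : IsCup B.toGrCoalg cup) : IsCompletedDGBialg d B cup where
  extends_mul := hcup.extends_mul
  comul_deg _ _ _ f a b h := transposeMul_inc_of_ne B.toGrAlg h f a b
  comul_mul f g := by
    have h : B.comul ∘ₗ B.mul =
        tensorMul K V B.mul ∘ₗ TensorProduct.map B.comul B.comul :=
      TensorProduct.ext' fun a b => by simpa using B.comul_mul a b
    rw [convTensor, ← LinearMap.comp_assoc, ← evTensor_comp_map_mul, transposeMul,
      LinearMap.comp_apply, hcup.mul]
    change (evTensor K V (f ⊗ₜ g) ∘ₗ B.comul) ∘ₗ B.mul = _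
    rw [LinearMap.comp_assoc, h]
    rfl
  comul_one := by
    rw [evTensor_one_one hcup, transposeMul, LinearMap.comp_apply, hcup.one]
    exact TensorProduct.ext' fun a b => by simpa using B.counit_mul a b
  coassoc f := by
    refine TensorProduct.ext_threefold fun a b c => ?_
    exact congrArg (ev K V f) (B.mul_assoc a b c)
  counit_comul f a := congrArg (ev K V f) (B.one_mul a)
  comul_counit f a := congrArg (ev K V f) (B.mul_one a)
  counit_mul f g := by
    rw [hcup.mul, LinearMap.comp_apply, B.comul_one, evTensor_apply_one]
  counit_one := by rw [hcup.one, B.counit_one]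
  coleibniz f := by
    rw [transposeMul, LinearMap.comp_apply, hd.ev_codiff]
    change (_ ∘ₗ _) ∘ₗ _ = (_ ∘ₗ _) ∘ₗ _
    rw [LinearMap.comp_assoc, hB.leibniz, LinearMap.comp_assoc]
    rfl

end Completed

/-! ### Products on homology -/

section Homology

variable {K : Type*} [CommRing K] {V : ℕ → Type*} [∀ n, AddCommGroup (V n)]
  [∀ n, Module K (V n)]

/-- Kernel and image of `d` are graded, and `d` is odd. -/
structure IsGradedDiff (d : Tot V →ₗ[K] Tot V) : Prop where
  ker_component : ∀ v, d v = 0 → ∀ n, d (inc K V n (DirectSum.component K ℕ V n v)) = 0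
  range_component : ∀ v n, inc K V n (DirectSum.component K ℕ V n (d v)) ∈ LinearMap.range d
  signMap_comp : ∀ v, d (signMap K V v) = - signMap K V (d v)

theorem mem_of_component_mem {S : Submodule K (Tot V)} {v : Tot V}
    (h : ∀ n, inc K V n (DirectSum.component K ℕ V n v) ∈ S) : v ∈ S := by
  classical
  rw [← DirectSum.sum_support_of v]
  exact Submodule.sum_mem _ fun n _ => h n

theorem component_inc_same (n : ℕ) (a : V n) :
    DirectSum.component K ℕ V n (inc K V n a) = a := by simp [DirectSum.component.lof_self]

theorem component_inc_of_ne {m n : ℕ} (h : n ≠ m) (a : V n) :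
    DirectSum.component K ℕ V m (inc K V n a) = 0 := by
  rw [DirectSum.component.of, dif_neg h]

theorem inc_injective (n : ℕ) : Function.Injective (inc K V n) :=
  Function.LeftInverse.injective (component_inc_same n)

theorem component_lmap {W : ℕ → Type*} [∀ n, AddCommGroup (W n)] [∀ n, Module K (W n)]
    (f : ∀ n, V n →ₗ[K] W n) (n : ℕ) (v : Tot V) :
    DirectSum.component K ℕ W n (DirectSum.lmap f v) = f n (DirectSum.component K ℕ V n v) :=
  DirectSum.lmap_apply f v n

theorem Lowers.isGradedDiff {d : Tot V →ₗ[K] Tot V} {δ : ∀ n, V (n + 1) →ₗ[K] V n}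
    (hd : Lowers d δ) : IsGradedDiff d := by
  have h (v : Tot V) (n : ℕ) : d (inc K V (n + 1) (DirectSum.component K ℕ V (n + 1) v)) =
      inc K V n (DirectSum.component K ℕ V n (d v)) := by
    have : d ∘ₗ inc K V (n + 1) ∘ₗ DirectSum.component K ℕ V (n + 1) =
        inc K V n ∘ₗ DirectSum.component K ℕ V n ∘ₗ d := tot_hom_ext fun m a => by
      simp only [LinearMap.comp_apply]
      cases m with
      | zero => rw [hd.zero, component_inc_of_ne (by omega)]; simp
      | succ m =>
        rcases eq_or_ne m n with rfl | hm
        · rw [component_inc_same, hd.succ, component_inc_same]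
        · rw [component_inc_of_ne (by omega), hd.succ m, component_inc_of_ne hm]; simp
    exact LinearMap.congr_fun this v
  refine ⟨fun v hv n => ?_, fun v n => ⟨_, h v n⟩, hd.signMap_comp⟩
  cases n with
  | zero => exact hd.zero _
  | succ n => rw [h, hv, map_zero, map_zero]

theorem Lowers.isGradedDiff_codiff {d : Tot V →ₗ[K] Tot V} {δ : ∀ n, V (n + 1) →ₗ[K] V n}
    (hd : Lowers d δ) : IsGradedDiff (codiff d) := by
  have h (v : Tot (GrDual K V)) (n : ℕ) :
      codiff d (inc K _ n (DirectSum.component K ℕ (GrDual K V) n v)) =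
      inc K _ (n + 1) (DirectSum.component K ℕ (GrDual K V) (n + 1) (codiff d v)) := by
    have : codiff d ∘ₗ inc K _ n ∘ₗ DirectSum.component K ℕ (GrDual K V) n =
        inc K _ (n + 1) ∘ₗ DirectSum.component K ℕ (GrDual K V) (n + 1) ∘ₗ codiff d :=
      tot_hom_ext fun m a => by
        simp only [LinearMap.comp_apply]
        rcases eq_or_ne m n with rfl | hm
        · rw [component_inc_same, hd.codiff_inc, map_smul, component_inc_same, map_smul]
        · rw [component_inc_of_ne hm, hd.codiff_inc m, map_smul, component_inc_of_ne (by omega)]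
          simp
    exact LinearMap.congr_fun this v
  refine ⟨fun v hv n => by rw [h, hv, map_zero, map_zero], fun v n => ?_, hd.signMap_codiff⟩
  cases n with
  | zero =>
    -- There are no coboundaries in degree 0, since the dual differential raises degrees.
    have : DirectSum.component K ℕ (GrDual K V) 0 ∘ₗ codiff d = 0 := tot_hom_ext fun m a => by
      simp only [LinearMap.comp_apply]
      rw [hd.codiff_inc, map_smul, component_inc_of_ne (by omega)]
      simp
    rw [show DirectSum.component K ℕ (GrDual K V) 0 (codiff d v) = 0 from
      LinearMap.congr_fun this v, map_zero]
    exact zero_mem _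
  | succ n => exact ⟨_, h v n⟩

variable {d : Tot V →ₗ[K] Tot V}

theorem cycInc_inc (n : ℕ) (a : Cyc d n) :
    cycInc d (inc K (Cyc d) n a) = inc K V n (a : V n) := by
  simp [cycInc, DirectSum.lmap_lof]

theorem cls_inc (n : ℕ) (a : Cyc d n) :
    cls d (inc K (Cyc d) n a) = inc K (Hlgy d) n (Submodule.Quotient.mk a) := by
  simp [cls, DirectSum.lmap_lof]

theorem component_cycInc (n : ℕ) (c : Tot (Cyc d)) :
    DirectSum.component K ℕ V n (cycInc d c) =
      (DirectSum.component K ℕ (Cyc d) n c : Cyc d n).1 :=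
  component_lmap _ n c

theorem cycInc_injective : Function.Injective (cycInc d) := by
  intro a b h
  refine DirectSum.ext_component K fun n => Subtype.ext ?_
  rw [← component_cycInc, ← component_cycInc, h]

theorem d_cycInc (c : Tot (Cyc d)) : d (cycInc d c) = 0 := by
  have : d ∘ₗ cycInc d = 0 := tot_hom_ext fun n a => by
    rw [LinearMap.comp_apply, cycInc_inc]
    exact a.2
  exact LinearMap.congr_fun this c

theorem IsGradedDiff.mem_range_cycInc (hd : IsGradedDiff d) {v : Tot V} (hv : d v = 0) :
    v ∈ LinearMap.range (cycInc d) :=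
  mem_of_component_mem fun n =>
    ⟨inc K (Cyc d) n ⟨_, hd.ker_component v hv n⟩, cycInc_inc _ _⟩

theorem cls_surjective : Function.Surjective (cls d) := by
  intro x
  have : x ∈ LinearMap.range (cls d) := mem_of_component_mem fun n => by
    obtain ⟨c, hc⟩ := Submodule.Quotient.mk_surjective _ (DirectSum.component K ℕ (Hlgy d) n x)
    exact ⟨inc K (Cyc d) n c, by rw [cls_inc, hc]⟩
  exact this

theorem IsGradedDiff.cls_eq_zero_iff (hd : IsGradedDiff d) {c : Tot (Cyc d)} :
    cls d c = 0 ↔ cycInc d c ∈ LinearMap.range d := by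
  constructor
  · intro h
    refine mem_of_component_mem fun n => ?_
    have h' : DirectSum.component K ℕ (Hlgy d) n (cls d c) = 0 := by rw [h, map_zero]
    rw [cls, component_lmap] at h'
    rw [component_cycInc]
    have := (Submodule.Quotient.mk_eq_zero _).1 h'
    exact this
  · rintro ⟨v, hv⟩
    refine DirectSum.ext_component K fun n => ?_
    rw [cls, component_lmap, map_zero]
    refine (Submodule.Quotient.mk_eq_zero _).2 ?_
    change inc K V n _ ∈ LinearMap.range d
    have := hd.range_component v n
    rwa [hv, component_cycInc] at this

/-- The value of `f` depends only on the images under `π`, so a set-theoretic section of `π` already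
gives a bilinear map. No splitting or flatness enters, and the lemma is valid over every commutative
ring. -/
theorem exists_tensor_factor {Z H W : Type*} [AddCommGroup Z] [AddCommGroup H] [AddCommGroup W]
    [Module K Z] [Module K H] [Module K W] {π : Z →ₗ[K] H} (hπ : Function.Surjective π)
    (f : (Z ⊗[K] Z) →ₗ[K] W) (hl : ∀ a b, π a = 0 → f (a ⊗ₜ b) = 0)
    (hr : ∀ a b, π b = 0 → f (a ⊗ₜ b) = 0) :
    ∃ g : (H ⊗[K] H) →ₗ[K] W, ∀ a b, g (π a ⊗ₜ π b) = f (a ⊗ₜ b) := by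
  have key : ∀ a a' b b', π a = π a' → π b = π b' → f (a ⊗ₜ b) = f (a' ⊗ₜ b') := by
    intro a a' b b' ha hb
    have h1 := hl (a - a') b (by rw [map_sub, ha, sub_self])
    have h2 := hr a' (b - b') (by rw [map_sub, hb, sub_self])
    rw [TensorProduct.sub_tmul, map_sub, sub_eq_zero] at h1
    rw [TensorProduct.tmul_sub, map_sub, sub_eq_zero] at h2
    rw [h1, h2]
  have hs := Function.surjInv_eq hπ
  let s := Function.surjInv hπ
  refine ⟨TensorProduct.lift (LinearMap.mk₂ K (fun x y => f (s x ⊗ₜ s y)) ?_ ?_ ?_ ?_), ?_⟩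
  · intro x x' y
    rw [← map_add, ← TensorProduct.add_tmul]
    exact key _ _ _ _ (by simp [s, hs]) rfl
  · intro c x y
    rw [← map_smul, TensorProduct.smul_tmul']
    exact key _ _ _ _ (by simp [s, hs]) rfl
  · intro x y y'
    rw [← map_add, ← TensorProduct.tmul_add]
    exact key _ _ _ _ rfl (by simp [s, hs])
  · intro c x y
    rw [← map_smul, ← TensorProduct.tmul_smul]
    exact key _ _ _ _ rfl (by simp [s, hs])
  · intro a b
    rw [TensorProduct.lift.tmul, LinearMap.mk₂_apply]
    exact key _ _ _ _ (by simp [s, hs]) (by simp [s, hs])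

theorem IsDGAlg.leibniz_tmul {A : GrAlg K V} (hA : IsDGAlg d A) (a b : Tot V) :
    d (A.mul (a ⊗ₜ b)) = A.mul (d a ⊗ₜ b) + A.mul (signMap K V a ⊗ₜ d b) := by
  simpa [tensorD] using LinearMap.congr_fun hA.leibniz (a ⊗ₜ b)

/-- The Leibniz rule for 1 · 1 gives d 1 = d 1 + d 1. -/
theorem IsDGAlg.d_one {A : GrAlg K V} (hA : IsDGAlg d A) : d A.one = 0 := by
  obtain ⟨e, he⟩ := A.one_deg
  have hs : signMap K V A.one = A.one := by rw [← he, signMap_inc, pow_zero, one_smul]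
  have := hA.leibniz_tmul A.one A.one
  rwa [A.one_mul, A.mul_one, hs, A.one_mul, right_eq_add] at this

theorem IsGradedDiff.exists_inducesMul (hd : IsGradedDiff d) {A : GrAlg K V}
    (hA : IsDGAlg d A) : ∃ H : GrAlg K (Hlgy d), InducesMul d A H := by
  have hcyc : ∀ t, (A.mul ∘ₗ TensorProduct.map (cycInc d) (cycInc d)) t ∈
      LinearMap.range (cycInc d) := fun t => by
    refine hd.mem_range_cycInc ?_
    have : d ∘ₗ A.mul ∘ₗ TensorProduct.map (cycInc d) (cycInc d) = 0 :=
      TensorProduct.ext' fun a b => by simp [hA.leibniz_tmul, d_cycInc]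
    exact LinearMap.congr_fun this t
  let μ := LinearMap.codRestrictOfInjective _ _ cycInc_injective hcyc
  have hμ : ∀ a b, cycInc d (μ (a ⊗ₜ b)) = A.mul (cycInc d a ⊗ₜ cycInc d b) := fun a b =>
    LinearMap.codRestrictOfInjective_comp_apply _ _ cycInc_injective hcyc (a ⊗ₜ b)
  obtain ⟨m, hm⟩ := exists_tensor_factor (cls_surjective (d := d)) (cls d ∘ₗ μ)
    (fun a b ha => by
      obtain ⟨v, hv⟩ := hd.cls_eq_zero_iff.1 ha
      refine hd.cls_eq_zero_iff.2 ⟨A.mul (v ⊗ₜ cycInc d b), ?_⟩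
      rw [hA.leibniz_tmul, d_cycInc, hv, hμ, TensorProduct.tmul_zero, map_zero, add_zero])
    (fun a b hb => by
      obtain ⟨v, hv⟩ := hd.cls_eq_zero_iff.1 hb
      -- The sign twist of the left factor cancels the one produced by the Leibniz rule.
      refine hd.cls_eq_zero_iff.2 ⟨A.mul (signMap K V (cycInc d a) ⊗ₜ v), ?_⟩
      rw [hA.leibniz_tmul, hd.signMap_comp, d_cycInc, hv, hμ, signMap_signMap]
      simp)
  obtain ⟨e, he⟩ := hd.mem_range_cycInc hA.d_one
  replace hm : ∀ a b, m (cls d a ⊗ₜ cls d b) = cls d (μ (a ⊗ₜ b)) := hm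
  refine ⟨{ mul := m, one := cls d e, mul_deg := ?_, one_deg := ?_, mul_assoc := ?_,
            one_mul := ?_, mul_one := ?_ }, ⟨fun a b => ⟨_, hμ a b, (hm a b).symm⟩, e, he, rfl⟩⟩
  · intro p q a b
    obtain ⟨a, rfl⟩ := Submodule.Quotient.mk_surjective _ a
    obtain ⟨b, rfl⟩ := Submodule.Quotient.mk_surjective _ b
    obtain ⟨x, hx⟩ := A.mul_deg p q a.1 b.1
    have hx' : cycInc d (μ (inc K _ p a ⊗ₜ inc K _ q b)) = inc K V (p + q) x := by
      rw [hμ, cycInc_inc, cycInc_inc, hx]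
    have hz : x ∈ cyc d (p + q) := by
      change d (inc K V (p + q) x) = 0
      rw [← hx', d_cycInc]
    refine ⟨Submodule.Quotient.mk ⟨x, hz⟩, ?_⟩
    rw [← cls_inc, ← cls_inc, ← cls_inc, hm]
    congr 1
    exact cycInc_injective (by rw [hx', cycInc_inc])
  · obtain ⟨x, hx⟩ := A.one_deg
    have hz : x ∈ cyc d 0 := by
      change d (inc K V 0 x) = 0
      rw [hx, hA.d_one]
    refine ⟨Submodule.Quotient.mk ⟨x, hz⟩, ?_⟩
    rw [← cls_inc]
    congr 1
    exact cycInc_injective (by rw [he, cycInc_inc, hx])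
  · intro a b c
    obtain ⟨a, rfl⟩ := cls_surjective a
    obtain ⟨b, rfl⟩ := cls_surjective b
    obtain ⟨c, rfl⟩ := cls_surjective c
    rw [hm, hm, hm, hm]
    congr 1
    exact cycInc_injective (by rw [hμ, hμ, hμ, hμ, A.mul_assoc])
  · intro a
    obtain ⟨a, rfl⟩ := cls_surjective a
    rw [hm]
    congr 1
    exact cycInc_injective (by rw [hμ, he, A.one_mul])
  · intro a
    obtain ⟨a, rfl⟩ := cls_surjective a
    rw [hm]
    congr 1
    exact cycInc_injective (by rw [hμ, he, A.mul_one])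

end Homology

/-! ### The action of the structure monoid on the shelf -/

section StructMonoid

variable {X : Type u} [Shelf X]

theorem shelfPow_shelfPow (x y z : X) :
    shelfPow (shelfPow x y) z = shelfPow (shelfPow x z) (shelfPow y z) :=
  Shelf.self_distrib

theorem gen_mul_gen_shelfPow (x y : X) : gen y * gen (shelfPow x y) = gen x * gen y :=
  PresentedMonoid.mk_eq_mk_of_rel (StructRel.rel x y)

theorem StructMonoid.induction_right {P : StructMonoid X → Prop} (one : P 1)
    (mul_gen : ∀ b x, P b → P (b * gen x)) (b : StructMonoid X) : P b := by
  have hb : b ∈ Submonoid.closure (Set.range (PresentedMonoid.of (StructRel X))) := by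
    rw [PresentedMonoid.closure_range_of]; trivial
  induction hb using Submonoid.closure_induction_right with
  | one => exact one
  | mul_right b _ y hy ih =>
    obtain ⟨x, rfl⟩ := hy
    exact mul_gen b x ih

/-- The right action of the structure monoid on the shelf. -/
def ractHom (X : Type u) [Shelf X] : StructMonoid X →* (Function.End X)ᵐᵒᵖ :=
  PresentedMonoid.lift (rels := StructRel X) (M := (Function.End X)ᵐᵒᵖ)
    (fun y => MulOpposite.op (fun x => shelfPow x y)) (by
    rintro _ _ ⟨x, y⟩
    simp only [map_mul, FreeMonoid.lift_eval_of]
    refine MulOpposite.unop_injective (funext fun z => ?_)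
    exact (shelfPow_shelfPow z x y).symm)

/-- `x ^ b` for `b` in the structure monoid. -/
def ract (x : X) (b : StructMonoid X) : X := (ractHom X b).unop x

@[simp] theorem ract_one (x : X) : ract x 1 = x := by simp [ract]; rfl

@[simp] theorem ract_mul (x : X) (a b : StructMonoid X) :
    ract x (a * b) = ract (ract x a) b := by
  simp [ract]; rfl

@[simp] theorem ract_gen (x y : X) : ract x (gen y) = shelfPow x y := rfl

/-- The defining relation extended from generators to all of M: a generator crosses b at the price
of being acted upon. It is what makes right multiplication by M compatible with the structure maps.
-/
theorem gen_mul (x : X) (b : StructMonoid X) : gen x * b = b * gen (ract x b) := by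
  induction b using StructMonoid.induction_right with
  | one => simp
  | mul_gen b y ih =>
    rw [← mul_assoc, ih, mul_assoc, ract_mul, ract_gen, ← gen_mul_gen_shelfPow, mul_assoc]

end StructMonoid

/-! ### Cells -/

section Cells

variable {K : Type v} [CommRing K] {X : Type u}

theorem chain_hom_ext {S : Type u} {W : Type*} [AddCommGroup W] [Module K W]
    {f g : Tot (Chain K X S) →ₗ[K] W}
    (h : ∀ (s : S) (n : ℕ) (x : Fin n → X), f (cell K s x) = g (cell K s x)) : f = g :=
  tot_hom_ext fun n a => by
    have : f ∘ₗ inc K (Chain K X S) n = g ∘ₗ inc K (Chain K X S) n :=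
      Finsupp.lhom_ext' fun c => LinearMap.ext_ring (h c.1 n c.2)
    exact LinearMap.congr_fun this a

theorem signMap_cell {S : Type u} (s : S) {n : ℕ} (x : Fin n → X) :
    signMap K (Chain K X S) (cell K s x) = (-1 : K) ^ n • cell K s x := signMap_inc n _

/-- Right multiplication by `e_y` on homogeneous elements. -/
def snocHom (K : Type v) [CommRing K] {X S : Type u} (y : X) (n : ℕ) :
    Chain K X S n →ₗ[K] Chain K X S (n + 1) :=
  Finsupp.lmapDomain K K (fun c => (c.1, Fin.snoc c.2 y))

/-- Right multiplication by `e_y`. -/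
def snocOp (K : Type v) [CommRing K] {X S : Type u} (y : X) :
    Tot (Chain K X S) →ₗ[K] Tot (Chain K X S) :=
  DirectSum.toModule K ℕ _ (fun n => inc K (Chain K X S) (n + 1) ∘ₗ snocHom K y n)

theorem snocOp_inc {S : Type u} (y : X) (n : ℕ) (a : Chain K X S n) :
    snocOp K y (inc K (Chain K X S) n a) = inc K (Chain K X S) (n + 1) (snocHom K y n a) := by
  rw [snocOp, DirectSum.toModule_lof]
  rfl

theorem snocOp_cell {S : Type u} (y : X) (s : S) {n : ℕ} (x : Fin n → X) :
    snocOp K y (cell K s x) = cell K s (Fin.snoc x y : Fin (n + 1) → X) := by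
  rw [cell, snocOp_inc, snocHom, Finsupp.lmapDomain_apply, Finsupp.mapDomain_single]
  rfl

theorem signMap_snocOp {S : Type u} (y : X) (c : Tot (Chain K X S)) :
    signMap K _ (snocOp K y c) = - snocOp K y (signMap K _ c) := by
  have : signMap K _ ∘ₗ snocOp K y = - (snocOp K y ∘ₗ signMap K (Chain K X S)) :=
    tot_hom_ext fun n a => by simp [snocOp_inc, pow_succ]
  exact LinearMap.congr_fun this c

/-- The induction principle behind most identities below: every cell is a degree-0 cell multiplied
repeatedly on the right by elements e_y. -/
theorem chain_hom_ext_snoc {S : Type u} {W : Type*} [AddCommGroup W] [Module K W]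
    {f g : Tot (Chain K X S) →ₗ[K] W} (nil : ∀ s : S, f (cell K s ![]) = g (cell K s ![]))
    (snoc : ∀ (c : Tot (Chain K X S)) (y : X), f c = g c → f (snocOp K y c) = g (snocOp K y c)) :
    f = g :=
  chain_hom_ext fun s n x => by
    induction n with
    | zero => rw [Subsingleton.elim x ![]]; exact nil s
    | succ n ih =>
      rw [← Fin.snoc_init_self x, ← snocOp_cell]
      exact snoc _ _ (ih _)

theorem lowers_rackD [Shelf X] (S : Type u) [ShelfSet X S] :
    Lowers (rackD K X S) (chainD K X S) where
  zero a := by rw [rackD, DirectSum.toModule_lof]; rfl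
  succ n a := by rw [rackD, DirectSum.toModule_lof]; rfl

theorem rackD_cell_nil [Shelf X] {S : Type u} [ShelfSet X S] (s : S) :
    rackD K X S (cell K s ![]) = 0 := (lowers_rackD S).zero _

theorem rackD_cell [Shelf X] {S : Type u} [ShelfSet X S] (s : S) {n : ℕ} (x : Fin (n + 1) → X) :
    rackD K X S (cell K s x) = ∑ i : Fin (n + 1), ((-1 : K) ^ (i : ℕ)) •
      (cell K s (i.removeNth x) - cell K (ShelfSet.act s (x i)) (face i x)) := by
  rw [cell, (lowers_rackD S).succ, chainD, Finsupp.linearCombination_single, one_smul, map_sum]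
  simp [cell]

theorem removeNth_castSucc_snoc {n : ℕ} (i : Fin (n + 1)) (x : Fin (n + 1) → X) (y : X) :
    i.castSucc.removeNth (Fin.snoc x y : Fin (n + 2) → X) =
      (Fin.snoc (i.removeNth x) y : Fin (n + 1) → X) := by
  funext j
  refine Fin.lastCases ?_ (fun j => ?_) j
  · simp [Fin.removeNth]
  · simp [Fin.removeNth, Fin.castSucc_succAbove_castSucc]

theorem face_castSucc_snoc [Shelf X] {n : ℕ} (i : Fin (n + 1)) (x : Fin (n + 1) → X) (y : X) :
    face i.castSucc (Fin.snoc x y : Fin (n + 2) → X) =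
      (Fin.snoc (face i x) y : Fin (n + 1) → X) := by
  funext j
  refine Fin.lastCases ?_ (fun j => ?_) j
  · simp [face, Fin.le_last]
  · simp [face]

theorem face_last_snoc [Shelf X] {n : ℕ} (x : Fin n → X) (y : X) :
    face (Fin.last n) (Fin.snoc x y : Fin (n + 1) → X) = fun j => shelfPow (x j) y := by
  funext j
  simp [face, Fin.castSucc_lt_last]

/-- All faces except the last commute with appending y. The last one removes y, and contributes the
cell itself minus the cell acted upon by y. -/
theorem rackD_snocOp_cell [Shelf X] {S : Type u} [ShelfSet X S] (s : S) {n : ℕ} (x : Fin n → X)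
    (y : X) :
    rackD K X S (snocOp K y (cell K s x)) = snocOp K y (rackD K X S (cell K s x)) +
      (-1 : K) ^ n • (cell K s x - cell K (ShelfSet.act s y) fun j => shelfPow (x j) y) := by
  rw [snocOp_cell, rackD_cell, Fin.sum_univ_castSucc, Fin.removeNth_last, Fin.init_snoc,
    Fin.snoc_last, face_last_snoc, Fin.val_last]
  congr 1
  cases n with
  | zero => rw [Subsingleton.elim x ![], rackD_cell_nil]; simp
  | succ n =>
    simp only [rackD_cell, removeNth_castSucc_snoc, face_castSucc_snoc, map_sum, map_smul, map_sub,
      snocOp_cell, Fin.snoc_castSucc, Fin.val_castSucc]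

end Cells

/-! ### The product of the rack bialgebra -/

section RackMul

variable {K : Type v} [CommRing K] {X : Type u} [Shelf X]

/-- Right multiplication by `b ∈ M` on homogeneous elements. -/
def rmulHom (K : Type v) [CommRing K] {X : Type u} [Shelf X] (b : StructMonoid X) (n : ℕ) :
    Chain K X (StructMonoid X) n →ₗ[K] Chain K X (StructMonoid X) n :=
  Finsupp.lmapDomain K K (fun c => (c.1 * b, fun i => ract (c.2 i) b))

/-- Right multiplication by `b ∈ M`: `a x_1 ⋯ x_n ↦ a b x_1^b ⋯ x_n^b`. -/
def rmulOp (K : Type v) [CommRing K] {X : Type u} [Shelf X] (b : StructMonoid X) :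
    Tot (Chain K X (StructMonoid X)) →ₗ[K] Tot (Chain K X (StructMonoid X)) :=
  DirectSum.lmap (rmulHom K b)

theorem rmulOp_inc (b : StructMonoid X) (n : ℕ) (a : Chain K X (StructMonoid X) n) :
    rmulOp K b (inc K _ n a) = inc K _ n (rmulHom K b n a) := by
  rw [rmulOp, DirectSum.lmap_lof]

theorem rmulOp_cell (b a : StructMonoid X) {n : ℕ} (x : Fin n → X) :
    rmulOp K b (cell K a x) = cell K (a * b) fun i => ract (x i) b := by
  rw [cell, rmulOp_inc, rmulHom, Finsupp.lmapDomain_apply, Finsupp.mapDomain_single]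
  rfl

theorem rmulOp_cell_nil (b a : StructMonoid X) :
    rmulOp K b (cell K a (![] : Fin 0 → X)) = cell K (a * b) ![] := by
  rw [rmulOp_cell, Subsingleton.elim (fun i => ract ((![] : Fin 0 → X) i) b) ![]]

theorem signMap_rmulOp (b : StructMonoid X) (c : Tot (Chain K X (StructMonoid X))) :
    signMap K _ (rmulOp K b c) = rmulOp K b (signMap K _ c) := by
  have : signMap K _ ∘ₗ rmulOp K b = rmulOp K b ∘ₗ signMap K _ :=
    tot_hom_ext fun n a => by simp [rmulOp_inc]
  exact LinearMap.congr_fun this c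

theorem rmulOp_snocOp (b : StructMonoid X) (y : X) (c : Tot (Chain K X (StructMonoid X))) :
    rmulOp K b (snocOp K y c) = snocOp K (ract y b) (rmulOp K b c) := by
  have : rmulOp K b ∘ₗ snocOp K y = snocOp K (ract y b) ∘ₗ rmulOp K b :=
    chain_hom_ext fun a n x => by
      simp only [LinearMap.comp_apply, snocOp_cell, rmulOp_cell]
      congr 1
      funext j
      refine Fin.lastCases ?_ (fun j => ?_) j <;> simp
  exact LinearMap.congr_fun this c

theorem rmulOp_one (c : Tot (Chain K X (StructMonoid X))) : rmulOp K 1 c = c := by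
  have : rmulOp K (1 : StructMonoid X) = LinearMap.id := chain_hom_ext fun a n x => by
    simp [rmulOp_cell]
  exact LinearMap.congr_fun this c

theorem rmulOp_rmulOp (a b : StructMonoid X) (c : Tot (Chain K X (StructMonoid X))) :
    rmulOp K b (rmulOp K a c) = rmulOp K (a * b) c := by
  have : rmulOp K b ∘ₗ rmulOp K a = rmulOp K (a * b) := chain_hom_ext fun s n x => by
    simp [rmulOp_cell, mul_assoc]
  exact LinearMap.congr_fun this c

/-- Right multiplication by `b x_1 ⋯ x_n`. -/
def mulCell (K : Type v) [CommRing K] {X : Type u} [Shelf X] (b : StructMonoid X) :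
    ∀ n, (Fin n → X) → Tot (Chain K X (StructMonoid X)) →ₗ[K] Tot (Chain K X (StructMonoid X))
  | 0, _ => rmulOp K b
  | n + 1, x => snocOp K (x (Fin.last n)) ∘ₗ mulCell K b n (Fin.init x)

/-- The product of the rack bialgebra. -/
def rackMul (K : Type v) [CommRing K] (X : Type u) [Shelf X] :
    (Tot (Chain K X (StructMonoid X)) ⊗[K] Tot (Chain K X (StructMonoid X))) →ₗ[K]
      Tot (Chain K X (StructMonoid X)) :=
  TensorProduct.lift (LinearMap.flip (DirectSum.toModule K ℕ _ fun n =>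
    Finsupp.linearCombination K fun c => mulCell K c.1 n c.2))

theorem rackMul_cell (c : Tot (Chain K X (StructMonoid X))) (b : StructMonoid X) {n : ℕ}
    (x : Fin n → X) : rackMul K X (c ⊗ₜ cell K b x) = mulCell K b n x c := by
  rw [rackMul, TensorProduct.lift.tmul, LinearMap.flip_apply, cell, DirectSum.toModule_lof,
    Finsupp.linearCombination_single, one_smul]

theorem rackMul_cell_nil (c : Tot (Chain K X (StructMonoid X))) (b : StructMonoid X) :
    rackMul K X (c ⊗ₜ cell K b ![]) = rmulOp K b c := rackMul_cell c b _

theorem rackMul_snocOp (c c' : Tot (Chain K X (StructMonoid X))) (y : X) :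
    rackMul K X (c ⊗ₜ snocOp K y c') = snocOp K y (rackMul K X (c ⊗ₜ c')) := by
  have : rackMul K X ∘ₗ TensorProduct.mk K _ _ c ∘ₗ snocOp K y =
      snocOp K y ∘ₗ rackMul K X ∘ₗ TensorProduct.mk K _ _ c := chain_hom_ext fun b n x => by
    simp only [LinearMap.comp_apply, TensorProduct.mk_apply, snocOp_cell, rackMul_cell, mulCell,
      Fin.snoc_last, Fin.init_snoc]
  exact LinearMap.congr_fun this c'

theorem rackMul_rmulOp (c c' : Tot (Chain K X (StructMonoid X))) (b : StructMonoid X) :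
    rackMul K X (c ⊗ₜ rmulOp K b c') = rmulOp K b (rackMul K X (c ⊗ₜ c')) := by
  have : rackMul K X ∘ₗ TensorProduct.mk K _ _ c ∘ₗ rmulOp K b =
      rmulOp K b ∘ₗ rackMul K X ∘ₗ TensorProduct.mk K _ _ c :=
    chain_hom_ext_snoc
      (fun a => by
        simp only [LinearMap.comp_apply, TensorProduct.mk_apply, rmulOp_cell_nil,
          rackMul_cell_nil, rmulOp_rmulOp])
      (fun c y ih => by
        simp only [LinearMap.comp_apply, TensorProduct.mk_apply, rmulOp_snocOp,
          rackMul_snocOp] at ih ⊢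
        rw [ih])
  exact LinearMap.congr_fun this c'

/-- Left multiplications commute with the right multiplications `snocOp` and `rmulOp`, and the
latter produce every factor c. -/
theorem rackMul_assoc (a b c : Tot (Chain K X (StructMonoid X))) :
    rackMul K X (rackMul K X (a ⊗ₜ b) ⊗ₜ c) = rackMul K X (a ⊗ₜ rackMul K X (b ⊗ₜ c)) := by
  have : rackMul K X ∘ₗ TensorProduct.mk K _ _ (rackMul K X (a ⊗ₜ b)) =
      rackMul K X ∘ₗ TensorProduct.mk K _ _ a ∘ₗ rackMul K X ∘ₗ TensorProduct.mk K _ _ b :=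
    chain_hom_ext_snoc
      (fun s => by
        simp only [LinearMap.comp_apply, TensorProduct.mk_apply, rackMul_cell_nil,
          rackMul_rmulOp])
      (fun c y ih => by
        simp only [LinearMap.comp_apply, TensorProduct.mk_apply, rackMul_snocOp] at ih ⊢
        rw [ih])
  exact LinearMap.congr_fun this c

theorem rackMul_cell_nil_left (a b : StructMonoid X) {n : ℕ} (x : Fin n → X) :
    rackMul K X (cell K a ![] ⊗ₜ cell K b x) = cell K (a * b) x := by
  induction n with
  | zero => rw [Subsingleton.elim x ![], rackMul_cell_nil, rmulOp_cell_nil]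
  | succ n ih =>
    rw [← Fin.snoc_init_self x, ← snocOp_cell, rackMul_snocOp, ih, snocOp_cell]

theorem rackMul_one_left (c : Tot (Chain K X (StructMonoid X))) :
    rackMul K X (cell K 1 ![] ⊗ₜ c) = c := by
  have : rackMul K X ∘ₗ TensorProduct.mk K _ _ (cell K 1 ![]) = LinearMap.id :=
    chain_hom_ext fun a n x => by
      simp only [LinearMap.comp_apply, TensorProduct.mk_apply, rackMul_cell_nil_left, one_mul]
      rfl
  exact LinearMap.congr_fun this c

theorem mulCell_inc_mem (b : StructMonoid X) (p n : ℕ) (x : Fin n → X)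
    (a : Chain K X (StructMonoid X) p) :
    mulCell K b n x (inc K _ p a) ∈
      LinearMap.range (inc K (Chain K X (StructMonoid X)) (p + n)) := by
  induction n with
  | zero => exact ⟨_, (rmulOp_inc b p a).symm⟩
  | succ n ih =>
    obtain ⟨z, hz⟩ := ih (Fin.init x)
    refine ⟨snocHom K (x (Fin.last n)) _ z, ?_⟩
    rw [mulCell, LinearMap.comp_apply, ← hz, snocOp_inc]
    rfl

theorem rackMul_inc_mem (p q : ℕ) (a : Chain K X (StructMonoid X) p)
    (b : Chain K X (StructMonoid X) q) :
    rackMul K X (inc K _ p a ⊗ₜ inc K _ q b) ∈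
      LinearMap.range (inc K (Chain K X (StructMonoid X)) (p + q)) := by
  induction b using Finsupp.induction_linear with
  | zero => simp
  | add f g hf hg =>
    rw [map_add, TensorProduct.tmul_add, map_add]
    exact add_mem hf hg
  | single c r =>
    have : inc K (Chain K X (StructMonoid X)) q (Finsupp.single c r) = r • cell K c.1 c.2 := by
      rw [cell, ← map_smul, Finsupp.smul_single_one]
    rw [this, TensorProduct.tmul_smul, map_smul, rackMul_cell]
    exact Submodule.smul_mem _ _ (mulCell_inc_mem _ _ _ _ _)

variable (K X) in
/-- The algebra structure on `C(X, M)`. -/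
def rackAlg : GrAlg K (Chain K X (StructMonoid X)) where
  mul := rackMul K X
  one := cell K 1 ![]
  mul_deg := rackMul_inc_mem
  one_deg := ⟨_, rfl⟩
  mul_assoc := rackMul_assoc
  one_mul := rackMul_one_left
  mul_one c := by rw [rackMul_cell_nil, rmulOp_one]

/-! ### The differential of `C(X, M)` -/

theorem dM_snocOp (y : X) (c : Tot (Chain K X (StructMonoid X))) :
    dM K X (snocOp K y c) = snocOp K y (dM K X c) +
      signMap K _ (c - rmulOp K (gen y) c) := by
  have : dM K X ∘ₗ snocOp K y = snocOp K y ∘ₗ dM K X +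
      signMap K _ ∘ₗ (LinearMap.id - rmulOp K (gen y)) := chain_hom_ext fun a n x => by
    simp only [LinearMap.comp_apply, LinearMap.add_apply, LinearMap.sub_apply, map_sub,
      LinearMap.id_apply, rmulOp_cell, signMap_cell, ← smul_sub]
    exact rackD_snocOp_cell a x y
  exact LinearMap.congr_fun this c

/-- For c e_y, the new term c y in the differential is carried by b to c (y b) = (c b) y^b, which is
the term arising from (c b) e_{y^b}. -/
theorem dM_rmulOp (b : StructMonoid X) (c : Tot (Chain K X (StructMonoid X))) :
    dM K X (rmulOp K b c) = rmulOp K b (dM K X c) := by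
  have : dM K X ∘ₗ rmulOp K b = rmulOp K b ∘ₗ dM K X :=
    chain_hom_ext_snoc
      (fun a => by
        simp only [LinearMap.comp_apply, rmulOp_cell_nil, rackD_cell_nil, map_zero])
      (fun c y ih => by
        simp only [LinearMap.comp_apply, rmulOp_snocOp, dM_snocOp, map_add, map_sub,
          signMap_rmulOp, rmulOp_rmulOp, gen_mul] at ih ⊢
        rw [ih])
  exact LinearMap.congr_fun this c

theorem dM_signMap (c : Tot (Chain K X (StructMonoid X))) :
    dM K X (signMap K _ c) = - signMap K _ (dM K X c) := (lowers_rackD _).signMap_comp c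

/-- In ∂∂(c e_y) the two copies of ∂c - (∂c) y occur with opposite signs: ∂ commutes with right
multiplication by y and anticommutes with the sign operator. -/
theorem dM_dM : dM K X ∘ₗ dM K X = 0 :=
  chain_hom_ext_snoc
    (fun a => by simp only [LinearMap.comp_apply, rackD_cell_nil, map_zero, LinearMap.zero_apply])
    (fun c y ih => by
      simp only [LinearMap.comp_apply, LinearMap.zero_apply] at ih ⊢
      rw [dM_snocOp, map_add, dM_snocOp, ih, dM_signMap, map_sub, map_sub, dM_rmulOp, map_zero,
        map_sub]
      abel)

theorem dM_rackMul (c c' : Tot (Chain K X (StructMonoid X))) :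
    dM K X (rackMul K X (c ⊗ₜ c')) =
      rackMul K X (dM K X c ⊗ₜ c') + rackMul K X (signMap K _ c ⊗ₜ dM K X c') := by
  -- The sign operator is multiplicative, because the product is graded. This handles the boundary
  -- term created by appending y to the right factor.
  have hs : ∀ c c', signMap K _ (rackMul K X (c ⊗ₜ c')) =
      rackMul K X (signMap K _ c ⊗ₜ signMap K _ c') := fun c c' => by
    have : signMap K _ ∘ₗ rackMul K X =
        rackMul K X ∘ₗ TensorProduct.map (signMap K _) (signMap K _) :=
      tot_tensor_ext fun p q a b => by
        obtain ⟨z, hz⟩ := rackMul_inc_mem p q a b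
        simp only [LinearMap.comp_apply, TensorProduct.map_tmul, signMap_inc, ← hz,
          ← TensorProduct.smul_tmul', TensorProduct.tmul_smul, map_smul, smul_smul, pow_add,
          mul_comm]
    exact LinearMap.congr_fun this (c ⊗ₜ c')
  have : dM K X ∘ₗ rackMul K X ∘ₗ TensorProduct.mk K _ _ c =
      rackMul K X ∘ₗ TensorProduct.mk K _ _ (dM K X c) +
        rackMul K X ∘ₗ TensorProduct.mk K _ _ (signMap K _ c) ∘ₗ dM K X :=
    chain_hom_ext_snoc
      (fun a => by
        simp only [LinearMap.comp_apply, LinearMap.add_apply, TensorProduct.mk_apply,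
          rackMul_cell_nil, rackD_cell_nil, dM_rmulOp, map_zero,
          add_zero])
      (fun c' y ih => by
        simp only [LinearMap.comp_apply, LinearMap.add_apply, TensorProduct.mk_apply,
          rackMul_snocOp, dM_snocOp, map_add, map_sub] at ih ⊢
        rw [ih, map_add, hs, ← rackMul_rmulOp, hs]
        abel)
  exact LinearMap.congr_fun this c'

theorem isDGAlg_rackAlg : IsDGAlg (dM K X) (rackAlg K X) where
  d_sq := dM_dM
  leibniz := TensorProduct.ext' fun a b => by
    rw [LinearMap.comp_apply, LinearMap.comp_apply, tensorD, LinearMap.add_apply, map_add]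
    exact dM_rackMul a b

end RackMul

/-! ### The counit -/

section RackCounit

variable {K : Type v} [CommRing K] {X : Type u}

/-- The counit on homogeneous elements. -/
def counitHom (K : Type v) [CommRing K] (X S : Type u) : ∀ n, Chain K X S n →ₗ[K] K
  | 0 => Finsupp.linearCombination K fun _ => 1
  | _ + 1 => 0

/-- The counit. -/
def rackCounit (K : Type v) [CommRing K] (X S : Type u) : Tot (Chain K X S) →ₗ[K] K :=
  DirectSum.toModule K ℕ _ (counitHom K X S)

theorem rackCounit_inc_succ {S : Type u} (n : ℕ) (a : Chain K X S (n + 1)) :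
    rackCounit K X S (inc K _ (n + 1) a) = 0 := by
  rw [rackCounit, DirectSum.toModule_lof]
  rfl

theorem rackCounit_cell_nil {S : Type u} (s : S) : rackCounit K X S (cell K s ![]) = 1 := by
  rw [rackCounit, cell, DirectSum.toModule_lof, counitHom, Finsupp.linearCombination_single,
    one_smul]

theorem rackCounit_snocOp {S : Type u} (y : X) (c : Tot (Chain K X S)) :
    rackCounit K X S (snocOp K y c) = 0 := by
  have : rackCounit K X S ∘ₗ snocOp K y = 0 := tot_hom_ext fun n a => by
    rw [LinearMap.comp_apply, snocOp_inc, rackCounit_inc_succ, LinearMap.zero_apply]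
  exact LinearMap.congr_fun this c

theorem rackCounit_signMap {S : Type u} (c : Tot (Chain K X S)) :
    rackCounit K X S (signMap K _ c) = rackCounit K X S c := by
  have : rackCounit K X S ∘ₗ signMap K _ = rackCounit K X S := tot_hom_ext fun n a => by
    rw [LinearMap.comp_apply, signMap_inc]
    cases n with
    | zero => simp
    | succ n => rw [map_smul, rackCounit_inc_succ, smul_zero]
  exact LinearMap.congr_fun this c

end RackCounit

/-! ### The coproduct of the rack bialgebra -/

section RackComul

variable {K : Type v} [CommRing K] {X : Type u} [Shelf X]

/-- Right multiplication by `Δ e_y = e_y ⊗ y + 1 ⊗ e_y`. -/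
def snocOpTensor (K : Type v) [CommRing K] {X : Type u} [Shelf X] (y : X) :
    (Tot (Chain K X (StructMonoid X)) ⊗[K] Tot (Chain K X (StructMonoid X))) →ₗ[K]
      (Tot (Chain K X (StructMonoid X)) ⊗[K] Tot (Chain K X (StructMonoid X))) :=
  TensorProduct.map (snocOp K y) (rmulOp K (gen y) ∘ₗ signMap K _) +
    TensorProduct.map LinearMap.id (snocOp K y)

theorem snocOpTensor_tmul (y : X) (a b : Tot (Chain K X (StructMonoid X))) :
    snocOpTensor K y (a ⊗ₜ b) =
      snocOp K y a ⊗ₜ rmulOp K (gen y) (signMap K _ b) + a ⊗ₜ snocOp K y b := by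
  simp [snocOpTensor]

/-- The coproduct of a cell. -/
def comulCell (K : Type v) [CommRing K] {X : Type u} [Shelf X] (a : StructMonoid X) :
    ∀ n, (Fin n → X) → Tot (Chain K X (StructMonoid X)) ⊗[K] Tot (Chain K X (StructMonoid X))
  | 0, _ => cell K a ![] ⊗ₜ cell K a ![]
  | n + 1, x => snocOpTensor K (x (Fin.last n)) (comulCell K a n (Fin.init x))

/-- The coproduct of the rack bialgebra. -/
def rackComul (K : Type v) [CommRing K] (X : Type u) [Shelf X] :
    Tot (Chain K X (StructMonoid X)) →ₗ[K]
      (Tot (Chain K X (StructMonoid X)) ⊗[K] Tot (Chain K X (StructMonoid X))) :=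
  DirectSum.toModule K ℕ _ fun n => Finsupp.linearCombination K fun c => comulCell K c.1 n c.2

theorem rackComul_cell (a : StructMonoid X) {n : ℕ} (x : Fin n → X) :
    rackComul K X (cell K a x) = comulCell K a n x := by
  rw [rackComul, cell, DirectSum.toModule_lof, Finsupp.linearCombination_single, one_smul]

theorem rackComul_cell_nil (a : StructMonoid X) :
    rackComul K X (cell K a ![]) = cell K a ![] ⊗ₜ cell K a ![] := rackComul_cell a _

theorem rackComul_snocOp (y : X) (c : Tot (Chain K X (StructMonoid X))) :
    rackComul K X (snocOp K y c) = snocOpTensor K y (rackComul K X c) := by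
  have : rackComul K X ∘ₗ snocOp K y = snocOpTensor K y ∘ₗ rackComul K X :=
    chain_hom_ext fun a n x => by
      simp only [LinearMap.comp_apply, snocOp_cell, rackComul_cell, comulCell, Fin.snoc_last,
        Fin.init_snoc]
  exact LinearMap.congr_fun this c

theorem rackCounit_rmulOp (b : StructMonoid X) (c : Tot (Chain K X (StructMonoid X))) :
    rackCounit K X _ (rmulOp K b c) = rackCounit K X _ c := by
  have : rackCounit K X _ ∘ₗ rmulOp K b = rackCounit K X _ := chain_hom_ext_snoc
    (fun a => by rw [LinearMap.comp_apply, rmulOp_cell_nil, rackCounit_cell_nil,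
      rackCounit_cell_nil])
    (fun c y _ => by rw [LinearMap.comp_apply, rmulOp_snocOp, rackCounit_snocOp,
      rackCounit_snocOp])
  exact LinearMap.congr_fun this c

theorem rackComul_rmulOp (b : StructMonoid X) (c : Tot (Chain K X (StructMonoid X))) :
    rackComul K X (rmulOp K b c) =
      TensorProduct.map (rmulOp K b) (rmulOp K b) (rackComul K X c) := by
  have hΘ (y : X) : TensorProduct.map (rmulOp K b) (rmulOp K b) ∘ₗ snocOpTensor K y =
      snocOpTensor K (ract y b) ∘ₗ TensorProduct.map (rmulOp K b) (rmulOp K b) :=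
    TensorProduct.ext' fun u v => by
      simp only [LinearMap.comp_apply, snocOpTensor_tmul, TensorProduct.map_tmul, map_add,
        rmulOp_snocOp, signMap_rmulOp, rmulOp_rmulOp, gen_mul]
  have : rackComul K X ∘ₗ rmulOp K b =
      TensorProduct.map (rmulOp K b) (rmulOp K b) ∘ₗ rackComul K X := chain_hom_ext_snoc
    (fun a => by
      simp only [LinearMap.comp_apply, rmulOp_cell_nil, rackComul_cell_nil,
        TensorProduct.map_tmul])
    (fun c y ih => by
      simp only [LinearMap.comp_apply, rmulOp_snocOp, rackComul_snocOp] at ih ⊢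
      rw [ih]
      exact (LinearMap.congr_fun (hΘ y) _).symm)
  exact LinearMap.congr_fun this c

theorem snocOpTensor_signMap (y : X) (t) :
    snocOpTensor K y (TensorProduct.map (signMap K _) (signMap K _) t) =
      - TensorProduct.map (signMap K (Chain K X (StructMonoid X))) (signMap K _)
        (snocOpTensor K y t) := by
  have : snocOpTensor K y ∘ₗ TensorProduct.map (signMap K _) (signMap K _) =
      - (TensorProduct.map (signMap K (Chain K X (StructMonoid X))) (signMap K _) ∘ₗ
        snocOpTensor K y) :=
    TensorProduct.ext' fun u v => by
      simp only [LinearMap.comp_apply, snocOpTensor_tmul, TensorProduct.map_tmul, map_add,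
        LinearMap.neg_apply, signMap_snocOp, signMap_rmulOp, TensorProduct.neg_tmul,
        TensorProduct.tmul_neg]
      abel
  exact LinearMap.congr_fun this t

theorem rackComul_signMap (c : Tot (Chain K X (StructMonoid X))) :
    rackComul K X (signMap K _ c) =
      TensorProduct.map (signMap K _) (signMap K _) (rackComul K X c) := by
  have : rackComul K X ∘ₗ signMap K _ =
      TensorProduct.map (signMap K _) (signMap K _) ∘ₗ rackComul K X := chain_hom_ext_snoc
    (fun a => by
      simp only [LinearMap.comp_apply, signMap_cell, pow_zero, one_smul, rackComul_cell_nil,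
        TensorProduct.map_tmul])
    (fun c y ih => by
      have h := signMap_snocOp y c
      simp only [LinearMap.comp_apply, h, map_neg, rackComul_snocOp] at ih ⊢
      rw [ih, snocOpTensor_signMap, neg_neg])
  exact LinearMap.congr_fun this c

theorem snocOpTensor_mem_tensorDeg (y : X) (n : ℕ) (t)
    (ht : t ∈ tensorDeg K (Chain K X (StructMonoid X)) n) :
    snocOpTensor K y t ∈ tensorDeg K (Chain K X (StructMonoid X)) (n + 1) := by
  have : tensorDeg K (Chain K X (StructMonoid X)) n ≤
      LinearMap.ker ((tensorDeg K _ (n + 1)).mkQ ∘ₗ snocOpTensor K y) :=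
    tensorDeg_le_ker fun p q a b hpq => by
      rw [LinearMap.comp_apply, Submodule.mkQ_apply, Submodule.Quotient.mk_eq_zero,
        snocOpTensor_tmul, snocOp_inc, snocOp_inc, signMap_inc, map_smul, rmulOp_inc,
        TensorProduct.tmul_smul]
      exact add_mem (Submodule.smul_mem _ _ (tmul_mem_tensorDeg _ _ (by omega) _ _))
        (tmul_mem_tensorDeg _ _ (by omega) _ _)
  exact (Submodule.Quotient.mk_eq_zero _).1 (this ht)

theorem comulCell_mem_tensorDeg (a : StructMonoid X) (n : ℕ) (x : Fin n → X) :
    comulCell K a n x ∈ tensorDeg K _ n := by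
  induction n with
  | zero => exact tmul_mem_tensorDeg 0 0 rfl _ _
  | succ n ih => exact snocOpTensor_mem_tensorDeg _ _ _ (ih _)

/-- Both iterated coproducts convert right multiplication by e_y into the same operator on the
triple tensor product, multiplication by e_y ⊗ y ⊗ y + 1 ⊗ e_y ⊗ y + 1 ⊗ 1 ⊗ e_y. `h1` and `h2`
compute it for the two bracketings and `h3` compares them. -/
theorem rackComul_coassoc :
    (TensorProduct.assoc K _ _ _).toLinearMap ∘ₗ
      TensorProduct.map (rackComul K X) LinearMap.id ∘ₗ rackComul K X =
    TensorProduct.map LinearMap.id (rackComul K X) ∘ₗ rackComul K X := by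
  refine chain_hom_ext_snoc (fun a => ?_) (fun c y ih => ?_)
  · simp only [LinearMap.comp_apply, rackComul_cell_nil, TensorProduct.map_tmul,
      LinearMap.id_apply]
    rfl
  · have h1 : TensorProduct.map (rackComul K X) LinearMap.id ∘ₗ snocOpTensor K y =
        (TensorProduct.map (snocOpTensor K y) (rmulOp K (gen y) ∘ₗ signMap K _) +
          TensorProduct.map LinearMap.id (snocOp K y)) ∘ₗ
          TensorProduct.map (rackComul K X) LinearMap.id :=
      TensorProduct.ext' fun u v => by simp [snocOpTensor_tmul, rackComul_snocOp]
    have h2 : TensorProduct.map LinearMap.id (rackComul K X) ∘ₗ snocOpTensor K y =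
        (TensorProduct.map (snocOp K y) (TensorProduct.map (rmulOp K (gen y) ∘ₗ signMap K _)
          (rmulOp K (gen y) ∘ₗ signMap K _)) +
          TensorProduct.map LinearMap.id (snocOpTensor K y)) ∘ₗ
          TensorProduct.map LinearMap.id (rackComul K X) :=
      TensorProduct.ext' fun u v => by
        simp only [LinearMap.comp_apply, LinearMap.add_apply, TensorProduct.map_tmul,
          snocOpTensor_tmul, map_add, rackComul_snocOp, rackComul_rmulOp, rackComul_signMap,
          LinearMap.id_apply, TensorProduct.map_comp]
    have h3 : (TensorProduct.assoc K _ _ _).toLinearMap ∘ₗ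
        (TensorProduct.map (snocOpTensor K y) (rmulOp K (gen y) ∘ₗ signMap K _) +
          TensorProduct.map LinearMap.id (snocOp K y)) =
        (TensorProduct.map (snocOp K y) (TensorProduct.map (rmulOp K (gen y) ∘ₗ signMap K _)
          (rmulOp K (gen y) ∘ₗ signMap K _)) +
          TensorProduct.map LinearMap.id (snocOpTensor K y)) ∘ₗ
          (TensorProduct.assoc K (Tot (Chain K X (StructMonoid X))) _ _).toLinearMap :=
      TensorProduct.ext_threefold fun u v w => by
        simp [snocOpTensor_tmul, TensorProduct.add_tmul, TensorProduct.tmul_add, add_assoc]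
    have h1' := LinearMap.congr_fun h1 (rackComul K X c)
    have h2' := LinearMap.congr_fun h2 (rackComul K X c)
    have h3' := LinearMap.congr_fun h3 (TensorProduct.map (rackComul K X) LinearMap.id
      (rackComul K X c))
    simp only [LinearMap.comp_apply] at ih h1' h2' h3' ⊢
    rw [rackComul_snocOp, h1', h2', h3', ih]

variable (K X) in
/-- The coalgebra structure on `C(X, M)`. -/
def rackCoalg : GrCoalg K (Chain K X (StructMonoid X)) where
  comul := rackComul K X
  counit := rackCounit K X _
  comul_deg n a := by
    rw [rackComul, DirectSum.toModule_lof, Finsupp.linearCombination_apply]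
    apply Submodule.finsuppSum_mem
    intro c _
    exact Submodule.smul_mem _ _ (comulCell_mem_tensorDeg _ _ _)
  counit_deg := rackCounit_inc_succ
  coassoc := rackComul_coassoc
  counit_comul c := by
    have hΘ (y : X) : (TensorProduct.lid K _).toLinearMap ∘ₗ
        TensorProduct.map (rackCounit K X _) LinearMap.id ∘ₗ snocOpTensor K y =
        snocOp K y ∘ₗ (TensorProduct.lid K _).toLinearMap ∘ₗ
          TensorProduct.map (rackCounit K X _) LinearMap.id :=
      TensorProduct.ext' fun u v => by simp [snocOpTensor_tmul, rackCounit_snocOp]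
    have : (TensorProduct.lid K _).toLinearMap ∘ₗ
        TensorProduct.map (rackCounit K X _) LinearMap.id ∘ₗ rackComul K X = LinearMap.id :=
      chain_hom_ext_snoc
        (fun a => by simp [rackComul_cell_nil, rackCounit_cell_nil])
        (fun c y ih => by
          have h := LinearMap.congr_fun (hΘ y) (rackComul K X c)
          simp only [LinearMap.comp_apply, LinearMap.id_apply, rackComul_snocOp] at h ih ⊢
          rw [h, ih])
    exact LinearMap.congr_fun this c
  comul_counit c := by
    have hΘ (y : X) : (TensorProduct.rid K _).toLinearMap ∘ₗ
        TensorProduct.map LinearMap.id (rackCounit K X _) ∘ₗ snocOpTensor K y =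
        snocOp K y ∘ₗ (TensorProduct.rid K _).toLinearMap ∘ₗ
          TensorProduct.map LinearMap.id (rackCounit K X _) :=
      TensorProduct.ext' fun u v => by
        simp [snocOpTensor_tmul, rackCounit_snocOp, rackCounit_rmulOp, rackCounit_signMap]
    have : (TensorProduct.rid K _).toLinearMap ∘ₗ
        TensorProduct.map LinearMap.id (rackCounit K X _) ∘ₗ rackComul K X = LinearMap.id :=
      chain_hom_ext_snoc
        (fun a => by simp [rackComul_cell_nil, rackCounit_cell_nil])
        (fun c y ih => by
          have h := LinearMap.congr_fun (hΘ y) (rackComul K X c)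
          simp only [LinearMap.comp_apply, LinearMap.id_apply, rackComul_snocOp] at h ih ⊢
          rw [h, ih])
    exact LinearMap.congr_fun this c

theorem tensorMul_cell_nil (b : StructMonoid X) (t) :
    tensorMul K _ (rackMul K X) (t ⊗ₜ (cell K b ![] ⊗ₜ cell K b ![])) =
      TensorProduct.map (rmulOp K b) (rmulOp K b) t := by
  have : tensorMul K _ (rackMul K X) ∘ₗ
      (TensorProduct.mk K _ _).flip (cell K b ![] ⊗ₜ cell K b ![]) =
      TensorProduct.map (rmulOp K b) (rmulOp K b) := tot_tensor_ext fun p q u v => by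
    rw [LinearMap.comp_apply, LinearMap.flip_apply, TensorProduct.mk_apply, cell, tensorMul_inc,
      mul_zero, pow_zero, one_smul]
    exact congrArg₂ _ (rackMul_cell_nil _ _) (rackMul_cell_nil _ _)
  exact LinearMap.congr_fun this t

/-- `snocOpTensor` is right multiplication by Δ(e_y), so this is an instance of associativity in the
tensor square. It makes multiplicativity of Δ an induction on the right factor. -/
theorem tensorMul_snocOpTensor (s t) (y : X) :
    tensorMul K _ (rackMul K X) (s ⊗ₜ snocOpTensor K y t) =
      snocOpTensor K y (tensorMul K _ (rackMul K X) (s ⊗ₜ t)) := by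
  have : tensorMul K _ (rackMul K X) ∘ₗ TensorProduct.map LinearMap.id (snocOpTensor K y) =
      snocOpTensor K y ∘ₗ tensorMul K _ (rackMul K X) :=
    tot_tensor_ext_four fun p q r s a b a' b' => by
      obtain ⟨z, hz⟩ := rackMul_inc_mem q s b b'
      simp only [LinearMap.comp_apply, TensorProduct.map_tmul, LinearMap.id_apply,
        snocOpTensor_tmul, TensorProduct.tmul_add, map_add, signMap_inc, map_smul,
        TensorProduct.tmul_smul, rmulOp_inc, snocOp_inc, tensorMul_inc]
      simp only [← snocOp_inc, ← rmulOp_inc, rackMul_snocOp, rackMul_rmulOp, smul_smul]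
      rw [← hz, signMap_inc, map_smul, TensorProduct.tmul_smul, smul_add, smul_smul]
      congr 2
      ring
  exact LinearMap.congr_fun this (s ⊗ₜ t)

variable (K X) in
/-- The bialgebra structure on `C(X, M)`. -/
def rackBialg : GrBialg K (Chain K X (StructMonoid X)) where
  toGrAlg := rackAlg K X
  comul := (rackCoalg K X).comul
  counit := (rackCoalg K X).counit
  comul_deg := (rackCoalg K X).comul_deg
  counit_deg := (rackCoalg K X).counit_deg
  coassoc := (rackCoalg K X).coassoc
  counit_comul := (rackCoalg K X).counit_comul
  comul_counit := (rackCoalg K X).comul_counit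
  comul_mul c c' := by
    have : rackComul K X ∘ₗ rackMul K X ∘ₗ TensorProduct.mk K _ _ c =
        tensorMul K _ (rackMul K X) ∘ₗ TensorProduct.mk K _ _ (rackComul K X c) ∘ₗ
          rackComul K X :=
      chain_hom_ext_snoc
        (fun a => by
          simp only [LinearMap.comp_apply, TensorProduct.mk_apply, rackMul_cell_nil,
            rackComul_cell_nil, tensorMul_cell_nil, rackComul_rmulOp])
        (fun c' y ih => by
          simp only [LinearMap.comp_apply, TensorProduct.mk_apply, rackMul_snocOp,
            rackComul_snocOp, tensorMul_snocOpTensor] at ih ⊢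
          rw [ih])
    exact LinearMap.congr_fun this c'
  comul_one := rackComul_cell_nil 1
  counit_mul c c' := by
    have : rackCounit K X _ ∘ₗ rackMul K X ∘ₗ TensorProduct.mk K _ _ c =
        rackCounit K X _ c • rackCounit K X _ :=
      chain_hom_ext_snoc
        (fun a => by
          simp [rackMul_cell_nil, rackCounit_rmulOp, rackCounit_cell_nil])
        (fun c' y ih => by
          simp [rackMul_snocOp, rackCounit_snocOp])
    exact LinearMap.congr_fun this c'
  counit_one := rackCounit_cell_nil 1

theorem isRackBialg_rackBialg : IsRackBialg (rackBialg K X) where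
  one_eq := rfl
  monoid_mul a b n x := rackMul_cell_nil_left a b x
  mul_e a n x y := by
    have h : cell K (1 : StructMonoid X) ![y] = snocOp K y (cell K 1 ![]) := by
      rw [snocOp_cell]
      congr 1
      exact funext fun i => by rw [Subsingleton.elim i (Fin.last 0)]; simp
    rw [h]
    refine (rackMul_snocOp _ _ _).trans ?_
    rw [rackMul_cell_nil, rmulOp_one, snocOp_cell]
  e_mul x y := by
    refine (rackMul_cell_nil _ _).trans ?_
    rw [rmulOp_cell, one_mul]
    congr 1
    exact funext fun i => by rw [Subsingleton.elim i 0]; simp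
  comul_gen x := rackComul_cell_nil _
  comul_e x := by
    have h : cell K (1 : StructMonoid X) ![x] = snocOp K x (cell K 1 ![]) := by
      rw [snocOp_cell]
      congr 1
      exact funext fun i => by rw [Subsingleton.elim i (Fin.last 0)]; simp
    rw [h]
    refine (rackComul_snocOp _ _).trans ?_
    rw [rackComul_cell_nil, snocOpTensor_tmul, signMap_cell, pow_zero, one_smul, rmulOp_cell_nil,
      one_mul]
  counit_gen x := rackCounit_cell_nil _
  counit_e x := rackCounit_inc_succ _ _

/-- The tensor-square counterpart of `dM_snocOp`: the differential of Δ(e_y) telescopes to 1 ⊗ 1 - y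
⊗ y. -/
theorem tensorD_snocOpTensor (y : X) (t) :
    tensorD K _ (dM K X) (snocOpTensor K y t) = snocOpTensor K y (tensorD K _ (dM K X) t) +
      TensorProduct.map (signMap K _) (signMap K _)
        (t - TensorProduct.map (rmulOp K (gen y)) (rmulOp K (gen y)) t) := by
  have : tensorD K _ (dM K X) ∘ₗ snocOpTensor K y =
      snocOpTensor K y ∘ₗ tensorD K _ (dM K X) +
        TensorProduct.map (signMap K _) (signMap K _) ∘ₗ
          (LinearMap.id - TensorProduct.map (rmulOp K (gen y)) (rmulOp K (gen y))) :=
    TensorProduct.ext' fun u v => by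
      simp only [LinearMap.comp_apply, LinearMap.add_apply, LinearMap.sub_apply,
        LinearMap.id_apply, TensorProduct.map_tmul, tensorD, snocOpTensor_tmul, map_add, map_sub,
        dM_snocOp, dM_rmulOp, dM_signMap, signMap_snocOp, signMap_rmulOp, map_neg,
        TensorProduct.tmul_add, TensorProduct.add_tmul, TensorProduct.tmul_sub,
        TensorProduct.sub_tmul, TensorProduct.tmul_neg, TensorProduct.neg_tmul]
      abel
  exact LinearMap.congr_fun this t

theorem isDGCoalg_rackCoalg : IsDGCoalg (dM K X) (rackBialg K X).toGrCoalg where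
  d_sq := dM_dM
  coleibniz := by
    change rackComul K X ∘ₗ dM K X = tensorD K _ (dM K X) ∘ₗ rackComul K X
    refine chain_hom_ext_snoc (fun a => ?_) (fun c y ih => ?_)
    · simp [rackComul_cell_nil, rackD_cell_nil, tensorD]
    · simp only [LinearMap.comp_apply, dM_snocOp, map_add, rackComul_snocOp, rackComul_signMap,
        map_sub, rackComul_rmulOp, tensorD_snocOpTensor] at ih ⊢
      rw [ih]

theorem isDGBialg_rackBialg : IsDGBialg (dM K X) (rackBialg K X) where
  alg := isDGAlg_rackAlg
  coalg := isDGCoalg_rackCoalg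

end RackComul

/-! ### The quotient coalgebra `C(X)` -/

section RackPt

variable {K : Type v} [CommRing K] {X : Type u} [Shelf X]

theorem forget_inc (n : ℕ) (a : Chain K X (StructMonoid X) n) :
    forget K X (inc K _ n a) =
      inc K (Chain K X (Pt X)) n (Finsupp.lmapDomain K K (fun c => (PUnit.unit, c.2)) a) := by
  rw [forget, DirectSum.lmap_lof]

theorem forget_cell (a : StructMonoid X) {n : ℕ} (x : Fin n → X) :
    forget K X (cell K a x) = cell K PUnit.unit x := by
  rw [cell, forget_inc, Finsupp.lmapDomain_apply, Finsupp.mapDomain_single]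
  rfl

/-- The section `x_1 ⋯ x_n ↦ 1 x_1 ⋯ x_n` of the projection `C(X, M) → C(X)`. -/
def unforget (K : Type v) [CommRing K] (X : Type u) [Shelf X] :
    Tot (Chain K X (Pt X)) →ₗ[K] Tot (Chain K X (StructMonoid X)) :=
  DirectSum.lmap (fun _ => Finsupp.lmapDomain K K (fun c => (1, c.2)))

theorem unforget_cell (s : Pt X) {n : ℕ} (x : Fin n → X) :
    unforget K X (cell K s x) = cell K 1 x := by
  rw [unforget, cell, DirectSum.lmap_lof, Finsupp.lmapDomain_apply, Finsupp.mapDomain_single]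
  rfl

theorem forget_unforget (c : Tot (Chain K X (Pt X))) : forget K X (unforget K X c) = c := by
  have : forget K X ∘ₗ unforget K X = LinearMap.id := chain_hom_ext fun s n x => by
    rw [LinearMap.comp_apply, unforget_cell, forget_cell]
    rfl
  exact LinearMap.congr_fun this c

theorem forget_surjective : Function.Surjective (forget K X) :=
  Function.RightInverse.surjective forget_unforget

theorem pt_hom_ext {W : Type*} [AddCommGroup W] [Module K W]
    {f g : Tot (Chain K X (Pt X)) →ₗ[K] W} (h : f ∘ₗ forget K X = g ∘ₗ forget K X) : f = g :=
  (LinearMap.cancel_right forget_surjective).1 h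

theorem forget_snocOp (y : X) (c : Tot (Chain K X (StructMonoid X))) :
    forget K X (snocOp K y c) = snocOp K y (forget K X c) := by
  have : forget K X ∘ₗ snocOp K y = snocOp K y ∘ₗ forget K X := chain_hom_ext fun a n x => by
    simp only [LinearMap.comp_apply, snocOp_cell, forget_cell]
  exact LinearMap.congr_fun this c

theorem unforget_snocOp (y : X) (c : Tot (Chain K X (Pt X))) :
    unforget K X (snocOp K y c) = snocOp K y (unforget K X c) := by
  have : unforget K X ∘ₗ snocOp K y = snocOp K y ∘ₗ unforget K X := chain_hom_ext fun a n x => by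
    simp only [LinearMap.comp_apply, snocOp_cell, unforget_cell]
  exact LinearMap.congr_fun this c

theorem forget_signMap (c : Tot (Chain K X (StructMonoid X))) :
    forget K X (signMap K _ c) = signMap K _ (forget K X c) := by
  have : forget K X ∘ₗ signMap K _ = signMap K _ ∘ₗ forget K X := tot_hom_ext fun n a => by
    simp only [LinearMap.comp_apply, signMap_inc, map_smul, forget_inc]
  exact LinearMap.congr_fun this c

theorem forget_dM (c : Tot (Chain K X (StructMonoid X))) :
    forget K X (dM K X c) = dPt K X (forget K X c) := by
  have : forget K X ∘ₗ dM K X = dPt K X ∘ₗ forget K X := chain_hom_ext fun a n x => by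
    cases n with
    | zero =>
      rw [Subsingleton.elim x ![], LinearMap.comp_apply, LinearMap.comp_apply, forget_cell,
        rackD_cell_nil, rackD_cell_nil, map_zero]
    | succ n =>
      simp only [LinearMap.comp_apply, forget_cell, rackD_cell, map_sum, map_smul, map_sub]
  exact LinearMap.congr_fun this c

/-- Right multiplication by y acts on the letters x_i independently of the M-coordinate, hence
descends to C(X). -/
theorem exists_forget_rmulOp (y : X) :
    ∃ g : Tot (Chain K X (Pt X)) →ₗ[K] Tot (Chain K X (Pt X)),
      ∀ c, forget K X (rmulOp K (gen y) c) = g (forget K X c) := by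
  refine ⟨forget K X ∘ₗ rmulOp K (gen y) ∘ₗ unforget K X, fun c => ?_⟩
  have : forget K X ∘ₗ rmulOp K (gen y) =
      (forget K X ∘ₗ rmulOp K (gen y) ∘ₗ unforget K X) ∘ₗ forget K X :=
    chain_hom_ext fun a n x => by
      simp only [LinearMap.comp_apply, rmulOp_cell, forget_cell, unforget_cell]
  exact LinearMap.congr_fun this c

/-- The coproduct of `C(X)`. -/
def ptComul (K : Type v) [CommRing K] (X : Type u) [Shelf X] :
    Tot (Chain K X (Pt X)) →ₗ[K] (Tot (Chain K X (Pt X)) ⊗[K] Tot (Chain K X (Pt X))) :=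
  TensorProduct.map (forget K X) (forget K X) ∘ₗ rackComul K X ∘ₗ unforget K X

/-- The coproduct of C(X) is defined through the section with M-coordinate 1. The claim is
independence of that choice: modulo `forget`, multiplication by Δ(e_y) descends, and so c and its
normalised lift have the same image at every step of the induction. -/
theorem ptComul_comp_forget : ptComul K X ∘ₗ forget K X =
    TensorProduct.map (forget K X) (forget K X) ∘ₗ rackComul K X := by
  refine chain_hom_ext_snoc (fun a => ?_) (fun c y ih => ?_)
  · simp only [ptComul, LinearMap.comp_apply, forget_cell, unforget_cell, rackComul_cell_nil,
      TensorProduct.map_tmul]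
  · obtain ⟨g, hg⟩ := exists_forget_rmulOp (K := K) y
    have hΘ : TensorProduct.map (forget K X) (forget K X) ∘ₗ snocOpTensor K y =
        (TensorProduct.map (snocOp K y) (g ∘ₗ signMap K _) +
          TensorProduct.map LinearMap.id (snocOp K y)) ∘ₗ
          TensorProduct.map (forget K X) (forget K X) := TensorProduct.ext' fun u v => by
      simp only [LinearMap.comp_apply, LinearMap.add_apply, snocOpTensor_tmul, map_add,
        TensorProduct.map_tmul, forget_snocOp, hg, forget_signMap, LinearMap.id_apply]
    have h1 := LinearMap.congr_fun hΘ (rackComul K X c)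
    have h2 := LinearMap.congr_fun hΘ (rackComul K X (unforget K X (forget K X c)))
    simp only [ptComul, LinearMap.comp_apply, forget_snocOp, unforget_snocOp,
      rackComul_snocOp] at ih h1 h2 ⊢
    rw [h1, h2, ih]

theorem ptComul_forget (c : Tot (Chain K X (StructMonoid X))) : ptComul K X (forget K X c) =
    TensorProduct.map (forget K X) (forget K X) (rackComul K X c) :=
  LinearMap.congr_fun ptComul_comp_forget c

theorem rackCounit_forget (c : Tot (Chain K X (StructMonoid X))) :
    rackCounit K X (Pt X) (forget K X c) = rackCounit K X _ c := by
  have : rackCounit K X (Pt X) ∘ₗ forget K X = rackCounit K X _ := chain_hom_ext_snoc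
    (fun a => by
      rw [LinearMap.comp_apply, forget_cell, rackCounit_cell_nil, rackCounit_cell_nil])
    (fun c y _ => by
      rw [LinearMap.comp_apply, forget_snocOp, rackCounit_snocOp, rackCounit_snocOp])
  exact LinearMap.congr_fun this c

variable (K X) in
/-- The coalgebra structure on `C(X)`. -/
def ptCoalg : GrCoalg K (Chain K X (Pt X)) where
  comul := ptComul K X
  counit := rackCounit K X _
  comul_deg n a := by
    obtain ⟨b, rfl⟩ : ∃ b : Chain K X (StructMonoid X) n,
        Finsupp.lmapDomain K K (fun c => (PUnit.unit, c.2)) b = a := by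
      refine ⟨Finsupp.lmapDomain K K (fun c => (1, c.2)) a, ?_⟩
      simp only [Finsupp.lmapDomain_apply, ← Finsupp.mapDomain_comp]
      exact Finsupp.mapDomain_id
    rw [← forget_inc, ptComul_forget]
    have : tensorDeg K (Chain K X (StructMonoid X)) n ≤ LinearMap.ker
        ((tensorDeg K _ n).mkQ ∘ₗ TensorProduct.map (forget K X) (forget K X)) :=
      tensorDeg_le_ker fun p q a b hpq => by
        rw [LinearMap.comp_apply, Submodule.mkQ_apply, Submodule.Quotient.mk_eq_zero,
          TensorProduct.map_tmul, forget_inc, forget_inc]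
        exact tmul_mem_tensorDeg p q hpq _ _
    exact (Submodule.Quotient.mk_eq_zero _).1 (this ((rackCoalg K X).comul_deg n b))
  counit_deg := rackCounit_inc_succ
  coassoc := by
    refine pt_hom_ext (LinearMap.ext fun c => ?_)
    have h1 : TensorProduct.map (ptComul K X) LinearMap.id ∘ₗ
        TensorProduct.map (forget K X) (forget K X) =
        TensorProduct.map (TensorProduct.map (forget K X) (forget K X)) (forget K X) ∘ₗ
          TensorProduct.map (rackComul K X) LinearMap.id :=
      TensorProduct.ext' fun u v => by simp [ptComul_forget]
    have h2 : TensorProduct.map LinearMap.id (ptComul K X) ∘ₗ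
        TensorProduct.map (forget K X) (forget K X) =
        TensorProduct.map (forget K X) (TensorProduct.map (forget K X) (forget K X)) ∘ₗ
          TensorProduct.map LinearMap.id (rackComul K X) :=
      TensorProduct.ext' fun u v => by simp [ptComul_forget]
    have h3 : (TensorProduct.assoc K _ _ _).toLinearMap ∘ₗ
        TensorProduct.map (TensorProduct.map (forget K X) (forget K X)) (forget K X) =
        TensorProduct.map (forget K X) (TensorProduct.map (forget K X) (forget K X)) ∘ₗ
          (TensorProduct.assoc K _ _ _).toLinearMap :=
      TensorProduct.ext_threefold fun u v w => rfl
    have h1' := LinearMap.congr_fun h1 (rackComul K X c)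
    have h2' := LinearMap.congr_fun h2 (rackComul K X c)
    have h3' := LinearMap.congr_fun h3 (TensorProduct.map (rackComul K X) LinearMap.id
      (rackComul K X c))
    have h4' := LinearMap.congr_fun (rackComul_coassoc (K := K) (X := X)) c
    simp only [LinearMap.comp_apply] at h1' h2' h3' h4' ⊢
    rw [ptComul_forget, h1', h2', h3', h4']
  counit_comul c := by
    obtain ⟨c, rfl⟩ := forget_surjective c
    have h1 : (TensorProduct.lid K _).toLinearMap ∘ₗ
        TensorProduct.map (rackCounit K X (Pt X)) LinearMap.id ∘ₗ
        TensorProduct.map (forget K X) (forget K X) =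
        forget K X ∘ₗ (TensorProduct.lid K _).toLinearMap ∘ₗ
          TensorProduct.map (rackCounit K X _) LinearMap.id :=
      TensorProduct.ext' fun u v => by simp [rackCounit_forget]
    rw [ptComul_forget]
    exact (LinearMap.congr_fun h1 _).trans (congrArg (forget K X) ((rackCoalg K X).counit_comul c))
  comul_counit c := by
    obtain ⟨c, rfl⟩ := forget_surjective c
    have h1 : (TensorProduct.rid K _).toLinearMap ∘ₗ
        TensorProduct.map LinearMap.id (rackCounit K X (Pt X)) ∘ₗ
        TensorProduct.map (forget K X) (forget K X) =
        forget K X ∘ₗ (TensorProduct.rid K _).toLinearMap ∘ₗ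
          TensorProduct.map LinearMap.id (rackCounit K X _) :=
      TensorProduct.ext' fun u v => by simp [rackCounit_forget]
    rw [ptComul_forget]
    exact (LinearMap.congr_fun h1 _).trans (congrArg (forget K X) ((rackCoalg K X).comul_counit c))

theorem isRackCoalg_ptCoalg : IsRackCoalg (rackBialg K X) (ptCoalg K X) where
  comul := ptComul_comp_forget
  counit := LinearMap.ext rackCounit_forget

theorem isDGCoalg_ptCoalg : IsDGCoalg (dPt K X) (ptCoalg K X) where
  d_sq := pt_hom_ext <| LinearMap.ext fun c => by
    simp only [LinearMap.comp_apply, ← forget_dM]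
    exact congrArg (forget K X) (LinearMap.congr_fun dM_dM c)
  coleibniz := pt_hom_ext <| LinearMap.ext fun c => by
    have h1 : tensorD K _ (dPt K X) ∘ₗ TensorProduct.map (forget K X) (forget K X) =
        TensorProduct.map (forget K X) (forget K X) ∘ₗ tensorD K _ (dM K X) :=
      TensorProduct.ext' fun u v => by simp [tensorD, forget_dM, forget_signMap]
    change ptComul K X (dPt K X (forget K X c)) =
      tensorD K _ (dPt K X) (ptComul K X (forget K X c))
    rw [← forget_dM, ptComul_forget, ptComul_forget]
    refine Eq.trans ?_ (LinearMap.congr_fun h1 _).symm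
    exact congrArg _ (LinearMap.congr_fun (isDGCoalg_rackCoalg (K := K) (X := X)).coleibniz c)

end RackPt

/-! ### Contractions onto homology -/

section Contraction

variable {K : Type*} [CommRing K] {V : ℕ → Type*} [∀ n, AddCommGroup (V n)]
  [∀ n, Module K (V n)]

/-- The map of degree `1` with given components. -/
def raise (η : ∀ n, V n →ₗ[K] V (n + 1)) : Tot V →ₗ[K] Tot V :=
  DirectSum.toModule K ℕ _ fun n => inc K V (n + 1) ∘ₗ η n

theorem raise_inc (η : ∀ n, V n →ₗ[K] V (n + 1)) (n : ℕ) (a : V n) :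
    raise η (inc K V n a) = inc K V (n + 1) (η n a) := by
  rw [raise, DirectSum.toModule_lof]
  rfl

theorem signMap_raise (η : ∀ n, V n →ₗ[K] V (n + 1)) (v : Tot V) :
    signMap K V (raise η v) = - raise η (signMap K V v) := by
  have : signMap K V ∘ₗ raise η = - (raise η ∘ₗ signMap K V) := tot_hom_ext fun n a => by
    simp [raise_inc, pow_succ]
  exact LinearMap.congr_fun this v

theorem lmap_inc {W : ℕ → Type*} [∀ n, AddCommGroup (W n)] [∀ n, Module K (W n)]
    (f : ∀ n, V n →ₗ[K] W n) (n : ℕ) (a : V n) :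
    DirectSum.lmap f (inc K V n a) = inc K W n (f n a) := DirectSum.lmap_lof f n a

theorem signMap_lmap {W : ℕ → Type*} [∀ n, AddCommGroup (W n)] [∀ n, Module K (W n)]
    (f : ∀ n, V n →ₗ[K] W n) (v : Tot V) :
    signMap K W (DirectSum.lmap f v) = DirectSum.lmap f (signMap K V v) := by
  have : signMap K W ∘ₗ DirectSum.lmap f = DirectSum.lmap f ∘ₗ signMap K V :=
    tot_hom_ext fun n a => by
      simp only [LinearMap.comp_apply, lmap_inc, signMap_inc, map_smul]
  exact LinearMap.congr_fun this v

/-- A graded deformation retraction of a complex onto its homology. -/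
structure Contraction (d : Tot V →ₗ[K] Tot V) where
  sec : ∀ n, Hlgy d n →ₗ[K] Cyc d n
  proj : ∀ n, V n →ₗ[K] Hlgy d n
  htpy : ∀ n, V n →ₗ[K] V (n + 1)
  mk_sec : ∀ n x, Submodule.Quotient.mk (sec n x) = x
  proj_cyc : ∀ n (z : Cyc d n), proj n z.1 = Submodule.Quotient.mk z
  proj_d : ∀ v, DirectSum.lmap proj (d v) = 0
  htpy_eq : ∀ v, d (raise htpy v) + raise htpy (d v) =
    cycInc d (DirectSum.lmap sec (DirectSum.lmap proj v)) - v

/-- A generalised inverse: split `f` onto its range and extend the splitting linearly to the whole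
target. -/
theorem exists_comp_comp_eq_self (hK : IsField K) {A B : Type*} [AddCommGroup A] [AddCommGroup B]
    [Module K A] [Module K B] (f : A →ₗ[K] B) : ∃ g : B →ₗ[K] A, ∀ a, f (g (f a)) = f a := by
  let _ := hK.toField
  obtain ⟨s, hs⟩ := f.rangeRestrict.exists_rightInverse_of_surjective f.range_rangeRestrict
  obtain ⟨g, hg⟩ := LinearMap.exists_extend s
  refine ⟨g, fun a => ?_⟩
  have h1 : g (f a) = s (f.rangeRestrict a) := LinearMap.congr_fun hg (f.rangeRestrict a)
  rw [h1]
  exact congrArg Subtype.val (LinearMap.congr_fun hs (f.rangeRestrict a))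

theorem exists_section_of_surjective (hK : IsField K) {A B : Type*} [AddCommGroup A]
    [AddCommGroup B] [Module K A] [Module K B] (f : A →ₗ[K] B) (hf : Function.Surjective f) :
    ∃ g : B →ₗ[K] A, ∀ b, f (g b) = b := by
  let _ := hK.toField
  obtain ⟨s, hs⟩ := f.exists_rightInverse_of_surjective (LinearMap.range_eq_top.2 hf)
  exact ⟨s, LinearMap.congr_fun hs⟩

/-- With generalised inverses η of the components of d, 1 - ηd projects onto cycles. Subtracting the
chosen representative of the class leaves a boundary, to which η supplies a preimage under d. -/
theorem Lowers.nonempty_contraction (hK : IsField K) {d : Tot V →ₗ[K] Tot V}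
    {δ : ∀ n, V (n + 1) →ₗ[K] V n} (hd : Lowers d δ) (hsq : d ∘ₗ d = 0) :
    Nonempty (Contraction d) := by
  replace hsq : ∀ v, d (d v) = 0 := LinearMap.congr_fun hsq
  choose η hη using fun n => exists_comp_comp_eq_self hK (δ n)
  choose sec hsec using fun n => exists_section_of_surjective hK
    ((bdry d n).submoduleOf (cyc d n)).mkQ (Submodule.mkQ_surjective _)
  have hdhd : ∀ v, d (raise η (d v)) = d v := by
    have : d ∘ₗ raise η ∘ₗ d = d := tot_hom_ext fun n a => by
      simp only [LinearMap.comp_apply]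
      cases n with
      | zero => rw [hd.zero, map_zero, map_zero]
      | succ n => rw [hd.succ, raise_inc, hd.succ, hη]
    exact LinearMap.congr_fun this
  have hπ : ∀ n, ∃ π : V n →ₗ[K] Cyc d n, ∀ a,
      inc K V n (π a).1 = inc K V n a - raise η (d (inc K V n a)) := by
    intro n
    cases n with
    | zero =>
      refine ⟨LinearMap.id.codRestrict (cyc d 0) fun a => hd.zero a, fun a => ?_⟩
      rw [hd.zero, map_zero, sub_zero]
      rfl
    | succ n =>
      have h (a : V (n + 1)) : inc K V (n + 1) (a - η n (δ n a)) =
          inc K V (n + 1) a - raise η (d (inc K V (n + 1) a)) := by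
        rw [hd.succ, raise_inc, map_sub]
      refine ⟨(LinearMap.id - η n ∘ₗ δ n).codRestrict (cyc d (n + 1)) fun a => ?_, h⟩
      change d (inc K V (n + 1) (a - η n (δ n a))) = 0
      rw [h, map_sub, hdhd, sub_self]
  choose π hπ using hπ
  let mk : ∀ n, Cyc d n →ₗ[K] Hlgy d n := fun n => ((bdry d n).submoduleOf (cyc d n)).mkQ
  -- The boundary part of a chain: its cycle projection minus the chosen representative of the same
  -- class.
  let ρ : ∀ n, V n →ₗ[K] V n := fun n =>
    (cyc d n).subtype ∘ₗ (π n - sec n ∘ₗ mk n ∘ₗ π n)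
  have hcp : ∀ v, cycInc d (DirectSum.lmap π v) = v - raise η (d v) := by
    have : cycInc d ∘ₗ DirectSum.lmap π = LinearMap.id - raise η ∘ₗ d :=
      tot_hom_ext fun n a => by
        rw [LinearMap.comp_apply, lmap_inc, cycInc_inc, hπ]
        rfl
    exact LinearMap.congr_fun this
  have hp : ∀ v, DirectSum.lmap (fun n => mk n ∘ₗ π n) v = cls d (DirectSum.lmap π v) := by
    have : (DirectSum.lmap (fun n => mk n ∘ₗ π n) : Tot V →ₗ[K] Tot (Hlgy d)) =
        cls d ∘ₗ DirectSum.lmap π := by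
      refine tot_hom_ext fun n a => ?_
      rw [LinearMap.comp_apply, lmap_inc, lmap_inc, cls_inc]
      rfl
    exact LinearMap.congr_fun this
  have hρ : ∀ v, DirectSum.lmap ρ v = cycInc d (DirectSum.lmap π v) -
      cycInc d (DirectSum.lmap sec (DirectSum.lmap (fun n => mk n ∘ₗ π n) v)) := by
    have : DirectSum.lmap ρ = cycInc d ∘ₗ DirectSum.lmap π -
        cycInc d ∘ₗ DirectSum.lmap sec ∘ₗ DirectSum.lmap (fun n => mk n ∘ₗ π n) :=
      tot_hom_ext fun n a => by
        simp only [LinearMap.sub_apply, LinearMap.comp_apply, lmap_inc, cycInc_inc, ← map_sub]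
        rfl
    exact LinearMap.congr_fun this
  have hcls : ∀ x, cls d (DirectSum.lmap sec x) = x := by
    have : cls d ∘ₗ DirectSum.lmap sec = LinearMap.id := tot_hom_ext fun n a => by
      rw [LinearMap.comp_apply, lmap_inc, cls_inc]
      exact congrArg _ (hsec n a)
    exact LinearMap.congr_fun this
  have hpd : ∀ v, DirectSum.lmap (fun n => mk n ∘ₗ π n) (d v) = 0 := fun v => by
    rw [hp, hd.isGradedDiff.cls_eq_zero_iff, hcp, hsq, map_zero, sub_zero]
    exact ⟨v, rfl⟩
  have hρb : ∀ v, d (raise η (DirectSum.lmap ρ v)) = DirectSum.lmap ρ v := fun v => by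
    obtain ⟨w, hw⟩ : DirectSum.lmap ρ v ∈ LinearMap.range d := by
      rw [hρ, ← map_sub, ← hd.isGradedDiff.cls_eq_zero_iff, map_sub, hcls, hp, sub_self]
    rw [← hw, hdhd]
  -- Taking h = -ηdηρ gives d h v = -ρ v and h d v = -η d v. With ρ v = v - η d v - i p v their sum
  -- is i p v - v.
  have hh : ∀ v, raise (fun n => - (η n ∘ₗ δ n ∘ₗ η n ∘ₗ ρ n)) v =
      - raise η (d (raise η (DirectSum.lmap ρ v))) := by
    have : raise (fun n => - (η n ∘ₗ δ n ∘ₗ η n ∘ₗ ρ n)) =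
        - (raise η ∘ₗ d ∘ₗ raise η ∘ₗ DirectSum.lmap ρ) := tot_hom_ext fun n a => by
      simp only [LinearMap.neg_apply, LinearMap.comp_apply, lmap_inc, raise_inc, hd.succ, map_neg]
    exact LinearMap.congr_fun this
  refine ⟨⟨sec, fun n => mk n ∘ₗ π n, fun n => - (η n ∘ₗ δ n ∘ₗ η n ∘ₗ ρ n), hsec, ?_, hpd, ?_⟩⟩
  · intro n z
    refine congrArg (mk n) (Subtype.ext (inc_injective (K := K) n ?_))
    rw [hπ, show d (inc K V n z.1) = 0 from z.2, map_zero, sub_zero]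
  · intro v
    rw [hh, hh, map_neg, hρb, hρb, hρ, hρ, hpd, hcp, hcp, hsq, map_zero, map_zero, map_zero,
      sub_zero, sub_zero, hdhd]
    abel

namespace Contraction

variable {d : Tot V →ₗ[K] Tot V} (G : Contraction d)

/-- The section on total spaces. -/
def s : Tot (Hlgy d) →ₗ[K] Tot (Cyc d) := DirectSum.lmap G.sec

/-- The inclusion on total spaces. -/
def i : Tot (Hlgy d) →ₗ[K] Tot V := cycInc d ∘ₗ G.s

/-- The projection on total spaces. -/
def p : Tot V →ₗ[K] Tot (Hlgy d) := DirectSum.lmap G.proj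

/-- The homotopy on total spaces. -/
def h : Tot V →ₗ[K] Tot V := raise G.htpy

theorem i_inc (n : ℕ) (x : Hlgy d n) :
    G.i (inc K (Hlgy d) n x) = inc K V n (G.sec n x).1 := by
  rw [i, LinearMap.comp_apply, s, lmap_inc, cycInc_inc]

theorem p_inc (n : ℕ) (a : V n) : G.p (inc K V n a) = inc K (Hlgy d) n (G.proj n a) := by
  rw [p, lmap_inc]

theorem cls_s (x : Tot (Hlgy d)) : cls d (G.s x) = x := by
  have : cls d ∘ₗ G.s = LinearMap.id := tot_hom_ext fun n a => by
    rw [LinearMap.comp_apply, s, lmap_inc, cls_inc, G.mk_sec]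
    rfl
  exact LinearMap.congr_fun this x

theorem p_cycInc (z : Tot (Cyc d)) : G.p (cycInc d z) = cls d z := by
  have : G.p ∘ₗ cycInc d = cls d := tot_hom_ext fun n a => by
    rw [LinearMap.comp_apply, cycInc_inc, p_inc, G.proj_cyc, cls_inc]
  exact LinearMap.congr_fun this z

theorem p_i (x : Tot (Hlgy d)) : G.p (G.i x) = x := by
  rw [i, LinearMap.comp_apply, p_cycInc, cls_s]

theorem d_i (x : Tot (Hlgy d)) : d (G.i x) = 0 := d_cycInc _

theorem p_d (v : Tot V) : G.p (d v) = 0 := G.proj_d v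

theorem d_h (v : Tot V) : d (G.h v) = G.i (G.p v) - v - G.h (d v) :=
  eq_sub_of_add_eq (G.htpy_eq v)

theorem signMap_p (v : Tot V) : signMap K _ (G.p v) = G.p (signMap K _ v) := signMap_lmap _ v

theorem signMap_i (x : Tot (Hlgy d)) : signMap K _ (G.i x) = G.i (signMap K _ x) := by
  have : signMap K _ ∘ₗ G.i = G.i ∘ₗ signMap K _ := tot_hom_ext fun n a => by
    simp only [LinearMap.comp_apply, i_inc, signMap_inc, map_smul]
  exact LinearMap.congr_fun this x

/-- A map killing boundaries sees i p and the identity differ only by a term through d, which will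
vanish on tensors closed for the total differential. -/
theorem apply_i_p {W : Type*} [AddCommGroup W] [Module K W] {φ : Tot V →ₗ[K] W}
    (hφ : ∀ v, φ (d v) = 0) (v : Tot V) : φ (G.i (G.p v)) = φ v + φ (G.h (d v)) := by
  have := hφ (G.h v)
  rw [d_h, map_sub, map_sub] at this
  rw [eq_add_of_sub_eq (sub_eq_zero.1 this), add_comm]

theorem apply_i_cls {W : Type*} [AddCommGroup W] [Module K W] {φ : Tot V →ₗ[K] W}
    (hφ : ∀ v, φ (d v) = 0) (z : Tot (Cyc d)) : φ (G.i (cls d z)) = φ (cycInc d z) := by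
  rw [← G.p_cycInc, G.apply_i_p hφ, d_cycInc, map_zero, map_zero, add_zero]

/-- The homotopy `h ⊗ 1 + i p ⊗ h` of the tensor square. -/
def tensorH : (Tot V ⊗[K] Tot V) →ₗ[K] (Tot V ⊗[K] Tot V) :=
  TensorProduct.map G.h LinearMap.id + TensorProduct.map (signMap K V ∘ₗ G.i ∘ₗ G.p) G.h

/-- The usual tensor product of homotopies: contract the left factor, then the right one while the
left is already replaced by i p. The sign operator is the Koszul sign of h crossing the left factor.
-/
theorem tensorD_tensorH (t : Tot V ⊗[K] Tot V) :
    tensorD K V d (G.tensorH t) + G.tensorH (tensorD K V d t) =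
      TensorProduct.map (G.i ∘ₗ G.p) (G.i ∘ₗ G.p) t - t := by
  have hh : ∀ v, signMap K V (G.h v) = - G.h (signMap K V v) := signMap_raise _
  have : tensorD K V d ∘ₗ G.tensorH + G.tensorH ∘ₗ tensorD K V d =
      TensorProduct.map (G.i ∘ₗ G.p) (G.i ∘ₗ G.p) - LinearMap.id :=
    TensorProduct.ext' fun u v => by
      simp only [tensorD, tensorH, LinearMap.comp_apply, LinearMap.add_apply, LinearMap.sub_apply,
        TensorProduct.map_tmul, LinearMap.id_apply, map_add, signMap_signMap, d_i, p_d, hh,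
        d_h, map_zero, TensorProduct.zero_tmul, TensorProduct.sub_tmul,
        TensorProduct.tmul_sub, TensorProduct.neg_tmul, ← signMap_p, signMap_i]
      abel
  exact LinearMap.congr_fun this t

end Contraction

end Contraction

/-! ### Coproducts on homology -/

section HomologyCoalgebra

variable {K : Type*} [CommRing K] {V : ℕ → Type*} [∀ n, AddCommGroup (V n)]
  [∀ n, Module K (V n)]

theorem GrCoalg.counit_signMap (C : GrCoalg K V) (v : Tot V) :
    C.counit (signMap K V v) = C.counit v := by
  have : C.counit ∘ₗ signMap K V = C.counit := tot_hom_ext fun n a => by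
    rw [LinearMap.comp_apply, signMap_inc]
    cases n with
    | zero => simp
    | succ n => rw [map_smul, C.counit_deg, smul_zero]
  exact LinearMap.congr_fun this v

/-- Dual to `IsDGAlg.d_one`: evaluating ε ⊗ ε on Δ(dv) = (d ⊗ 1 + 1 ⊗ d) Δ(v) gives ε(dv) = ε(dv) +
ε(dv). -/
theorem IsDGCoalg.counit_d {d : Tot V →ₗ[K] Tot V} {C : GrCoalg K V} (hC : IsDGCoalg d C)
    (v : Tot V) : C.counit (d v) = 0 := by
  have h1 : TensorProduct.rid K _ (TensorProduct.map LinearMap.id C.counit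
      (C.comul (d v))) = d v := C.comul_counit _
  have h2 : (C.counit ∘ₗ (TensorProduct.rid K _).toLinearMap ∘ₗ
      TensorProduct.map LinearMap.id C.counit) ∘ₗ tensorD K V d =
      C.counit ∘ₗ d ∘ₗ (TensorProduct.rid K _).toLinearMap ∘ₗ
        TensorProduct.map LinearMap.id C.counit +
      C.counit ∘ₗ d ∘ₗ (TensorProduct.lid K _).toLinearMap ∘ₗ
        TensorProduct.map C.counit LinearMap.id := TensorProduct.ext' fun a b => by
    simp only [tensorD, LinearMap.comp_apply, LinearMap.add_apply, TensorProduct.map_tmul,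
      LinearMap.id_apply, map_add, LinearEquiv.coe_coe, TensorProduct.rid_tmul,
      TensorProduct.lid_tmul, map_smul, C.counit_signMap, smul_eq_mul, mul_comm]
  have h3 := LinearMap.congr_fun h2 (C.comul v)
  have h4 := LinearMap.congr_fun hC.coleibniz v
  simp only [LinearMap.comp_apply, LinearMap.add_apply, LinearEquiv.coe_coe] at h3 h4
  rw [← h4, h1, C.comul_counit, C.counit_comul] at h3
  exact left_eq_add.1 h3

theorem IsDGCoalg.tensorD_comul_cycInc {d : Tot V →ₗ[K] Tot V} {C : GrCoalg K V}
    (hC : IsDGCoalg d C) (z : Tot (Cyc d)) : tensorD K V d (C.comul (cycInc d z)) = 0 := by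
  have := LinearMap.congr_fun hC.coleibniz (cycInc d z)
  simp only [LinearMap.comp_apply] at this
  rw [← this, d_cycInc, map_zero]

namespace Contraction

variable {d : Tot V →ₗ[K] Tot V} (G : Contraction d)

theorem map_p_tensorD (t : Tot V ⊗[K] Tot V) :
    TensorProduct.map G.p G.p (tensorD K V d t) = 0 := by
  have : TensorProduct.map G.p G.p ∘ₗ tensorD K V d = 0 := TensorProduct.ext' fun a b => by
    simp [tensorD, p_d]
  exact LinearMap.congr_fun this t

/-- Projecting the left factor to homology kills the term d ⊗ 1, so closedness leaves only the
differential of the right factor, up to sign. -/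
theorem map_p_d_of_tensorD_eq_zero {t : Tot V ⊗[K] Tot V} (ht : tensorD K V d t = 0) :
    TensorProduct.map G.p d t = 0 := by
  have : TensorProduct.map (signMap K _) LinearMap.id ∘ₗ
      TensorProduct.map G.p LinearMap.id ∘ₗ tensorD K V d = TensorProduct.map G.p d :=
    TensorProduct.ext' fun a b => by simp [tensorD, p_d, ← signMap_p]
  rw [← this, LinearMap.comp_apply, LinearMap.comp_apply, ht, map_zero, map_zero]

theorem map_d_p_of_tensorD_eq_zero {t : Tot V ⊗[K] Tot V} (ht : tensorD K V d t = 0) :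
    TensorProduct.map d G.p t = 0 := by
  have : TensorProduct.map LinearMap.id G.p ∘ₗ tensorD K V d = TensorProduct.map d G.p :=
    TensorProduct.ext' fun a b => by simp [tensorD, p_d]
  rw [← this, LinearMap.comp_apply, ht, map_zero]

theorem map_apply_i_p_left {W : Type*} [AddCommGroup W] [Module K W] {φ : Tot V →ₗ[K] W}
    (hφ : ∀ v, φ (d v) = 0) {t : Tot V ⊗[K] Tot V} (ht : tensorD K V d t = 0) :
    TensorProduct.map (φ ∘ₗ G.i ∘ₗ G.p) G.p t = TensorProduct.map φ G.p t := by
  have : TensorProduct.map (φ ∘ₗ G.i ∘ₗ G.p) G.p = TensorProduct.map φ G.p +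
      TensorProduct.map (φ ∘ₗ G.h) LinearMap.id ∘ₗ TensorProduct.map d G.p :=
    TensorProduct.ext' fun a b => by simp [G.apply_i_p hφ, TensorProduct.add_tmul]
  rw [this, LinearMap.add_apply, LinearMap.comp_apply, G.map_d_p_of_tensorD_eq_zero ht, map_zero,
    add_zero]

theorem map_apply_i_p_right {W : Type*} [AddCommGroup W] [Module K W] {φ : Tot V →ₗ[K] W}
    (hφ : ∀ v, φ (d v) = 0) {t : Tot V ⊗[K] Tot V} (ht : tensorD K V d t = 0) :
    TensorProduct.map G.p (φ ∘ₗ G.i ∘ₗ G.p) t = TensorProduct.map G.p φ t := by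
  have : TensorProduct.map G.p (φ ∘ₗ G.i ∘ₗ G.p) = TensorProduct.map G.p φ +
      TensorProduct.map LinearMap.id (φ ∘ₗ G.h) ∘ₗ TensorProduct.map G.p d :=
    TensorProduct.ext' fun a b => by simp [G.apply_i_p hφ, TensorProduct.tmul_add]
  rw [this, LinearMap.add_apply, LinearMap.comp_apply, G.map_p_d_of_tensorD_eq_zero ht, map_zero,
    add_zero]

variable {C : GrCoalg K V}

theorem map_p_comul_d (hC : IsDGCoalg d C) (v : Tot V) : (TensorProduct.map G.p G.p ∘ₗ C.comul) (d v) = 0 := by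
  have := LinearMap.congr_fun hC.coleibniz v
  simp only [LinearMap.comp_apply] at this ⊢
  rw [this, map_p_tensorD]

theorem tensorD_comul_i (hC : IsDGCoalg d C) (x : Tot (Hlgy d)) : tensorD K V d (C.comul (G.i x)) = 0 := by
  have := LinearMap.congr_fun hC.coleibniz (G.i x)
  simp only [LinearMap.comp_apply] at this
  rw [← this, d_i, map_zero]

/-- The coalgebra structure on homology. -/
def homologyCoalg (hC : IsDGCoalg d C) : GrCoalg K (Hlgy d) where
  comul := TensorProduct.map G.p G.p ∘ₗ C.comul ∘ₗ G.i
  counit := C.counit ∘ₗ G.i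
  comul_deg n x := by
    have : tensorDeg K V n ≤
        LinearMap.ker ((tensorDeg K (Hlgy d) n).mkQ ∘ₗ TensorProduct.map G.p G.p) :=
      tensorDeg_le_ker fun p q a b hpq => by
        rw [LinearMap.comp_apply, Submodule.mkQ_apply, Submodule.Quotient.mk_eq_zero,
          TensorProduct.map_tmul, p_inc, p_inc]
        exact tmul_mem_tensorDeg p q hpq _ _
    rw [LinearMap.comp_apply, LinearMap.comp_apply, i_inc]
    exact (Submodule.Quotient.mk_eq_zero _).1 (this (C.comul_deg n _))
  counit_deg n x := by
    rw [LinearMap.comp_apply, i_inc, C.counit_deg]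
  -- The iterated coproduct contains a spurious i p between the two uses of Δ. `h1` and `h2` remove
  -- it, and what remains is the threefold p applied to coassociativity of `C`.
  coassoc := LinearMap.ext fun x => by
    have h1 := G.map_apply_i_p_left (G.map_p_comul_d hC) (G.tensorD_comul_i hC x)
    have h2 := G.map_apply_i_p_right (G.map_p_comul_d hC) (G.tensorD_comul_i hC x)
    have e1 : TensorProduct.map (TensorProduct.map G.p G.p ∘ₗ C.comul ∘ₗ G.i) LinearMap.id ∘ₗ
        TensorProduct.map G.p G.p =
        TensorProduct.map ((TensorProduct.map G.p G.p ∘ₗ C.comul) ∘ₗ G.i ∘ₗ G.p) G.p :=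
      TensorProduct.ext' fun a b => rfl
    have e2 : TensorProduct.map LinearMap.id (TensorProduct.map G.p G.p ∘ₗ C.comul ∘ₗ G.i) ∘ₗ
        TensorProduct.map G.p G.p =
        TensorProduct.map G.p ((TensorProduct.map G.p G.p ∘ₗ C.comul) ∘ₗ G.i ∘ₗ G.p) :=
      TensorProduct.ext' fun a b => rfl
    have e3 : (TensorProduct.assoc K _ _ _).toLinearMap ∘ₗ
        TensorProduct.map (TensorProduct.map G.p G.p ∘ₗ C.comul) G.p =
        TensorProduct.map G.p (TensorProduct.map G.p G.p) ∘ₗ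
          (TensorProduct.assoc K _ _ _).toLinearMap ∘ₗ
            TensorProduct.map C.comul LinearMap.id := by
      have : (TensorProduct.assoc K _ _ _).toLinearMap ∘ₗ
          TensorProduct.map (TensorProduct.map G.p G.p) G.p =
          TensorProduct.map G.p (TensorProduct.map G.p G.p) ∘ₗ
            (TensorProduct.assoc K _ _ _).toLinearMap :=
        TensorProduct.ext_threefold fun a b c => rfl
      rw [← LinearMap.comp_assoc, ← this, LinearMap.comp_assoc, ← TensorProduct.map_comp,
        LinearMap.comp_id]
    have e4 : TensorProduct.map G.p (TensorProduct.map G.p G.p ∘ₗ C.comul) =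
        TensorProduct.map G.p (TensorProduct.map G.p G.p) ∘ₗ
          TensorProduct.map LinearMap.id C.comul := by
      rw [← TensorProduct.map_comp, LinearMap.comp_id]
    have e1' := LinearMap.congr_fun e1 (C.comul (G.i x))
    have e2' := LinearMap.congr_fun e2 (C.comul (G.i x))
    have e3' := LinearMap.congr_fun e3 (C.comul (G.i x))
    have e4' := LinearMap.congr_fun e4 (C.comul (G.i x))
    have h := LinearMap.congr_fun C.coassoc (G.i x)
    simp only [LinearMap.comp_apply] at e1' e2' e3' e4' h ⊢
    rw [e1', h1, e2', h2, e3', e4', h]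
  counit_comul x := by
    have h1 := G.map_apply_i_p_left hC.counit_d (G.tensorD_comul_i hC x)
    have e1 : TensorProduct.map (C.counit ∘ₗ G.i) LinearMap.id ∘ₗ TensorProduct.map G.p G.p =
        TensorProduct.map (C.counit ∘ₗ G.i ∘ₗ G.p) G.p := TensorProduct.ext' fun a b => rfl
    have e2 : (TensorProduct.lid K _).toLinearMap ∘ₗ TensorProduct.map C.counit G.p =
        G.p ∘ₗ (TensorProduct.lid K _).toLinearMap ∘ₗ TensorProduct.map C.counit LinearMap.id :=
      TensorProduct.ext' fun a b => by simp
    have e1' := LinearMap.congr_fun e1 (C.comul (G.i x))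
    have e2' := LinearMap.congr_fun e2 (C.comul (G.i x))
    simp only [LinearMap.comp_apply, LinearEquiv.coe_coe] at e1' e2' ⊢
    rw [e1', h1, e2', C.counit_comul, p_i]
  comul_counit x := by
    have h1 := G.map_apply_i_p_right hC.counit_d (G.tensorD_comul_i hC x)
    have e1 : TensorProduct.map LinearMap.id (C.counit ∘ₗ G.i) ∘ₗ TensorProduct.map G.p G.p =
        TensorProduct.map G.p (C.counit ∘ₗ G.i ∘ₗ G.p) := TensorProduct.ext' fun a b => rfl
    have e2 : (TensorProduct.rid K _).toLinearMap ∘ₗ TensorProduct.map G.p C.counit =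
        G.p ∘ₗ (TensorProduct.rid K _).toLinearMap ∘ₗ TensorProduct.map LinearMap.id C.counit :=
      TensorProduct.ext' fun a b => by simp
    have e1' := LinearMap.congr_fun e1 (C.comul (G.i x))
    have e2' := LinearMap.congr_fun e2 (C.comul (G.i x))
    simp only [LinearMap.comp_apply, LinearEquiv.coe_coe] at e1' e2' ⊢
    rw [e1', h1, e2', C.comul_counit, p_i]

theorem homologyCoalg_comul_cls (hC : IsDGCoalg d C) (z : Tot (Cyc d)) :
    (G.homologyCoalg hC).comul (cls d z) =
      TensorProduct.map G.p G.p (C.comul (cycInc d z)) :=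
  G.apply_i_cls (G.map_p_comul_d hC) z

theorem homologyCoalg_counit_cls (hC : IsDGCoalg d C) (z : Tot (Cyc d)) :
    (G.homologyCoalg hC).counit (cls d z) = C.counit (cycInc d z) :=
  G.apply_i_cls hC.counit_d z

theorem inducesComul_homologyCoalg (hC : IsDGCoalg d C) : InducesComul d C (G.homologyCoalg hC) where
  comul z := by
    -- The tensor w consists of representatives of the projected coproduct. It differs from Δ z by a
    -- boundary of the tensor square, explicitly that of `tensorH`, because Δ z is closed.
    refine ⟨TensorProduct.map G.s G.s (TensorProduct.map G.p G.p (C.comul (cycInc d z))), ?_, ?_⟩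
    · have h := G.tensorD_tensorH (C.comul (cycInc d z))
      rw [hC.tensorD_comul_cycInc, map_zero, add_zero] at h
      have e : TensorProduct.map (cycInc d) (cycInc d) ∘ₗ TensorProduct.map G.s G.s ∘ₗ
          TensorProduct.map G.p G.p = TensorProduct.map (G.i ∘ₗ G.p) (G.i ∘ₗ G.p) :=
        TensorProduct.ext' fun a b => rfl
      have e' := LinearMap.congr_fun e (C.comul (cycInc d z))
      simp only [LinearMap.comp_apply] at e'
      rw [e', ← neg_sub, ← h]
      refine neg_mem ?_
      rw [tensorD, LinearMap.add_apply]
      refine add_mem (Submodule.mem_sup_left ⟨_, rfl⟩) (Submodule.mem_sup_right ?_)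
      refine ⟨TensorProduct.map (signMap K V) LinearMap.id
        (G.tensorH (C.comul (cycInc d z))), ?_⟩
      rw [← LinearMap.comp_apply, ← TensorProduct.map_comp]
      rfl
    · have e : TensorProduct.map (cls d) (cls d) ∘ₗ TensorProduct.map G.s G.s =
          LinearMap.id := TensorProduct.ext' fun a b => by simp [cls_s]
      rw [homologyCoalg_comul_cls]
      exact (LinearMap.congr_fun e _).symm
  counit z := G.homologyCoalg_counit_cls hC z

end Contraction

end HomologyCoalgebra

/-! ### The bialgebra structure on homology -/

section HomologyBialgebra

variable {K : Type*} [CommRing K] {V : ℕ → Type*} [∀ n, AddCommGroup (V n)]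
  [∀ n, Module K (V n)]

theorem tensorMul_of_parity (mul : (Tot V ⊗[K] Tot V) →ₗ[K] Tot V) {q r : ℕ} {a b a' b' : Tot V}
    (hb : oddPart K V b = if Odd q then b else 0)
    (ha : oddPart K V a' = if Odd r then a' else 0) :
    tensorMul K V mul ((a ⊗ₜ b) ⊗ₜ (a' ⊗ₜ b')) =
      (-1 : K) ^ (q * r) • (mul (a ⊗ₜ a') ⊗ₜ[K] mul (b ⊗ₜ b')) := by
  rw [tensorMul, LinearMap.comp_apply, koszulMiddle, LinearMap.comp_apply,
    koszulSign_tmul_of_parity (p := q) (q := r)]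
  · simp
  · rw [TensorProduct.map_tmul, hb]; split_ifs <;> simp
  · rw [TensorProduct.map_tmul, ha]; split_ifs <;> simp

theorem Lowers.oddPart_d {d : Tot V →ₗ[K] Tot V} {δ : ∀ n, V (n + 1) →ₗ[K] V n}
    (hd : Lowers d δ) (n : ℕ) (a : V n) :
    oddPart K V (d (inc K V n a)) = if Odd (n + 1) then d (inc K V n a) else 0 := by
  cases n with
  | zero => simp [hd.zero]
  | succ n => rw [hd.succ, oddPart_inc]; simp [Nat.odd_add]

theorem GrAlg.signMap_mul (A : GrAlg K V) (a b : Tot V) :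
    signMap K V (A.mul (a ⊗ₜ b)) = A.mul (signMap K V a ⊗ₜ signMap K V b) := by
  have : signMap K V ∘ₗ A.mul = A.mul ∘ₗ TensorProduct.map (signMap K V) (signMap K V) :=
    tot_tensor_ext fun p q a b => by
      obtain ⟨x, hx⟩ := A.mul_deg p q a b
      simp only [LinearMap.comp_apply, TensorProduct.map_tmul, signMap_inc, ← hx,
        ← TensorProduct.smul_tmul', TensorProduct.tmul_smul, map_smul, smul_smul, pow_add,
        mul_comm]
  exact LinearMap.congr_fun this (a ⊗ₜ b)

/-- The tensor square of a d.g. algebra is a d.g. algebra. The differentials d b and d a' have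
shifted parity, which is why the product formula is needed for elements known only through their
parity. -/
theorem Lowers.tensorD_tensorMul {d : Tot V →ₗ[K] Tot V} {δ : ∀ n, V (n + 1) →ₗ[K] V n}
    (hd : Lowers d δ) {A : GrAlg K V} (hA : IsDGAlg d A) (s t : Tot V ⊗[K] Tot V) :
    tensorD K V d (tensorMul K V A.mul (s ⊗ₜ t)) =
      tensorMul K V A.mul (tensorD K V d s ⊗ₜ t) +
        tensorMul K V A.mul
          (TensorProduct.map (signMap K V) (signMap K V) s ⊗ₜ tensorD K V d t) := by
  have : tensorD K V d ∘ₗ tensorMul K V A.mul =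
      tensorMul K V A.mul ∘ₗ TensorProduct.map (tensorD K V d) LinearMap.id +
        tensorMul K V A.mul ∘ₗ TensorProduct.map
          (TensorProduct.map (signMap K V) (signMap K V)) (tensorD K V d) :=
    tot_tensor_ext_four fun p q r s a b a' b' => by
      have t1 := tensorMul_of_parity A.mul (a := d (inc K V p a)) (b' := inc K V s b')
        (oddPart_inc q b) (oddPart_inc r a')
      have t2 := tensorMul_of_parity A.mul (a := inc K V p a) (b' := inc K V s b')
        (hd.oddPart_d q b) (oddPart_inc r a')
      have t3 := tensorMul_of_parity A.mul (a := inc K V p a) (b' := inc K V s b')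
        (oddPart_inc q b) (hd.oddPart_d r a')
      have t4 := tensorMul_of_parity A.mul (a := inc K V p a) (b' := d (inc K V s b'))
        (oddPart_inc q b) (oddPart_inc r a')
      have hq : (-1 : K) ^ q * (-1) ^ q = 1 := by rw [← mul_pow]; simp
      simp only [LinearMap.comp_apply, LinearMap.add_apply, TensorProduct.map_tmul,
        LinearMap.id_apply, tensorMul_inc, tensorD, map_smul, hA.leibniz_tmul, A.signMap_mul,
        signMap_inc, ← TensorProduct.smul_tmul', TensorProduct.tmul_smul,
        TensorProduct.add_tmul, TensorProduct.tmul_add, smul_add, map_add, t1, t2, t3, t4, smul_smul]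
      match_scalars
      all_goals first | ring1 | linear_combination (-(-1) ^ (q * r) * (-1) ^ p : K) * hq
  exact LinearMap.congr_fun this (s ⊗ₜ t)

theorem Lowers.tensorMul_boundary_left {d : Tot V →ₗ[K] Tot V}
    {δ : ∀ n, V (n + 1) →ₗ[K] V n} (hd : Lowers d δ) {A : GrAlg K V} (hA : IsDGAlg d A)
    (s : Tot V ⊗[K] Tot V) {t : Tot V ⊗[K] Tot V} (ht : tensorD K V d t = 0) :
    tensorMul K V A.mul (tensorD K V d s ⊗ₜ t) =
      tensorD K V d (tensorMul K V A.mul (s ⊗ₜ t)) := by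
  rw [hd.tensorD_tensorMul hA, ht, TensorProduct.tmul_zero, map_zero, add_zero]

theorem Lowers.tensorMul_boundary_right {d : Tot V →ₗ[K] Tot V}
    {δ : ∀ n, V (n + 1) →ₗ[K] V n} (hd : Lowers d δ) {A : GrAlg K V} (hA : IsDGAlg d A)
    {s : Tot V ⊗[K] Tot V} (t : Tot V ⊗[K] Tot V) (hs : tensorD K V d s = 0) :
    tensorMul K V A.mul (s ⊗ₜ tensorD K V d t) =
      tensorD K V d (tensorMul K V A.mul
        (TensorProduct.map (signMap K V) (signMap K V) s ⊗ₜ t)) := by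
  have h1 : TensorProduct.map (signMap K V) (signMap K V) ∘ₗ
      TensorProduct.map (signMap K V) (signMap K V) = LinearMap.id :=
    TensorProduct.ext' fun a b => by simp
  have h2 : tensorD K V d ∘ₗ TensorProduct.map (signMap K V) (signMap K V) =
      - (TensorProduct.map (signMap K V) (signMap K V) ∘ₗ tensorD K V d) :=
    TensorProduct.ext' fun a b => by
      simp [tensorD, hd.signMap_comp, TensorProduct.neg_tmul, TensorProduct.tmul_neg, add_comm]
  have h1' := LinearMap.congr_fun h1 s
  have h2' := LinearMap.congr_fun h2 s
  simp only [LinearMap.comp_apply, LinearMap.neg_apply] at h1' h2'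
  rw [hd.tensorD_tensorMul hA, h2', hs, h1', map_zero, neg_zero, TensorProduct.zero_tmul, map_zero,
    zero_add]
  rfl

namespace Contraction

variable {d : Tot V →ₗ[K] Tot V} (G : Contraction d)

theorem p_mul {A : GrAlg K V} {H : GrAlg K (Hlgy d)} (hH : InducesMul d A H)
    (a b : Tot (Cyc d)) :
    G.p (A.mul (cycInc d a ⊗ₜ cycInc d b)) = H.mul (cls d a ⊗ₜ cls d b) := by
  obtain ⟨c, hc, hc'⟩ := hH.mul a b
  rw [← hc, ← hc', p_cycInc]

theorem p_mul_i {A : GrAlg K V} {H : GrAlg K (Hlgy d)} (hH : InducesMul d A H)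
    (x y : Tot (Hlgy d)) : G.p (A.mul (G.i x ⊗ₜ G.i y)) = H.mul (x ⊗ₜ y) := by
  have := G.p_mul hH (G.s x) (G.s y)
  rwa [cls_s, cls_s] at this

theorem map_p_tensorMul_i {A : GrAlg K V} {H : GrAlg K (Hlgy d)} (hH : InducesMul d A H)
    (x y : Tot (Hlgy d) ⊗[K] Tot (Hlgy d)) :
    TensorProduct.map G.p G.p (tensorMul K V A.mul
      (TensorProduct.map G.i G.i x ⊗ₜ TensorProduct.map G.i G.i y)) =
      tensorMul K (Hlgy d) H.mul (x ⊗ₜ y) := by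
  have : TensorProduct.map G.p G.p ∘ₗ tensorMul K V A.mul ∘ₗ
      TensorProduct.map (TensorProduct.map G.i G.i) (TensorProduct.map G.i G.i) =
      tensorMul K (Hlgy d) H.mul := tot_tensor_ext_four fun p q r s a b a' b' => by
    simp only [LinearMap.comp_apply, TensorProduct.map_tmul, i_inc, tensorMul_inc, map_smul]
    simp only [← i_inc, p_mul_i G hH]
  exact LinearMap.congr_fun this (x ⊗ₜ y)

/-- Closed tensors may be replaced by their images under i p at the cost of boundaries. A boundary
times a closed tensor is a boundary, and p ⊗ p kills it. -/
theorem map_p_tensorMul {δ : ∀ n, V (n + 1) →ₗ[K] V n} (hd : Lowers d δ) {A : GrAlg K V}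
    (hA : IsDGAlg d A) {H : GrAlg K (Hlgy d)} (hH : InducesMul d A H)
    {s t : Tot V ⊗[K] Tot V} (hs : tensorD K V d s = 0) (ht : tensorD K V d t = 0) :
    TensorProduct.map G.p G.p (tensorMul K V A.mul (s ⊗ₜ t)) =
      tensorMul K (Hlgy d) H.mul
        (TensorProduct.map G.p G.p s ⊗ₜ TensorProduct.map G.p G.p t) := by
  have hi : TensorProduct.map (G.i ∘ₗ G.p) (G.i ∘ₗ G.p) =
      TensorProduct.map G.i G.i ∘ₗ TensorProduct.map G.p G.p := TensorProduct.map_comp _ _ _ _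
  have hs' := G.tensorD_tensorH s
  have ht' := G.tensorD_tensorH t
  rw [hs, map_zero, add_zero, hi, LinearMap.comp_apply] at hs'
  rw [ht, map_zero, add_zero, hi, LinearMap.comp_apply] at ht'
  have hDi : tensorD K V d (TensorProduct.map G.i G.i (TensorProduct.map G.p G.p s)) = 0 := by
    have : tensorD K V d ∘ₗ TensorProduct.map G.i G.i = 0 := TensorProduct.ext' fun a b => by
      simp [tensorD, d_i]
    exact LinearMap.congr_fun this _
  rw [← G.map_p_tensorMul_i hH, ← sub_eq_zero, ← map_sub]
  have e : tensorMul K V A.mul (s ⊗ₜ t) - tensorMul K V A.mul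
      (TensorProduct.map G.i G.i (TensorProduct.map G.p G.p s) ⊗ₜ
        TensorProduct.map G.i G.i (TensorProduct.map G.p G.p t)) =
      - tensorMul K V A.mul (tensorD K V d (G.tensorH s) ⊗ₜ t) -
        tensorMul K V A.mul (TensorProduct.map G.i G.i (TensorProduct.map G.p G.p s) ⊗ₜ
          tensorD K V d (G.tensorH t)) := by
    rw [hs', ht', TensorProduct.sub_tmul, TensorProduct.tmul_sub, map_sub, map_sub]
    abel
  rw [e, hd.tensorMul_boundary_left hA _ ht, hd.tensorMul_boundary_right hA _ hDi,
    map_sub, map_neg, map_p_tensorD, map_p_tensorD, neg_zero, sub_zero]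

theorem exists_homologyBialg (G : Contraction d) {δ : ∀ n, V (n + 1) →ₗ[K] V n} (hd : Lowers d δ) {B : GrBialg K V}
    (hB : IsDGBialg d B) : ∃ H : GrBialg K (Hlgy d),
      InducesMul d B.toGrAlg H.toGrAlg ∧ InducesComul d B.toGrCoalg H.toGrCoalg := by
  obtain ⟨A, hA⟩ := hd.isGradedDiff.exists_inducesMul hB.alg
  let C := G.homologyCoalg hB.coalg
  obtain ⟨e, he, he'⟩ := hA.one
  refine ⟨{ toGrAlg := A, comul := C.comul, counit := C.counit, comul_deg := C.comul_deg,
            counit_deg := C.counit_deg, coassoc := C.coassoc, counit_comul := C.counit_comul,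
            comul_counit := C.comul_counit, comul_mul := ?_, comul_one := ?_, counit_mul := ?_,
            counit_one := ?_ }, hA, G.inducesComul_homologyCoalg hB.coalg⟩
  · intro x y
    obtain ⟨a, rfl⟩ := cls_surjective x
    obtain ⟨b, rfl⟩ := cls_surjective y
    obtain ⟨c, hc, hc'⟩ := hA.mul a b
    rw [← hc', G.homologyCoalg_comul_cls, G.homologyCoalg_comul_cls, G.homologyCoalg_comul_cls, hc,
      B.comul_mul]
    exact G.map_p_tensorMul hd hB.alg hA (hB.coalg.tensorD_comul_cycInc a)
      (hB.coalg.tensorD_comul_cycInc b)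
  · rw [← he', G.homologyCoalg_comul_cls, he, B.comul_one, TensorProduct.map_tmul, ← he, p_cycInc]
  · intro x y
    obtain ⟨a, rfl⟩ := cls_surjective x
    obtain ⟨b, rfl⟩ := cls_surjective y
    obtain ⟨c, hc, hc'⟩ := hA.mul a b
    rw [← hc', G.homologyCoalg_counit_cls, G.homologyCoalg_counit_cls, G.homologyCoalg_counit_cls,
      hc, B.counit_mul]
  · rw [← he', G.homologyCoalg_counit_cls, he, B.counit_one]

end Contraction

end HomologyBialgebra

/-! ### Finiteness of the homology of a finite shelf -/

/-! ### Combinatorics of words in the structure monoid of a finite shelf. -/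

section Monoid

theorem exists_le_count {X : Type*} [Finite X] [DecidableEq X] {N : ℕ} {w : List X}
    (hw : N * Nat.card X < w.length) : ∃ x ∈ w, N ≤ w.count x := by
  have := Fintype.ofFinite X
  by_contra! h
  have h1 : ∑ x : X, w.count x = w.length := by
    simpa using Multiset.sum_count_eq_card (s := Finset.univ) (m := (w : Multiset X)) fun _ _ =>
      Finset.mem_univ _
  have h2 : ∑ x : X, w.count x ≤ ∑ _x : X, N := Finset.sum_le_sum fun x _ => by
    by_cases hx : x ∈ w
    · exact (h x hx).le
    · rw [List.count_eq_zero_of_not_mem hx]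
      exact Nat.zero_le _
  rw [h1, Finset.sum_const, Finset.card_univ, smul_eq_mul, ← Nat.card_eq_fintype_card,
    mul_comm] at h2
  omega

variable {X : Type u} [Shelf X]

theorem ract_shelfPow (x y : X) (b : StructMonoid X) :
    ract (shelfPow x y) b = shelfPow (ract x b) (ract y b) := by
  rw [← ract_gen, ← ract_mul, gen_mul, ract_mul, ract_gen]

/-- The endomorphism `x ↦ x^b` of the structure monoid. -/
def powHom (b : StructMonoid X) : StructMonoid X →* StructMonoid X :=
  PresentedMonoid.lift (rels := StructRel X) (fun x => gen (ract x b)) (by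
    rintro _ _ ⟨x, y⟩
    simp only [map_mul, FreeMonoid.lift_eval_of]
    rw [ract_shelfPow, gen_mul_gen_shelfPow])

theorem powHom_gen (b : StructMonoid X) (x : X) : powHom b (gen x) = gen (ract x b) := rfl

/-- The crossing rule `gen_mul` for an arbitrary left factor: elements of M commute up to the
twisting endomorphism. -/
theorem mul_eq_mul_powHom (a b : StructMonoid X) : a * b = b * powHom b a := by
  induction a using StructMonoid.induction_right with
  | one => simp
  | mul_gen a x ih => rw [mul_assoc, gen_mul, ← mul_assoc, ih, map_mul, powHom_gen, mul_assoc]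

/-- A smallest image of the action on X is a subshelf Y on which further elements of Y can only act
by permutations; a common exponent of these permutations serves as N. -/
theorem exists_periodic_subset [Finite X] : ∃ (Y : Set X) (b : StructMonoid X) (N : ℕ), 0 < N ∧
    (∀ x, ract x b ∈ Y) ∧ (∀ x ∈ Y, ∀ y ∈ Y, shelfPow x y ∈ Y) ∧
    ∀ x ∈ Y, ∀ y ∈ Y, ract x (gen y ^ N) = x := by
  obtain ⟨b, hb⟩ : ∃ b : StructMonoid X, ∀ b' : StructMonoid X,
      (Set.range fun x => ract x b).ncard ≤ (Set.range fun x => ract x b').ncard :=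
    ⟨_, fun b' => Function.argmin_le (fun b => (Set.range fun x => ract x b).ncard) b'⟩
  let Y : Set X := Set.range fun x => ract x b
  have hY : ∀ x ∈ Y, ∀ y ∈ Y, shelfPow x y ∈ Y := by
    rintro _ ⟨x, rfl⟩ _ ⟨y, rfl⟩
    exact ⟨shelfPow x y, ract_shelfPow x y b⟩
  have hinj : ∀ y ∈ Y, Set.InjOn (fun x => shelfPow x y) Y := by
    rintro _ ⟨y, rfl⟩
    rw [← Set.ncard_image_iff]
    -- The image of Y under y^b is the image of X under the action of y b, so minimality of b bounds
    -- its size from below.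
    refine le_antisymm (Set.ncard_image_le Y.toFinite) ((hb (gen y * b)).trans_eq ?_)
    congr 1
    rw [← Set.range_comp]
    congr 1
    funext x
    simp only [Function.comp_apply, ract_mul, ract_gen, ract_shelfPow]
  refine ⟨Y, b, Nat.card (Equiv.Perm Y), Nat.card_pos, fun x => ⟨x, rfl⟩, hY, fun x hx y hy => ?_⟩
  let f : Y → Y := fun z => ⟨shelfPow z.1 y, hY _ z.2 _ hy⟩
  have hf : Function.Injective f := fun z w h =>
    Subtype.ext (hinj y hy z.2 w.2 (congrArg Subtype.val h))
  let σ : Equiv.Perm Y := Equiv.ofBijective f (Finite.injective_iff_bijective.1 hf)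
  have h1 : ∀ n, (((σ ^ n) ⟨x, hx⟩ : Y) : X) = ract x (gen y ^ n) := fun n => by
    induction n with
    | zero => simp
    | succ n ih =>
      rw [pow_succ', Equiv.Perm.mul_apply, pow_succ, ract_mul, ← ih]
      rfl
  rw [← h1, pow_card_eq_one']
  rfl

/-- Each occurrence of y is pulled to the front, twisting the letters it crosses; these stay in Y
because Y is a subshelf. The remaining word may contain y again, but only its length matters. -/
theorem exists_prod_eq_pow_mul {Y : Set X} (hY : ∀ x ∈ Y, ∀ y ∈ Y, shelfPow x y ∈ Y)
    [DecidableEq X] {y : X} (hy : y ∈ Y) (w : List X) (hw : ∀ x ∈ w, x ∈ Y) :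
    ∃ w' : List X, (∀ x ∈ w', x ∈ Y) ∧ w'.length + w.count y = w.length ∧
      (w.map gen).prod = gen y ^ w.count y * (w'.map gen).prod := by
  induction w using List.reverseRecOn with
  | nil => exact ⟨[], by simp⟩
  | append_singleton w x ih =>
    obtain ⟨w', h1, h2, h3⟩ := ih fun z hz => hw z (by simp [hz])
    by_cases hx : x = y
    · subst hx
      refine ⟨w'.map fun z => shelfPow z x, ?_, ?_, ?_⟩
      · intro z hz
        obtain ⟨t, ht, rfl⟩ := List.mem_map.1 hz
        exact hY t (h1 t ht) x hy
      · simp; omega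
      · have h4 : powHom (gen x) (w'.map gen).prod =
            ((w'.map fun z => shelfPow z x).map gen).prod := by
          rw [map_list_prod, List.map_map, List.map_map]
          rfl
        rw [List.map_append, List.prod_append, h3, List.map_singleton, List.prod_singleton,
          mul_assoc, mul_eq_mul_powHom (w'.map gen).prod (gen x), h4, ← mul_assoc]
        simp [pow_succ]
    · refine ⟨w' ++ [x], ?_, ?_, ?_⟩
      · intro z hz
        rcases List.mem_append.1 hz with hz | hz
        · exact h1 z hz
        · exact hw z (by simp_all)
      · simp [hx]; omega
      · simp [h3, hx, mul_assoc]

end Monoid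

/-! ### A finiteness criterion: commuting operators acting on homology by scalars. -/

section NoetherianOperators

variable {K : Type*} [CommRing K] {V : ℕ → Type*} [∀ n, AddCommGroup (V n)]
  [∀ n, Module K (V n)] {d : Tot V →ₗ[K] Tot V} {n : ℕ} {R : Subalgebra K (Module.End K (V n))}

theorem isNoetherianRing_adjoin_of_comm [IsNoetherianRing K] {A : Type*} [Ring A] [Algebra K A]
    {s : Set A} (hs : s.Finite) (hcomm : ∀ a ∈ s, ∀ b ∈ s, a * b = b * a) :
    IsNoetherianRing (Algebra.adjoin K s) := by
  have := Algebra.isMulCommutative_adjoin K hcomm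
  have : Algebra.FiniteType K (Algebra.adjoin K s) :=
    ⟨(Subalgebra.fg_top _).2 ⟨hs.toFinset, by simp⟩⟩
  let _ : CommRing (Algebra.adjoin K s) := { mul_comm := mul_comm' }
  exact Algebra.FiniteType.isNoetherianRing K (Algebra.adjoin K s)

/-- The cycles form an R-submodule of a finitely generated module over a Noetherian ring. -/
theorem exists_fg_span_eq_cycles [IsNoetherianRing R]
    (hR : ∀ q ∈ R, ∀ z, d (inc K V n z) = 0 → d (inc K V n (q z)) = 0) {gens : Set (V n)}
    (hgens : gens.Finite) : ∃ t : Finset (V n), ∀ z, z ∈ Submodule.span R (t : Set (V n)) ↔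
      z ∈ Submodule.span R gens ∧ d (inc K V n z) = 0 := by
  have hWn : IsNoetherian R (Submodule.span R gens) := isNoetherian_span_of_finite R hgens
  let Z : Submodule R (V n) :=
    { carrier := {z | z ∈ Submodule.span R gens ∧ d (inc K V n z) = 0}
      zero_mem' := ⟨zero_mem _, by rw [map_zero, map_zero]⟩
      add_mem' := fun {a c} ha hc =>
        ⟨add_mem ha.1 hc.1, by rw [map_add, map_add, ha.2, hc.2, add_zero]⟩
      smul_mem' := fun r z hz => ⟨Submodule.smul_mem _ r hz.1, hR _ r.2 z hz.2⟩ }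
  obtain ⟨t, ht⟩ := isNoetherian_submodule.1 hWn Z fun z hz => hz.1
  exact ⟨t, fun z => by rw [ht]; rfl⟩

/-- Modulo boundaries every element of R acts on cycles as a scalar, so R-combinations of cycles may
be replaced by K-combinations. -/
theorem exists_mem_span_sub_mem_range
    (hR : ∀ q ∈ R, ∃ c : K, ∀ z, d (inc K V n z) = 0 → d (inc K V n (q z)) = 0 ∧
      inc K V n (q z) - c • inc K V n z ∈ LinearMap.range d) {t : Set (V n)}
    (ht : ∀ z ∈ Submodule.span R t, d (inc K V n z) = 0) {z : V n}
    (hz : z ∈ Submodule.span R t) :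
    ∃ k ∈ Submodule.span K t, inc K V n z - inc K V n k ∈ LinearMap.range d := by
  induction hz using Submodule.span_induction with
  | mem z hz => exact ⟨z, Submodule.subset_span hz, by rw [sub_self]; exact zero_mem _⟩
  | zero => exact ⟨0, zero_mem _, by rw [sub_self]; exact zero_mem _⟩
  | add x y _ _ hx hy =>
    obtain ⟨k, hk, hk'⟩ := hx
    obtain ⟨l, hl, hl'⟩ := hy
    refine ⟨k + l, add_mem hk hl, ?_⟩
    rw [map_add, map_add, add_sub_add_comm]
    exact add_mem hk' hl'
  | smul r z hz ih =>
    obtain ⟨k, hk, hk'⟩ := ih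
    obtain ⟨c, hc⟩ := hR _ r.2
    refine ⟨c • k, Submodule.smul_mem _ c hk, ?_⟩
    have h := add_mem (hc z (ht z hz)).2 (Submodule.smul_mem _ c hk')
    rw [smul_sub, sub_add_sub_cancel, ← map_smul _ c k] at h
    exact h

theorem finite_homology_of_noetherian [IsNoetherianRing R]
    (hR : ∀ q ∈ R, ∃ c : K, ∀ z, d (inc K V n z) = 0 → d (inc K V n (q z)) = 0 ∧
      inc K V n (q z) - c • inc K V n z ∈ LinearMap.range d) {gens : Set (V n)}
    (hgens : gens.Finite)
    (hz : ∀ z, d (inc K V n z) = 0 → ∃ z' ∈ Submodule.span R gens, d (inc K V n z') = 0 ∧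
      inc K V n z' - inc K V n z ∈ LinearMap.range d) : Module.Finite K (Hlgy d n) := by
  obtain ⟨t, ht⟩ := exists_fg_span_eq_cycles
    (fun q hq z hz => (hR q hq).elim fun c hc => (hc z hz).1) hgens
  have hT : Submodule.span K (t : Set (V n)) ≤ cyc d n := Submodule.span_le.2 fun z hz =>
    ((ht z).1 (Submodule.subset_span hz)).2
  have hTf : Module.Finite K (Submodule.span K (t : Set (V n))) :=
    Module.Finite.span_of_finite K t.finite_toSet
  refine Module.Finite.of_surjective
    (((bdry d n).submoduleOf (cyc d n)).mkQ ∘ₗ Submodule.inclusion hT) fun x => ?_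
  obtain ⟨⟨z, hzc⟩, rfl⟩ := Submodule.Quotient.mk_surjective _ x
  obtain ⟨z', h1, h2, h3⟩ := hz z hzc
  obtain ⟨k, hk, hk'⟩ := exists_mem_span_sub_mem_range hR (fun z hz => ((ht z).1 hz).2)
    ((ht z').2 ⟨h1, h2⟩)
  refine ⟨⟨k, hk⟩, (Submodule.Quotient.eq _).2 ?_⟩
  change inc K V n (k - z) ∈ LinearMap.range d
  have h := sub_mem h3 hk'
  rwa [sub_sub_sub_cancel_left, ← map_sub] at h

/-- The generators act as the identity on homology, so a polynomial in them acts by its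
augmentation. -/
theorem exists_smul_sub_mem_range {s : Set (Module.End K (V n))}
    (hs : ∀ q ∈ s, ∀ z, d (inc K V n z) = 0 → d (inc K V n (q z)) = 0 ∧
      inc K V n (q z) - inc K V n z ∈ LinearMap.range d)
    {q : Module.End K (V n)} (hq : q ∈ Algebra.adjoin K s) :
    ∃ c : K, ∀ z, d (inc K V n z) = 0 → d (inc K V n (q z)) = 0 ∧
      inc K V n (q z) - c • inc K V n z ∈ LinearMap.range d := by
  induction hq using Algebra.adjoin_induction with
  | mem q hq => exact ⟨1, fun z hz => by rw [one_smul]; exact hs q hq z hz⟩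
  | algebraMap r =>
    refine ⟨r, fun z hz => ?_⟩
    rw [Module.algebraMap_end_apply, map_smul, map_smul, hz, smul_zero, sub_self]
    exact ⟨rfl, zero_mem _⟩
  | add p q _ _ hp hq =>
    obtain ⟨c, hc⟩ := hp
    obtain ⟨e, he⟩ := hq
    refine ⟨c + e, fun z hz => ?_⟩
    rw [LinearMap.add_apply, map_add, map_add, (hc z hz).1, (he z hz).1, add_zero, add_smul,
      add_sub_add_comm]
    exact ⟨rfl, add_mem (hc z hz).2 (he z hz).2⟩
  | mul p q _ _ hp hq =>
    obtain ⟨c, hc⟩ := hp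
    obtain ⟨e, he⟩ := hq
    refine ⟨c * e, fun z hz => ⟨(hc _ (he z hz).1).1, ?_⟩⟩
    have := add_mem (hc _ (he z hz).1).2 (Submodule.smul_mem _ c (he z hz).2)
    rwa [smul_sub, smul_smul, sub_add_sub_cancel] at this

theorem finite_homology_of_commuting [IsNoetherianRing K] {s : Set (Module.End K (V n))}
    (hsf : s.Finite) (hcomm : ∀ p ∈ s, ∀ q ∈ s, p * q = q * p)
    (hs : ∀ q ∈ s, ∀ z, d (inc K V n z) = 0 → d (inc K V n (q z)) = 0 ∧
      inc K V n (q z) - inc K V n z ∈ LinearMap.range d) {gens : Set (V n)}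
    (hgens : gens.Finite)
    (hz : ∀ z, d (inc K V n z) = 0 → ∃ z', d (inc K V n z') = 0 ∧
      inc K V n z' - inc K V n z ∈ LinearMap.range d ∧
      ∀ W : Submodule K (V n), gens ⊆ W → (∀ q ∈ s, ∀ w ∈ W, q w ∈ W) → z' ∈ W) :
    Module.Finite K (Hlgy d n) := by
  have hR : IsNoetherianRing (Algebra.adjoin K s) := isNoetherianRing_adjoin_of_comm hsf hcomm
  refine finite_homology_of_noetherian (fun q hq => exists_smul_sub_mem_range hs hq) hgens
    fun z hzc => ?_
  obtain ⟨z', h1, h2, h3⟩ := hz z hzc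
  exact ⟨z', h3 ((Submodule.span (Algebra.adjoin K s) gens).restrictScalars K)
    Submodule.subset_span fun q hq w hw => Submodule.smul_mem _
      (⟨q, Algebra.subset_adjoin hq⟩ : Algebra.adjoin K s) hw, h1, h2⟩

end NoetherianOperators

/-! ### Trivial action of M on homology, and reduction to a periodic subshelf. -/

section Finiteness

variable {K : Type v} [CommRing K] {X : Type u} [Shelf X]

/-- Left multiplication by `b ∈ M` on homogeneous elements. -/
def lmulHom (K : Type v) [CommRing K] {X : Type u} [Shelf X] (n : ℕ) (b : StructMonoid X) :
    Module.End K (Chain K X (StructMonoid X) n) :=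
  Finsupp.lmapDomain K K (fun c => (b * c.1, c.2))

theorem lmulHom_mul (n : ℕ) (a b : StructMonoid X) :
    lmulHom K n a * lmulHom K n b = lmulHom K n (a * b) :=
  Finsupp.lhom_ext fun c r => by
    simp [lmulHom, Finsupp.mapDomain_single, mul_assoc]

theorem lmulHom_single (n : ℕ) (b a : StructMonoid X) (x : Fin n → X) (r : K) :
    lmulHom K n b (Finsupp.single (a, x) r) = Finsupp.single (b * a, x) r :=
  Finsupp.mapDomain_single

theorem rackMul_cell_nil_inc (b : StructMonoid X) (n : ℕ)
    (z : Chain K X (StructMonoid X) n) :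
    rackMul K X (cell K b ![] ⊗ₜ inc K _ n z) = inc K _ n (lmulHom K n b z) := by
  have : rackMul K X ∘ₗ TensorProduct.mk K _ _ (cell K b ![]) ∘ₗ inc K _ n =
      inc K _ n ∘ₗ lmulHom K n b := Finsupp.lhom_ext' fun c => LinearMap.ext_ring <| by
    refine (rackMul_cell_nil_left b c.1 c.2).trans ?_
    exact congrArg (inc K _ n) (lmulHom_single n b c.1 c.2 (1 : K)).symm
  exact LinearMap.congr_fun this z

/-- The endomorphism `a x_1 ⋯ x_n ↦ a^b x_1^b ⋯ x_n^b` on homogeneous elements. -/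
def powChain (K : Type v) [CommRing K] {X : Type u} [Shelf X] (b : StructMonoid X) (n : ℕ) :
    Module.End K (Chain K X (StructMonoid X) n) :=
  Finsupp.lmapDomain K K (fun c => (powHom b c.1, fun i => ract (c.2 i) b))

/-- The chain version of a b = b a^b. It links the twist to left and right multiplication, both of
which turn out to be homotopically trivial. -/
theorem lmulHom_powChain (b : StructMonoid X) (n : ℕ) (z : Chain K X (StructMonoid X) n) :
    lmulHom K n b (powChain K b n z) = rmulHom K b n z := by
  have : lmulHom K n b ∘ₗ powChain K b n = rmulHom K b n := Finsupp.lhom_ext fun c r => by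
    simp [lmulHom, powChain, rmulHom, Finsupp.mapDomain_single, ← mul_eq_mul_powHom]
  exact LinearMap.congr_fun this z

theorem face_ract (b : StructMonoid X) {n : ℕ} (i : Fin (n + 1)) (x : Fin (n + 1) → X) :
    face i (fun j => ract (x j) b) = fun j => ract (face i x j) b := by
  funext j
  simp only [face]
  split_ifs
  · exact (ract_shelfPow _ _ b).symm
  · rfl

/-- Acting by b is an endomorphism of the shelf and of M, so it commutes with both kinds of faces.
-/
theorem dM_powChain (b : StructMonoid X) {n : ℕ} {z : Chain K X (StructMonoid X) n}
    (hz : dM K X (inc K _ n z) = 0) : dM K X (inc K _ n (powChain K b n z)) = 0 := by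
  have hp : ∀ (a : StructMonoid X) (n : ℕ) (x : Fin n → X),
      DirectSum.lmap (powChain K b) (cell K a x) =
        cell K (powHom b a) fun i => ract (x i) b := fun a n x => by
    rw [cell, lmap_inc, powChain, Finsupp.lmapDomain_apply, Finsupp.mapDomain_single]
    rfl
  have : dM K X ∘ₗ DirectSum.lmap (powChain K b) = DirectSum.lmap (powChain K b) ∘ₗ dM K X :=
    chain_hom_ext fun a n x => by
      rw [LinearMap.comp_apply, LinearMap.comp_apply, hp]
      cases n with
      | zero =>
        rw [Subsingleton.elim x ![], rackD_cell_nil, map_zero]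
        exact (lowers_rackD _).zero _
      | succ n =>
        rw [rackD_cell, rackD_cell, map_sum]
        refine Finset.sum_congr rfl fun i _ => ?_
        rw [map_smul, map_sub, hp, hp, face_ract]
        have : ShelfSet.act (powHom b a) (ract (x i) b) = powHom b (ShelfSet.act a (x i)) :=
          ((powHom b).map_mul a (gen (x i))).symm
        rw [this]
        rfl
  have h := LinearMap.congr_fun this (inc K _ n z)
  rwa [LinearMap.comp_apply, LinearMap.comp_apply, hz, map_zero, lmap_inc] at h

theorem dM_lmulHom (b : StructMonoid X) {n : ℕ} {z : Chain K X (StructMonoid X) n}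
    (hz : dM K X (inc K _ n z) = 0) : dM K X (inc K _ n (lmulHom K n b z)) = 0 := by
  rw [← rackMul_cell_nil_inc, dM_rackMul, rackD_cell_nil, hz]
  simp

/-- For a cycle z the Leibniz rule gives ∂(e_y z) = z - y z; an induction on b does the rest. -/
theorem lmulHom_sub_mem_range (b : StructMonoid X) {n : ℕ} {z : Chain K X (StructMonoid X) n}
    (hz : dM K X (inc K _ n z) = 0) :
    inc K _ n (lmulHom K n b z) - inc K _ n z ∈ LinearMap.range (dM K X) := by
  induction b using StructMonoid.induction_right generalizing z with
  | one =>
    rw [← rackMul_cell_nil_inc, rackMul_one_left, sub_self]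
    exact zero_mem _
  | mul_gen b y ih =>
    have h := ih (dM_lmulHom (gen y) hz)
    rw [← Module.End.mul_apply, lmulHom_mul] at h
    rw [← sub_add_sub_cancel]
    refine add_mem h ⟨- rackMul K X (snocOp K y (cell K 1 ![]) ⊗ₜ inc K _ n z), ?_⟩
    rw [map_neg, dM_rackMul, dM_snocOp, rackD_cell_nil, hz, TensorProduct.tmul_zero, map_zero,
      map_zero, rmulOp_cell_nil, map_sub, signMap_cell, signMap_cell, pow_zero, one_smul, one_smul,
      one_mul, zero_add, add_zero, TensorProduct.sub_tmul, map_sub, rackMul_one_left,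
      rackMul_cell_nil_inc, neg_sub]

theorem rmulOp_sub_mem_range (b : StructMonoid X) {z : Tot (Chain K X (StructMonoid X))}
    (hz : dM K X z = 0) : rmulOp K b z - z ∈ LinearMap.range (dM K X) := by
  induction b using StructMonoid.induction_right with
  | one =>
    rw [rmulOp_one, sub_self]
    exact zero_mem _
  | mul_gen b y ih =>
    rw [← rmulOp_rmulOp, ← sub_add_sub_cancel]
    refine add_mem ⟨signMap K _ (snocOp K y (rmulOp K b z)), ?_⟩ ih
    rw [dM_signMap, dM_snocOp, dM_rmulOp, hz, map_zero, map_zero, zero_add, signMap_signMap,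
      neg_sub]

/-- Modulo boundaries, z^b ~ b z^b = z b ~ z. -/
theorem powChain_sub_mem_range (b : StructMonoid X) {n : ℕ} {z : Chain K X (StructMonoid X) n}
    (hz : dM K X (inc K _ n z) = 0) :
    inc K _ n (powChain K b n z) - inc K _ n z ∈ LinearMap.range (dM K X) := by
  have h1 := lmulHom_sub_mem_range b (dM_powChain b hz)
  have h2 := rmulOp_sub_mem_range b hz
  rw [lmulHom_powChain, ← rmulOp_inc] at h1
  have := sub_mem h2 h1
  rwa [sub_sub_sub_cancel_left] at this

/-- A word longer than N · |X| contains some letter y at least N times. After collecting the y's in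
front, y^N splits off as an operator and the rest has N fewer letters; positivity of N makes the
recursion terminate. -/
theorem single_prod_mem {Y : Set X} (hY : ∀ x ∈ Y, ∀ y ∈ Y, shelfPow x y ∈ Y) [Finite X]
    {N : ℕ} (hN : 0 < N) {n : ℕ} {W : Submodule K (Chain K X (StructMonoid X) n)}
    (hW : ∀ w : List X, w.length ≤ N * Nat.card X → ∀ x,
      Finsupp.single ((w.map gen).prod, x) 1 ∈ W)
    (hR : ∀ y ∈ Y, ∀ z ∈ W, lmulHom K n (gen y ^ N) z ∈ W) (w : List X) (hw : ∀ x ∈ w, x ∈ Y)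
    (x : Fin n → X) : Finsupp.single ((w.map gen).prod, x) 1 ∈ W := by
  classical
  induction h : w.length using Nat.strong_induction_on generalizing w with
  | _ l ih =>
    rcases le_or_gt w.length (N * Nat.card X) with hl | hl
    · exact hW w hl x
    · obtain ⟨y, hy, hc⟩ := exists_le_count hl
      obtain ⟨w', h1, h2, h3⟩ := exists_prod_eq_pow_mul hY (hw y hy) w hw
      have h4 := hR y (hw y hy) _ (ih (List.replicate (w.count y - N) y ++ w').length
        (by simp; omega) (List.replicate (w.count y - N) y ++ w') (fun z hz => by
          rcases List.mem_append.1 hz with hz | hz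
          · rw [List.eq_of_mem_replicate hz]
            exact hw y hy
          · exact h1 z hz) rfl)
      rw [lmulHom_single, List.map_append, List.prod_append, List.map_replicate,
        List.prod_replicate, ← mul_assoc, ← pow_add, Nat.add_sub_cancel' hc, ← h3] at h4
      exact h4

/-- After the twist every M-coordinate is a word in letters of Y. The letters x_i need no such
restriction, since X^n is finite anyway. -/
theorem single_powHom_mem {Y : Set X} {b : StructMonoid X} (hb : ∀ x, ract x b ∈ Y) {n : ℕ}
    {W : Submodule K (Chain K X (StructMonoid X) n)}
    (hW : ∀ w : List X, (∀ x ∈ w, x ∈ Y) → ∀ x, Finsupp.single ((w.map gen).prod, x) 1 ∈ W)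
    (z : Chain K X (StructMonoid X) n) : powChain K b n z ∈ W := by
  have hw : ∀ a : StructMonoid X, ∃ w : List X, (∀ x ∈ w, x ∈ Y) ∧
      powHom b a = (w.map gen).prod := fun a => by
    induction a using StructMonoid.induction_right with
    | one => exact ⟨[], by simp⟩
    | mul_gen a y ih =>
      obtain ⟨w, h1, h2⟩ := ih
      refine ⟨w ++ [ract y b], fun x hx => ?_, by simp [h2, powHom_gen]⟩
      rcases List.mem_append.1 hx with hx | hx
      · exact h1 x hx
      · rw [List.mem_singleton.1 hx]
        exact hb y
  have : W.mkQ ∘ₗ powChain K b n = 0 := Finsupp.lhom_ext' fun c => LinearMap.ext_ring <| by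
    refine (Submodule.Quotient.mk_eq_zero _).2 ?_
    obtain ⟨w, h1, h2⟩ := hw c.1
    rw [powChain, Finsupp.lsingle_apply, Finsupp.lmapDomain_apply, Finsupp.mapDomain_single, h2]
    exact hW w h1 _
  exact (Submodule.Quotient.mk_eq_zero _).1 (LinearMap.congr_fun this z)

theorem finite_homology [IsNoetherianRing K] [Finite X] (n : ℕ) :
    Module.Finite K (Hlgy (dM K X) n) := by
  obtain ⟨Y, b, N, hN, hb, hY, hper⟩ := exists_periodic_subset (X := X)
  refine finite_homology_of_commuting (s := (fun y => lmulHom K n (gen y ^ N)) '' Y)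
    (gens := (fun p : List X × (Fin n → X) => Finsupp.single ((p.1.map gen).prod, p.2) 1) ''
      ({w | w.length ≤ N * Nat.card X} ×ˢ Set.univ)) (Y.toFinite.image _) ?_ ?_
    (((List.finite_length_le X _).prod Set.finite_univ).image _)
    fun z hz => ⟨powChain K b n z, dM_powChain b hz, powChain_sub_mem_range b hz,
      fun W hW hs => single_powHom_mem hb (single_prod_mem hY hN
        (fun w hw x => hW ⟨(w, x), ⟨hw, trivial⟩, rfl⟩)
        fun y hy z hz => hs _ ⟨y, hy, rfl⟩ z hz) z⟩
  · rintro _ ⟨x, hx, rfl⟩ _ ⟨y, hy, rfl⟩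
    -- y^N fixes x, so crossing it leaves the generator unchanged.
    have h : Commute (gen x) (gen y ^ N) := by
      rw [Commute, SemiconjBy, gen_mul, hper x hx y hy]
    rw [lmulHom_mul, lmulHom_mul, (h.pow_left N).eq]
  · rintro _ ⟨y, hy, rfl⟩ z hz
    exact ⟨dM_lmulHom _ hz, lmulHom_sub_mem_range _ hz⟩

end Finiteness

/-! ### The dual bialgebra of a degreewise finite graded bialgebra -/

section Injectivity

/-! ### Injectivity of the Koszul evaluations over a field. -/

variable {K : Type*} [CommRing K]

/-- No finite dimensionality is assumed: expand a tensor along a basis of the dual of `B`. If it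
vanishes as a functional, then for each a the resulting element of the dual of `B` is zero, hence so
are all its coordinates. -/
theorem dualDistrib_injective (hK : IsField K) (A B : Type*) [AddCommGroup A] [AddCommGroup B]
    [Module K A] [Module K B] : Function.Injective (TensorProduct.dualDistrib K A B) := by
  let _ := hK.toField
  let c := Module.Free.chooseBasis K (Module.Dual K B)
  have h (a : A) (j) : ∀ s, c.repr (dualTensorHom K A (Module.Dual K B) s a) j =
      TensorProduct.equivFinsuppOfBasisRight c s j a := by
    have : Finsupp.lapply j ∘ₗ c.repr.toLinearMap ∘ₗ LinearMap.applyₗ a ∘ₗ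
        dualTensorHom K A (Module.Dual K B) =
        LinearMap.applyₗ a ∘ₗ Finsupp.lapply j ∘ₗ
          (TensorProduct.equivFinsuppOfBasisRight c).toLinearMap :=
      TensorProduct.ext' fun φ ψ => by simp [mul_comm]
    exact LinearMap.congr_fun this
  have h2 (a : A) (b : B) : ∀ s, dualTensorHom K A (Module.Dual K B) s a b =
      TensorProduct.dualDistrib K A B s (a ⊗ₜ b) := by
    have : LinearMap.applyₗ b ∘ₗ LinearMap.applyₗ a ∘ₗ dualTensorHom K A (Module.Dual K B) =
        LinearMap.applyₗ (a ⊗ₜ b) ∘ₗ TensorProduct.dualDistrib K A B :=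
      TensorProduct.ext' fun φ ψ => by simp
    exact LinearMap.congr_fun this
  rw [injective_iff_map_eq_zero]
  intro s hs
  rw [← (TensorProduct.equivFinsuppOfBasisRight c).map_eq_zero_iff]
  ext j a
  rw [← h, show dualTensorHom K A (Module.Dual K B) s a = 0 from
    LinearMap.ext fun b => by rw [h2, hs]; rfl]
  simp

theorem tensor_map_injective (hK : IsField K) {A B A' B' : Type*} [AddCommGroup A]
    [AddCommGroup B] [AddCommGroup A'] [AddCommGroup B'] [Module K A] [Module K B] [Module K A']
    [Module K B'] {f : A →ₗ[K] A'} {g : B →ₗ[K] B'} (hf : Function.Injective f)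
    (hg : Function.Injective g) : Function.Injective (TensorProduct.map f g) := by
  let _ := hK.toField
  exact TensorProduct.map_injective_of_flat_flat f g hf hg

theorem koszulSign_injective {A B : Type*} [AddCommGroup A] [AddCommGroup B] [Module K A]
    [Module K B] {P : A →ₗ[K] A} {Q : B →ₗ[K] B} (hP : ∀ a, P (P a) = P a)
    (hQ : ∀ b, Q (Q b) = Q b) : Function.Injective (koszulSign K P Q) := by
  have : koszulSign K P Q ∘ₗ koszulSign K P Q = LinearMap.id := TensorProduct.ext' fun a b => by
    simp only [LinearMap.comp_apply, koszulSign_tmul, map_sub, map_smul, hP, hQ,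
      LinearMap.id_apply]
    module
  exact Function.LeftInverse.injective (g := koszulSign K P Q) (LinearMap.congr_fun this)

variable {V : ℕ → Type*} [∀ n, AddCommGroup (V n)] [∀ n, Module K (V n)]

theorem oddPart_oddPart (v : Tot V) : oddPart K V (oddPart K V v) = oddPart K V v := by
  have : oddPart K V ∘ₗ oddPart K V = oddPart K V := tot_hom_ext fun n a => by
    rw [LinearMap.comp_apply, oddPart_inc]
    split_ifs with h
    · rw [oddPart_inc, if_pos h]
    · rw [map_zero]
  exact LinearMap.congr_fun this v

theorem oddPartTensor_oddPartTensor (t : Tot V ⊗[K] Tot V) :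
    oddPartTensor K V (oddPartTensor K V t) = oddPartTensor K V t := by
  have : oddPartTensor K V ∘ₗ oddPartTensor K V = oddPartTensor K V :=
    tot_tensor_ext fun p q a b => by
      rw [LinearMap.comp_apply, oddPartTensor_inc]
      split_ifs with h
      · rw [oddPartTensor_inc, if_pos h]
      · rw [map_zero]
  exact LinearMap.congr_fun this t

theorem evTensor_injective (hK : IsField K) : Function.Injective (evTensor K V) :=
  (dualDistrib_injective hK _ _).comp
    ((tensor_map_injective hK ev_injective ev_injective).comp
      (koszulSign_injective oddPart_oddPart oddPart_oddPart))

variable (K V) in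
/-- The Koszul evaluation of `T* ⊗ (T* ⊗ T*)`. -/
def evTensorThree : (Tot (GrDual K V) ⊗[K] (Tot (GrDual K V) ⊗[K] Tot (GrDual K V))) →ₗ[K]
    Module.Dual K (Tot V ⊗[K] (Tot V ⊗[K] Tot V)) :=
  TensorProduct.dualDistrib K _ _ ∘ₗ TensorProduct.map (ev K V) (evTensor K V) ∘ₗ
    koszulSign K (oddPart K (GrDual K V)) (oddPartTensor K (GrDual K V))

variable (K V) in
/-- The Koszul evaluation of `(T* ⊗ T*) ⊗ T*`. -/
def evTensorThree' : ((Tot (GrDual K V) ⊗[K] Tot (GrDual K V)) ⊗[K] Tot (GrDual K V)) →ₗ[K]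
    Module.Dual K ((Tot V ⊗[K] Tot V) ⊗[K] Tot V) :=
  TensorProduct.dualDistrib K _ _ ∘ₗ TensorProduct.map (evTensor K V) (ev K V) ∘ₗ
    koszulSign K (oddPartTensor K (GrDual K V)) (oddPart K (GrDual K V))

theorem evTensorThree_injective (hK : IsField K) : Function.Injective (evTensorThree K V) :=
  (dualDistrib_injective hK _ _).comp
    ((tensor_map_injective hK ev_injective (evTensor_injective hK)).comp
      (koszulSign_injective oddPart_oddPart oddPartTensor_oddPartTensor))

/-- The two bracketings carry sign exponents p(q+r) + qr and (p+q)r + pq, which coincide. Together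
with injectivity this lets coassociativity of a dual coproduct be tested on triple tensors. -/
theorem evTensorThree_assoc (x) : evTensorThree K V (TensorProduct.assoc K _ _ _ x) ∘ₗ
    (TensorProduct.assoc K (Tot V) (Tot V) (Tot V)).toLinearMap = evTensorThree' K V x := by
  have : (TensorProduct.assoc K (Tot V) (Tot V) (Tot V)).toLinearMap.dualMap ∘ₗ
      evTensorThree K V ∘ₗ (TensorProduct.assoc K _ _ _).toLinearMap = evTensorThree' K V :=
    tot_tensor_ext_three fun p q r f g h => TensorProduct.ext_threefold fun a b c => by
      have h1 := koszulSign_tmul_of_parity (oddPart_inc (K := K) p f)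
        (oddPartTensor_inc (K := K) q r g h)
      have h2 := koszulSign_tmul_of_parity (oddPartTensor_inc (K := K) p q f g)
        (oddPart_inc (K := K) r h)
      simp only [evTensorThree, evTensorThree', LinearMap.comp_apply, LinearEquiv.coe_coe,
        TensorProduct.assoc_tmul, h1, h2, map_smul, TensorProduct.map_tmul, evTensor_inc,
        LinearMap.dualMap_apply, TensorProduct.dualDistrib_apply, LinearMap.smul_apply,
        smul_eq_mul, TensorProduct.tmul_smul, ← TensorProduct.smul_tmul']
      ring
  exact LinearMap.congr_fun this x

end Injectivity

/-! ### The transposed coproduct in the algebraic tensor square. -/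

section FiniteDual

variable {K : Type*} [CommRing K] {V : ℕ → Type*} [∀ n, AddCommGroup (V n)]
  [∀ n, Module K (V n)]

theorem evTensor_map_inc (p q : ℕ) (u : GrDual K V p ⊗[K] GrDual K V q) (a : V p) (b : V q) :
    evTensor K V (TensorProduct.map (inc K _ p) (inc K _ q) u) (inc K V p a ⊗ₜ inc K V q b) =
      (-1 : K) ^ (p * q) * TensorProduct.dualDistrib K _ _ u (a ⊗ₜ b) := by
  have : LinearMap.applyₗ (inc K V p a ⊗ₜ inc K V q b) ∘ₗ evTensor K V ∘ₗ
      TensorProduct.map (inc K _ p) (inc K _ q) =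
      (-1 : K) ^ (p * q) • (LinearMap.applyₗ (a ⊗ₜ b) ∘ₗ TensorProduct.dualDistrib K _ _) :=
    TensorProduct.ext' fun f g => by simp [evTensor_inc]
  exact LinearMap.congr_fun this u

theorem evTensor_map_inc_of_ne {p q p' q' : ℕ} (h : p' ≠ p ∨ q' ≠ q)
    (u : GrDual K V p ⊗[K] GrDual K V q) (a : V p') (b : V q') :
    evTensor K V (TensorProduct.map (inc K _ p) (inc K _ q) u)
      (inc K V p' a ⊗ₜ inc K V q' b) = 0 := by
  have : LinearMap.applyₗ (inc K V p' a ⊗ₜ inc K V q' b) ∘ₗ evTensor K V ∘ₗ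
      TensorProduct.map (inc K _ p) (inc K _ q) = 0 :=
    TensorProduct.ext' fun f g => by
      rcases h with h | h <;> simp [evTensor_inc, ev_inc_of_ne h]
  exact LinearMap.congr_fun this u

/-- A functional of total degree n involves only the finitely many bidegrees (p, q) with p + q = n.
In each of them, finite dimensionality turns it into an algebraic tensor; the inserted sign cancels
the Koszul sign of the evaluation. -/
theorem exists_evTensor_eq (hK : IsField K) (hV : ∀ n, Module.Finite K (V n)) {n : ℕ}
    {Φ : Module.Dual K (Tot V ⊗[K] Tot V)}
    (hΦ : ∀ (p q : ℕ) (a : V p) (b : V q), p + q ≠ n →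
      Φ (inc K V p a ⊗ₜ inc K V q b) = 0) :
    ∃ t ∈ tensorDeg K (GrDual K V) n, evTensor K V t = Φ := by
  have hu : ∀ p q, ∃ u : GrDual K V p ⊗[K] GrDual K V q,
      TensorProduct.dualDistrib K _ _ u =
        (-1 : K) ^ (p * q) • (Φ ∘ₗ TensorProduct.map (inc K V p) (inc K V q)) := fun p q => by
    let _ := hK.toField
    exact ⟨(TensorProduct.dualDistribEquiv K (V p) (V q)).symm _,
      (TensorProduct.dualDistribEquiv K (V p) (V q)).apply_symm_apply _⟩
  choose u hu using hu
  refine ⟨∑ r ∈ Finset.HasAntidiagonal.antidiagonal n, TensorProduct.map (inc K _ r.1) (inc K _ r.2) (u r.1 r.2),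
    Submodule.sum_mem _ fun r hr => Submodule.mem_iSup_of_mem
      ⟨r, Finset.HasAntidiagonal.mem_antidiagonal.1 hr⟩ ⟨_, rfl⟩, tot_tensor_ext fun p q a b => ?_⟩
  rw [map_sum, LinearMap.sum_apply]
  by_cases hpq : p + q = n
  · rw [Finset.sum_eq_single (p, q)]
    · rw [evTensor_map_inc, hu, LinearMap.smul_apply, smul_eq_mul, ← mul_assoc, ← mul_pow]
      simp
    · intro r _ hr
      refine evTensor_map_inc_of_ne ?_ _ _ _
      by_contra! h
      exact hr (Prod.ext h.1.symm h.2.symm)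
    · intro h
      exact absurd (Finset.HasAntidiagonal.mem_antidiagonal.2 hpq) h
  · rw [hΦ p q a b hpq]
    refine Finset.sum_eq_zero fun r hr => evTensor_map_inc_of_ne ?_ _ _ _
    have := Finset.HasAntidiagonal.mem_antidiagonal.1 hr
    by_contra! h
    exact hpq (by rw [h.1, h.2, this])

theorem transposeMul_mem_range (hK : IsField K) (hV : ∀ n, Module.Finite K (V n))
    (A : GrAlg K V) (F : Tot (GrDual K V)) :
    transposeMul A F ∈ LinearMap.range (evTensor K V) := by
  have : (LinearMap.range (evTensor K V)).mkQ ∘ₗ transposeMul A = 0 := tot_hom_ext fun n f => by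
    obtain ⟨t, -, ht⟩ := exists_evTensor_eq hK hV
      (fun p q a b h => transposeMul_inc_of_ne A (n := n) h f a b)
    exact (Submodule.Quotient.mk_eq_zero _).2 ⟨t, ht⟩
  exact (Submodule.Quotient.mk_eq_zero _).1 (LinearMap.congr_fun this F)

/-- The transpose of a product, with values in the tensor square of the graded dual. -/
def dualComul (hK : IsField K) (hV : ∀ n, Module.Finite K (V n)) (A : GrAlg K V) :
    Tot (GrDual K V) →ₗ[K] (Tot (GrDual K V) ⊗[K] Tot (GrDual K V)) :=
  LinearMap.codRestrictOfInjective (transposeMul A) (evTensor K V) (evTensor_injective hK)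
    (transposeMul_mem_range hK hV A)

theorem evTensor_dualComul (hK : IsField K) (hV : ∀ n, Module.Finite K (V n)) (A : GrAlg K V)
    (F : Tot (GrDual K V)) : evTensor K V (dualComul hK hV A F) = transposeMul A F :=
  LinearMap.codRestrictOfInjective_comp_apply _ _ (evTensor_injective hK)
    (transposeMul_mem_range hK hV A) F

theorem dualComul_mem_tensorDeg (hK : IsField K) (hV : ∀ n, Module.Finite K (V n))
    (A : GrAlg K V) (n : ℕ) (f : GrDual K V n) :
    dualComul hK hV A (inc K _ n f) ∈ tensorDeg K (GrDual K V) n := by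
  obtain ⟨t, ht, ht'⟩ := exists_evTensor_eq hK hV
    (fun p q a b h => transposeMul_inc_of_ne A (n := n) h f a b)
  rwa [evTensor_injective hK ((evTensor_dualComul hK hV A _).trans ht'.symm)]

theorem oddPartTensor_of_mem {n : ℕ} {t : Tot V ⊗[K] Tot V} (ht : t ∈ tensorDeg K V n) :
    oddPartTensor K V t = if Odd n then t else 0 := by
  have : tensorDeg K V n ≤
      LinearMap.ker (oddPartTensor K V - (if Odd n then LinearMap.id else 0)) :=
    tensorDeg_le_ker fun p q a b hpq => by
      subst hpq
      rw [LinearMap.sub_apply, oddPartTensor_inc]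
      split_ifs <;> simp
  have h := sub_eq_zero.1 (this ht)
  rw [h]
  split_ifs <;> rfl

theorem evTensorThree_tmul_of_mem {p q : ℕ} (f : GrDual K V p)
    {t : Tot (GrDual K V) ⊗[K] Tot (GrDual K V)} (ht : t ∈ tensorDeg K (GrDual K V) q) :
    evTensorThree K V (inc K _ p f ⊗ₜ t) =
      (-1 : K) ^ (p * q) •
        TensorProduct.dualDistrib K _ _ (ev K V (inc K _ p f) ⊗ₜ evTensor K V t) := by
  have h := koszulSign_tmul_of_parity (oddPart_inc (K := K) p f) (oddPartTensor_of_mem ht)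
  unfold evTensorThree
  rw [LinearMap.comp_apply, LinearMap.comp_apply, h, map_smul, map_smul, TensorProduct.map_tmul]

theorem evTensorThree'_tmul_of_mem {p q : ℕ} (f : GrDual K V q)
    {t : Tot (GrDual K V) ⊗[K] Tot (GrDual K V)} (ht : t ∈ tensorDeg K (GrDual K V) p) :
    evTensorThree' K V (t ⊗ₜ inc K _ q f) =
      (-1 : K) ^ (p * q) •
        TensorProduct.dualDistrib K _ _ (evTensor K V t ⊗ₜ ev K V (inc K _ q f)) := by
  have h := koszulSign_tmul_of_parity (oddPartTensor_of_mem ht) (oddPart_inc (K := K) q f)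
  unfold evTensorThree'
  rw [LinearMap.comp_apply, LinearMap.comp_apply, h, map_smul, map_smul, TensorProduct.map_tmul]

theorem evTensorThree_map_dualComul (hK : IsField K) (hV : ∀ n, Module.Finite K (V n))
    (A : GrAlg K V) (s) :
    evTensorThree K V (TensorProduct.map LinearMap.id (dualComul hK hV A) s) =
      evTensor K V s ∘ₗ TensorProduct.map LinearMap.id A.mul := by
  have : evTensorThree K V ∘ₗ TensorProduct.map LinearMap.id (dualComul hK hV A) =
      (TensorProduct.map LinearMap.id A.mul).dualMap ∘ₗ evTensor K V :=
    tot_tensor_ext fun p q f g => by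
      have h := evTensorThree_tmul_of_mem f (dualComul_mem_tensorDeg hK hV A q g)
      rw [evTensor_dualComul] at h
      refine h.trans ?_
      rw [LinearMap.comp_apply, evTensor_inc, map_smul, LinearMap.dualMap_apply',
        dualDistrib_comp_map, LinearMap.comp_id]
      rfl
  exact LinearMap.congr_fun this s

theorem evTensorThree'_map_dualComul (hK : IsField K) (hV : ∀ n, Module.Finite K (V n))
    (A : GrAlg K V) (s) :
    evTensorThree' K V (TensorProduct.map (dualComul hK hV A) LinearMap.id s) =
      evTensor K V s ∘ₗ TensorProduct.map A.mul LinearMap.id := by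
  have : evTensorThree' K V ∘ₗ TensorProduct.map (dualComul hK hV A) LinearMap.id =
      (TensorProduct.map A.mul LinearMap.id).dualMap ∘ₗ evTensor K V :=
    tot_tensor_ext fun p q f g => by
      have h := evTensorThree'_tmul_of_mem g (dualComul_mem_tensorDeg hK hV A p f)
      rw [evTensor_dualComul] at h
      refine h.trans ?_
      rw [LinearMap.comp_apply, evTensor_inc, map_smul, LinearMap.dualMap_apply',
        dualDistrib_comp_map, LinearMap.comp_id]
      rfl
  exact LinearMap.congr_fun this s

theorem evTensor_one_left (A : GrAlg K V) (ε : Tot (GrDual K V) →ₗ[K] K)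
    (hε : ∀ F, ε F = ev K V F A.one) (s) (a : Tot V) :
    ev K V (TensorProduct.lid K _ (TensorProduct.map ε LinearMap.id s)) a =
      evTensor K V s (A.one ⊗ₜ a) := by
  obtain ⟨e, he⟩ := A.one_deg
  have : LinearMap.applyₗ a ∘ₗ ev K V ∘ₗ (TensorProduct.lid K _).toLinearMap ∘ₗ
      TensorProduct.map ε LinearMap.id = LinearMap.applyₗ (A.one ⊗ₜ a) ∘ₗ evTensor K V :=
    tot_tensor_ext fun p q f g => by
      simp only [LinearMap.comp_apply, TensorProduct.map_tmul, LinearEquiv.coe_coe,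
        TensorProduct.lid_tmul, map_smul, LinearMap.applyₗ_apply_apply, evTensor_inc, hε,
        TensorProduct.dualDistrib_apply, LinearMap.id_apply, smul_eq_mul]
      rw [← he]
      rcases eq_or_ne 0 p with rfl | hp
      · simp
      · simp [ev_inc_of_ne hp]
  exact LinearMap.congr_fun this s

theorem evTensor_one_right (A : GrAlg K V) (ε : Tot (GrDual K V) →ₗ[K] K)
    (hε : ∀ F, ε F = ev K V F A.one) (s) (a : Tot V) :
    ev K V (TensorProduct.rid K _ (TensorProduct.map LinearMap.id ε s)) a =
      evTensor K V s (a ⊗ₜ A.one) := by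
  obtain ⟨e, he⟩ := A.one_deg
  have : LinearMap.applyₗ a ∘ₗ ev K V ∘ₗ (TensorProduct.rid K _).toLinearMap ∘ₗ
      TensorProduct.map LinearMap.id ε = LinearMap.applyₗ (a ⊗ₜ A.one) ∘ₗ evTensor K V :=
    tot_tensor_ext fun p q f g => by
      simp only [LinearMap.comp_apply, TensorProduct.map_tmul, LinearEquiv.coe_coe,
        TensorProduct.rid_tmul, map_smul, LinearMap.applyₗ_apply_apply, evTensor_inc, hε,
        TensorProduct.dualDistrib_apply, LinearMap.id_apply, smul_eq_mul]
      rw [← he]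
      rcases eq_or_ne 0 q with rfl | hp
      · simp [mul_comm]
      · simp [ev_inc_of_ne hp]
  exact LinearMap.congr_fun this s

/-- The graded dual coalgebra of a degreewise finite graded algebra over a field. -/
def dualCoalg (hK : IsField K) (hV : ∀ n, Module.Finite K (V n)) (A : GrAlg K V) :
    GrCoalg K (GrDual K V) where
  comul := dualComul hK hV A
  counit := LinearMap.applyₗ A.one ∘ₗ ev K V
  comul_deg := dualComul_mem_tensorDeg hK hV A
  counit_deg n f := by
    obtain ⟨e, he⟩ := A.one_deg
    rw [← he]
    exact ev_inc_of_ne (by omega) f e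
  coassoc := LinearMap.ext fun F => evTensorThree_injective hK <| by
    rw [LinearMap.comp_apply, LinearMap.comp_apply, LinearMap.comp_apply,
      evTensorThree_map_dualComul, evTensor_dualComul,
      ← LinearMap.cancel_right (TensorProduct.assoc K (Tot V) (Tot V) (Tot V)).surjective]
    refine (evTensorThree_assoc _).trans ?_
    rw [evTensorThree'_map_dualComul, evTensor_dualComul]
    exact TensorProduct.ext_threefold fun a b c => congrArg (ev K V F) (A.mul_assoc a b c)
  counit_comul F := ev_injective <| LinearMap.ext fun a => by
    rw [evTensor_one_left A _ fun _ => rfl, evTensor_dualComul]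
    exact congrArg (ev K V F) (A.one_mul a)
  comul_counit F := ev_injective <| LinearMap.ext fun a => by
    rw [evTensor_one_right A _ fun _ => rfl, evTensor_dualComul]
    exact congrArg (ev K V F) (A.mul_one a)

/-- With d = 0 the completed duality statement contains exactly the multiplicativity and unit
identities of a dual bialgebra, which injectivity of the evaluation then transfers to the algebraic
tensor square. -/
theorem isCompletedDGBialg_zero (B : GrBialg K V) :
    IsCompletedDGBialg (0 : Tot V →ₗ[K] Tot V) B (cupAlg B.toGrCoalg) :=
  Lowers.isCompletedDGBialg (δ := fun _ => 0) ⟨fun _ => rfl, fun n a => (map_zero _).symm⟩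
    ⟨by simp, by ext; simp [tensorD]⟩ (isCup_cupAlg _)

/-- The graded dual bialgebra of a degreewise finite graded bialgebra over a field. -/
def dualBialg (hK : IsField K) (hV : ∀ n, Module.Finite K (V n)) (B : GrBialg K V) :
    GrBialg K (GrDual K V) :=
  have h := isCompletedDGBialg_zero B
  { toGrAlg := cupAlg B.toGrCoalg
    toGrCoalg := dualCoalg hK hV B.toGrAlg
    comul_mul := fun F G => evTensor_injective hK <| by
      refine (evTensor_dualComul hK hV _ _).trans ?_
      rw [h.comul_mul, h.extends_mul]
      exact congrArg₂ _ (evTensor_dualComul hK hV _ _).symm (evTensor_dualComul hK hV _ _).symm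
    comul_one := evTensor_injective hK ((evTensor_dualComul hK hV _ _).trans h.comul_one)
    counit_mul := h.counit_mul
    counit_one := h.counit_one }

end FiniteDual

/-! ### The bialgebra structure on the cohomology of the graded dual -/

/-! ### Transport of graded coalgebras and bialgebras along graded isomorphisms. -/

section Transport

variable {K : Type*} [CommRing K] {V W : ℕ → Type*} [∀ n, AddCommGroup (V n)]
  [∀ n, Module K (V n)] [∀ n, AddCommGroup (W n)] [∀ n, Module K (W n)]

theorem map_mem_tensorDeg {f : Tot V →ₗ[K] Tot W}
    (hf : ∀ n a, f (inc K V n a) ∈ LinearMap.range (inc K W n)) {n : ℕ} {t}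
    (ht : t ∈ tensorDeg K V n) : TensorProduct.map f f t ∈ tensorDeg K W n := by
  have : tensorDeg K V n ≤
      LinearMap.ker ((tensorDeg K W n).mkQ ∘ₗ TensorProduct.map f f) :=
    tensorDeg_le_ker fun p q a b hpq => by
      obtain ⟨x, hx⟩ := hf p a
      obtain ⟨y, hy⟩ := hf q b
      refine (Submodule.Quotient.mk_eq_zero _).2 ?_
      rw [TensorProduct.map_tmul, ← hx, ← hy]
      exact tmul_mem_tensorDeg p q hpq x y
  exact (Submodule.Quotient.mk_eq_zero _).1 (this ht)

theorem tensorMul_map {f : Tot V →ₗ[K] Tot W}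
    (hf : ∀ n a, f (inc K V n a) ∈ LinearMap.range (inc K W n))
    {m : (Tot V ⊗[K] Tot V) →ₗ[K] Tot V} {m' : (Tot W ⊗[K] Tot W) →ₗ[K] Tot W}
    (hm : ∀ a b, f (m (a ⊗ₜ b)) = m' (f a ⊗ₜ f b)) (s t) :
    TensorProduct.map f f (tensorMul K V m (s ⊗ₜ t)) =
      tensorMul K W m' (TensorProduct.map f f s ⊗ₜ TensorProduct.map f f t) := by
  have : TensorProduct.map f f ∘ₗ tensorMul K V m =
      tensorMul K W m' ∘ₗ TensorProduct.map (TensorProduct.map f f) (TensorProduct.map f f) :=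
    tot_tensor_ext_four fun p q r s a b a' b' => by
      obtain ⟨w, hw⟩ := hf p a
      obtain ⟨x, hx⟩ := hf q b
      obtain ⟨y, hy⟩ := hf r a'
      obtain ⟨z, hz⟩ := hf s b'
      rw [LinearMap.comp_apply, LinearMap.comp_apply, tensorMul_inc, map_smul,
        TensorProduct.map_tmul, TensorProduct.map_tmul, TensorProduct.map_tmul,
        TensorProduct.map_tmul, hm, hm, ← hw, ← hx, ← hy, ← hz, tensorMul_inc]
  exact LinearMap.congr_fun this (s ⊗ₜ t)

/-- The transport of a graded coalgebra along a graded isomorphism. -/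
def GrCoalg.transport (C : GrCoalg K W) (E : Tot V ≃ₗ[K] Tot W)
    (hE : ∀ n a, E (inc K V n a) ∈ LinearMap.range (inc K W n))
    (hE' : ∀ n a, E.symm (inc K W n a) ∈ LinearMap.range (inc K V n)) : GrCoalg K V where
  comul := TensorProduct.map E.symm.toLinearMap E.symm.toLinearMap ∘ₗ C.comul ∘ₗ E.toLinearMap
  counit := C.counit ∘ₗ E.toLinearMap
  comul_deg n a := by
    obtain ⟨x, hx⟩ := hE n a
    refine map_mem_tensorDeg hE' ?_
    change C.comul (E _) ∈ _
    rw [← hx]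
    exact C.comul_deg n x
  counit_deg n a := by
    obtain ⟨x, hx⟩ := hE (n + 1) a
    change C.counit (E _) = 0
    rw [← hx]
    exact C.counit_deg n x
  coassoc := LinearMap.ext fun v => by
    have h1 : ∀ t, TensorProduct.assoc K _ _ _ (TensorProduct.map
        (TensorProduct.map E.symm.toLinearMap E.symm.toLinearMap ∘ₗ C.comul ∘ₗ E.toLinearMap)
        LinearMap.id (TensorProduct.map E.symm.toLinearMap E.symm.toLinearMap t)) =
        TensorProduct.map E.symm.toLinearMap
          (TensorProduct.map E.symm.toLinearMap E.symm.toLinearMap)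
          (TensorProduct.assoc K _ _ _ (TensorProduct.map C.comul LinearMap.id t)) := fun t => by
      induction t with
      | zero => simp only [map_zero]
      | add x y hx hy => simp only [map_add, hx, hy]
      | tmul x y =>
        simp only [TensorProduct.map_tmul, LinearMap.comp_apply, LinearEquiv.coe_coe,
          LinearEquiv.apply_symm_apply, LinearMap.id_apply]
        induction C.comul x with
        | zero => simp only [map_zero, TensorProduct.zero_tmul]
        | add x y hx hy => simp only [map_add, TensorProduct.add_tmul, hx, hy]
        | tmul x z => simp
    have h2 : ∀ t, TensorProduct.map LinearMap.id
        (TensorProduct.map E.symm.toLinearMap E.symm.toLinearMap ∘ₗ C.comul ∘ₗ E.toLinearMap)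
        (TensorProduct.map E.symm.toLinearMap E.symm.toLinearMap t) =
        TensorProduct.map E.symm.toLinearMap
          (TensorProduct.map E.symm.toLinearMap E.symm.toLinearMap)
          (TensorProduct.map LinearMap.id C.comul t) := fun t => by
      induction t with
      | zero => simp only [map_zero]
      | add x y hx hy => simp only [map_add, hx, hy]
      | tmul x y => simp
    have h3 := LinearMap.congr_fun C.coassoc (E v)
    simp only [LinearMap.comp_apply, LinearEquiv.coe_coe] at h1 h2 h3 ⊢
    rw [h1, h2, h3]
  counit_comul v := by
    have h : ∀ t, TensorProduct.lid K _ (TensorProduct.map (C.counit ∘ₗ E.toLinearMap)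
        LinearMap.id (TensorProduct.map E.symm.toLinearMap E.symm.toLinearMap t)) =
        E.symm (TensorProduct.lid K _ (TensorProduct.map C.counit LinearMap.id t)) := fun t => by
      induction t with
      | zero => simp only [map_zero]
      | add x y hx hy => simp only [map_add, hx, hy]
      | tmul x y => simp
    refine (h _).trans ?_
    rw [LinearMap.comp_apply, C.counit_comul]
    exact E.symm_apply_apply v
  comul_counit v := by
    have h : ∀ t, TensorProduct.rid K _ (TensorProduct.map LinearMap.id
        (C.counit ∘ₗ E.toLinearMap)
        (TensorProduct.map E.symm.toLinearMap E.symm.toLinearMap t)) =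
        E.symm (TensorProduct.rid K _ (TensorProduct.map LinearMap.id C.counit t)) := fun t => by
      induction t with
      | zero => simp only [map_zero]
      | add x y hx hy => simp only [map_add, hx, hy]
      | tmul x y => simp
    refine (h _).trans ?_
    rw [LinearMap.comp_apply, C.comul_counit]
    exact E.symm_apply_apply v

/-- The product on the source is prescribed and only the coproduct is pulled back, so that the cup
product on cohomology is kept on the nose. -/
theorem GrBialg.exists_transport (D : GrBialg K W) (A : GrAlg K V) (E : Tot V ≃ₗ[K] Tot W)
    (hE : ∀ n a, E (inc K V n a) ∈ LinearMap.range (inc K W n))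
    (hE' : ∀ n a, E.symm (inc K W n a) ∈ LinearMap.range (inc K V n))
    (hmul : ∀ a b, E (A.mul (a ⊗ₜ b)) = D.mul (E a ⊗ₜ E b)) (hone : E A.one = D.one) :
    ∃ T : GrBialg K V, T.toGrAlg = A ∧
      (∀ v, TensorProduct.map E.toLinearMap E.toLinearMap (T.comul v) = D.comul (E v)) ∧
      ∀ v, T.counit v = D.counit (E v) := by
  refine ⟨{ toGrAlg := A
            toGrCoalg := D.toGrCoalg.transport E hE hE'
            comul_mul := fun a b => ?_
            comul_one := ?_
            counit_mul := fun a b => ?_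
            counit_one := ?_ }, rfl, fun v => ?_, fun v => rfl⟩
  · have hs : ∀ x y, E.symm.toLinearMap (D.mul (x ⊗ₜ y)) =
        A.mul (E.symm.toLinearMap x ⊗ₜ E.symm.toLinearMap y) := fun x y => by
      refine E.injective ?_
      simp [hmul]
    change TensorProduct.map _ _ (D.comul (E _)) = _
    rw [hmul, D.comul_mul, tensorMul_map hE' hs]
    rfl
  · change TensorProduct.map _ _ (D.comul (E _)) = _
    rw [hone, D.comul_one, ← hone]
    simp
  · change D.counit (E _) = _
    rw [hmul, D.counit_mul]
    rfl
  · change D.counit (E _) = _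
    rw [hone, D.counit_one]
  · change TensorProduct.map _ _ (TensorProduct.map _ _ (D.comul (E v))) = _
    rw [← LinearMap.comp_apply, ← TensorProduct.map_comp]
    simp

end Transport

/-! ### Cohomology as the dual of homology, and its bialgebra structure. -/

section Cohomology

variable {K : Type*} [CommRing K] {V : ℕ → Type*} [∀ n, AddCommGroup (V n)]
  [∀ n, Module K (V n)] {d : Tot V →ₗ[K] Tot V} {δ : ∀ n, V (n + 1) →ₗ[K] V n}

theorem ev_lmap_dualMap {W : ℕ → Type*} [∀ n, AddCommGroup (W n)] [∀ n, Module K (W n)]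
    (f : ∀ n, V n →ₗ[K] W n) (F : Tot (GrDual K W)) :
    ev K V (DirectSum.lmap (fun n => (f n).dualMap) F) = ev K W F ∘ₗ DirectSum.lmap f := by
  have : ev K V ∘ₗ DirectSum.lmap (fun n => (f n).dualMap) =
      (DirectSum.lmap f).dualMap ∘ₗ ev K W := tot_hom_ext fun n φ => tot_hom_ext fun m a => by
    simp only [LinearMap.comp_apply, LinearMap.dualMap_apply]
    rw [lmap_inc, lmap_inc]
    rcases eq_or_ne m n with rfl | h
    · simp
    · rw [ev_inc_of_ne h, ev_inc_of_ne h]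
  exact LinearMap.congr_fun this F

theorem exists_ev_comp_raise (η : ∀ n, V n →ₗ[K] V (n + 1)) (F : Tot (GrDual K V)) :
    ∃ F', ev K V F' = ev K V F ∘ₗ raise η := by
  have : (LinearMap.range (ev K V)).mkQ ∘ₗ (raise η).dualMap ∘ₗ ev K V = 0 :=
    tot_hom_ext fun n f => by
      refine (Submodule.Quotient.mk_eq_zero _).2 ?_
      cases n with
      | zero =>
        refine ⟨0, tot_hom_ext fun m a => ?_⟩
        rw [map_zero, LinearMap.zero_apply]
        change 0 = ev K V (inc K (GrDual K V) 0 f) (raise η (inc K V m a))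
        rw [raise_inc, ev_inc_of_ne (by omega)]
      | succ n =>
        refine ⟨inc K _ n (f ∘ₗ η n), tot_hom_ext fun m a => ?_⟩
        change _ = ev K V (inc K (GrDual K V) (n + 1) f) (raise η (inc K V m a))
        rw [raise_inc]
        rcases eq_or_ne m n with rfl | h
        · simp
        · rw [ev_inc_of_ne h, ev_inc_of_ne (by omega)]
  exact (Submodule.Quotient.mk_eq_zero _).1 (LinearMap.congr_fun this F)

/-- Cocycles kill boundaries. For inhomogeneous cocycles the sign operator has to be inserted first;
it preserves cocycles. -/
theorem Lowers.ev_cycInc_codiff (hd : Lowers d δ) (c : Tot (Cyc (codiff d))) (v : Tot V) :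
    ev K V (cycInc (codiff d) c) (d v) = 0 := by
  have h := hd.signMap_codiff (cycInc (codiff d) c)
  rw [d_cycInc, map_zero, neg_zero] at h
  have h' := hd.ev_codiff (signMap K _ (cycInc (codiff d) c))
  rw [h, map_zero, signMap_signMap] at h'
  exact (LinearMap.congr_fun h' v).symm

/-- The universal coefficient isomorphism made explicit: restrict a cocycle along i, with inverse
given by pulling back along p. -/
theorem Contraction.exists_cohomology_equiv (G : Contraction d) (hd : Lowers d δ) :
    ∃ E : Tot (Hlgy (codiff d)) ≃ₗ[K] Tot (GrDual K (Hlgy d)),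
      (∀ n a, E (inc K _ n a) ∈ LinearMap.range (inc K (GrDual K (Hlgy d)) n)) ∧
      (∀ n a, E.symm (inc K _ n a) ∈ LinearMap.range (inc K (Hlgy (codiff d)) n)) ∧
      ∀ c z, ev K _ (E (cls (codiff d) c)) (cls d z) =
        ev K V (cycInc (codiff d) c) (cycInc d z) := by
  let Γ : Tot (GrDual K V) →ₗ[K] Tot (GrDual K (Hlgy d)) :=
    DirectSum.lmap fun n => ((cyc d n).subtype ∘ₗ G.sec n).dualMap
  let Λ : Tot (GrDual K (Hlgy d)) →ₗ[K] Tot (GrDual K V) :=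
    DirectSum.lmap fun n => (G.proj n).dualMap
  have hi : DirectSum.lmap (fun n => (cyc d n).subtype ∘ₗ G.sec n) = G.i :=
    tot_hom_ext fun n a => by rw [lmap_inc, G.i_inc]; rfl
  have hΓ : ∀ F, ev K _ (Γ F) = ev K V F ∘ₗ G.i := fun F => by rw [ev_lmap_dualMap, hi]
  have hΛ : ∀ F, ev K _ (Λ F) = ev K _ F ∘ₗ G.p := ev_lmap_dualMap _
  have hΛc : ∀ F, codiff d (Λ F) = 0 := fun F => ev_injective <| by
    rw [hd.ev_codiff, ev_signMap, hΛ, map_zero]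
    refine LinearMap.ext fun v => ?_
    simp only [LinearMap.comp_apply]
    rw [← G.signMap_p, G.p_d, map_zero, map_zero]
    rfl
  have hΓΛ : ∀ F, Γ (Λ F) = F := fun F => ev_injective <| LinearMap.ext fun v => by
    rw [hΓ, hΛ, LinearMap.comp_apply, LinearMap.comp_apply, G.p_i]
  have hker : LinearMap.ker (cls (codiff d)) = LinearMap.ker (Γ ∘ₗ cycInc (codiff d)) := by
    ext c
    rw [LinearMap.mem_ker, hd.isGradedDiff_codiff.cls_eq_zero_iff, LinearMap.mem_ker]
    constructor
    · rintro ⟨F, hF⟩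
      refine ev_injective (LinearMap.ext fun v => ?_)
      rw [LinearMap.comp_apply, ← hF, hΓ, hd.ev_codiff, map_zero, LinearMap.comp_apply,
        LinearMap.comp_apply, G.d_i, map_zero]
      rfl
    · intro h
      obtain ⟨F, hF⟩ := exists_ev_comp_raise G.htpy (cycInc (codiff d) c)
      -- A cocycle φ vanishing on i p satisfies φ = -φ h d. Thus the transpose of h, corrected by
      -- signs, provides a primitive.
      refine ⟨- signMap K _ F, ev_injective (LinearMap.ext fun v => ?_)⟩
      have h' := G.apply_i_p (hd.ev_cycInc_codiff c) v
      have h0 : ev K V (cycInc (codiff d) c) (G.i (G.p v)) = 0 := by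
        have := LinearMap.congr_fun (hΓ (cycInc (codiff d) c)) (G.p v)
        rw [LinearMap.comp_apply] at h this
        rw [← this, h, map_zero]
        rfl
      rw [h0] at h'
      rw [map_neg, map_neg, hd.ev_codiff, signMap_signMap, hF]
      exact neg_eq_of_add_eq_zero_left h'.symm
  have hsurj : Function.Surjective (Γ ∘ₗ cycInc (codiff d)) := fun F => by
    obtain ⟨c, hc⟩ := hd.isGradedDiff_codiff.mem_range_cycInc (hΛc F)
    exact ⟨c, by rw [LinearMap.comp_apply, hc, hΓΛ]⟩
  let E := ((cls (codiff d)).quotKerEquivOfSurjective cls_surjective).symm ≪≫ₗ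
    Submodule.quotEquivOfEq _ _ hker ≪≫ₗ LinearMap.quotKerEquivOfSurjective _ hsurj
  have hE : ∀ c, E (cls (codiff d) c) = Γ (cycInc (codiff d) c) := fun c => by
    have : ((cls (codiff d)).quotKerEquivOfSurjective cls_surjective).symm (cls (codiff d) c) =
        Submodule.Quotient.mk c := by
      rw [LinearEquiv.symm_apply_eq]
      rfl
    change LinearMap.quotKerEquivOfSurjective _ hsurj (Submodule.quotEquivOfEq _ _ hker
      (((cls (codiff d)).quotKerEquivOfSurjective cls_surjective).symm (cls (codiff d) c))) = _
    rw [this]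
    rfl
  refine ⟨E, fun n a => ?_, fun n a => ?_, fun c z => ?_⟩
  · obtain ⟨a, rfl⟩ := Submodule.Quotient.mk_surjective _ a
    rw [← cls_inc, hE, cycInc_inc]
    exact ⟨_, (lmap_inc _ _ _).symm⟩
  · have hmem : a ∘ₗ G.proj n ∈ cyc (codiff d) n := by
      have := hΛc (inc K _ n a)
      rwa [show Λ (inc K _ n a) = inc K _ n (a ∘ₗ G.proj n) from lmap_inc _ _ _] at this
    refine ⟨Submodule.Quotient.mk ⟨_, hmem⟩, ?_⟩
    rw [← cls_inc, LinearEquiv.eq_symm_apply, hE, cycInc_inc,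
      ← show Λ (inc K _ n a) = inc K _ n (a ∘ₗ G.proj n) from lmap_inc _ _ _, hΓΛ]
  · rw [hE, hΓ, LinearMap.comp_apply, G.apply_i_cls (hd.ev_cycInc_codiff c)]

/-- The sign in the evaluation depends only on the degrees of the functionals, which E preserves, so
the pairing identity passes to tensor squares. -/
theorem evTensor_map_cycInc {E : Tot (Hlgy (codiff d)) →ₗ[K] Tot (GrDual K (Hlgy d))}
    (hE : ∀ n a, E (inc K _ n a) ∈ LinearMap.range (inc K (GrDual K (Hlgy d)) n))
    (hev : ∀ c z, ev K _ (E (cls (codiff d) c)) (cls d z) =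
      ev K V (cycInc (codiff d) c) (cycInc d z)) (t u) :
    evTensor K V (TensorProduct.map (cycInc (codiff d)) (cycInc (codiff d)) t)
      (TensorProduct.map (cycInc d) (cycInc d) u) =
    evTensor K (Hlgy d) (TensorProduct.map E E
      (TensorProduct.map (cls (codiff d)) (cls (codiff d)) t))
      (TensorProduct.map (cls d) (cls d) u) := by
  have : (TensorProduct.map (cycInc d) (cycInc d)).dualMap ∘ₗ evTensor K V ∘ₗ
      TensorProduct.map (cycInc (codiff d)) (cycInc (codiff d)) =
      (TensorProduct.map (cls d) (cls d)).dualMap ∘ₗ evTensor K (Hlgy d) ∘ₗ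
        TensorProduct.map E E ∘ₗ TensorProduct.map (cls (codiff d)) (cls (codiff d)) :=
    tot_tensor_ext fun p q f g => TensorProduct.ext' fun a b => by
      change evTensor K V (cycInc _ _ ⊗ₜ cycInc _ _) (cycInc _ _ ⊗ₜ cycInc _ _) =
        evTensor K _ (E (cls _ _) ⊗ₜ E (cls _ _)) (cls _ _ ⊗ₜ cls _ _)
      have hf := hev (inc K _ p f) a
      have hg := hev (inc K _ q g) b
      rw [cls_inc, cycInc_inc] at hf hg
      rw [cls_inc, cls_inc, cycInc_inc, cycInc_inc]
      obtain ⟨f', hf'⟩ := hE p (Submodule.Quotient.mk f)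
      obtain ⟨g', hg'⟩ := hE q (Submodule.Quotient.mk g)
      rw [← hf'] at hf
      rw [← hg'] at hg
      rw [← hf', ← hg', evTensor_inc, evTensor_inc, LinearMap.smul_apply, LinearMap.smul_apply,
        TensorProduct.dualDistrib_apply, TensorProduct.dualDistrib_apply, hf, hg]
  exact LinearMap.congr_fun (LinearMap.congr_fun this t) u

theorem Lowers.range_le_ker_evTensor_cycInc (hd : Lowers d δ) (t) :
    LinearMap.range (TensorProduct.map d (LinearMap.id : Tot V →ₗ[K] Tot V)) ⊔
      LinearMap.range (TensorProduct.map (LinearMap.id : Tot V →ₗ[K] Tot V) d) ≤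
    LinearMap.ker
      (evTensor K V (TensorProduct.map (cycInc (codiff d)) (cycInc (codiff d)) t)) := by
  have h1 : (TensorProduct.map d (LinearMap.id : Tot V →ₗ[K] Tot V)).dualMap ∘ₗ evTensor K V ∘ₗ
      TensorProduct.map (cycInc (codiff d)) (cycInc (codiff d)) = 0 :=
    tot_tensor_ext fun p q f g => TensorProduct.ext' fun a b => by
      change evTensor K V (cycInc _ _ ⊗ₜ cycInc _ _) (d a ⊗ₜ b) = 0
      have h := hd.ev_cycInc_codiff (inc K _ p f) a
      rw [cycInc_inc] at h
      rw [cycInc_inc, cycInc_inc, evTensor_inc, LinearMap.smul_apply,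
        TensorProduct.dualDistrib_apply, h, zero_mul, smul_zero]
  have h2 : (TensorProduct.map (LinearMap.id : Tot V →ₗ[K] Tot V) d).dualMap ∘ₗ evTensor K V ∘ₗ
      TensorProduct.map (cycInc (codiff d)) (cycInc (codiff d)) = 0 :=
    tot_tensor_ext fun p q f g => TensorProduct.ext' fun a b => by
      change evTensor K V (cycInc _ _ ⊗ₜ cycInc _ _) (a ⊗ₜ d b) = 0
      have h := hd.ev_cycInc_codiff (inc K _ q g) b
      rw [cycInc_inc] at h
      rw [cycInc_inc, cycInc_inc, evTensor_inc, LinearMap.smul_apply,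
        TensorProduct.dualDistrib_apply, h, mul_zero, smul_zero]
  exact sup_le (LinearMap.range_le_ker_iff.2 (LinearMap.congr_fun h1 t))
    (LinearMap.range_le_ker_iff.2 (LinearMap.congr_fun h2 t))

/-- Cohomology with the cup product is identified, as an algebra, with the dual of the homology
bialgebra, and the dual coproduct is carried back. -/
theorem Contraction.exists_cohomologyBialg (hK : IsField K) (G : Contraction d)
    (hd : Lowers d δ) (hfin : ∀ n, Module.Finite K (Hlgy d n)) {B : GrBialg K V}
    (hB : IsDGBialg d B) {cup : GrAlg K (GrDual K V)} (hcup : IsCup B.toGrCoalg cup) :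
    ∃ H : GrBialg K (Hlgy (codiff d)),
      InducesMul (codiff d) cup H.toGrAlg ∧ InducesDualComul d B.toGrAlg H.toGrCoalg := by
  obtain ⟨A, hA⟩ := hd.isGradedDiff_codiff.exists_inducesMul (hd.isDGAlg_codiff hB.coalg hcup)
  obtain ⟨H, hHm, hHc⟩ := exists_homologyBialg G hd hB
  obtain ⟨E, hE, hE', hev⟩ := G.exists_cohomology_equiv hd
  let D := dualBialg hK hfin H
  have hmul : ∀ a b, E (A.mul (a ⊗ₜ b)) = D.mul (E a ⊗ₜ E b) := by
    intro a b
    obtain ⟨f, rfl⟩ := cls_surjective a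
    obtain ⟨g, rfl⟩ := cls_surjective b
    obtain ⟨c, hc, hc'⟩ := hA.mul f g
    refine ev_injective (LinearMap.ext fun x => ?_)
    obtain ⟨z, rfl⟩ := cls_surjective x
    obtain ⟨w, hw, hw'⟩ := hHc.comul z
    -- Cocycles do not see the boundary terms by which Δ z differs from the tensor of cycles w, so
    -- the cup product is computed by the coproduct on homology.
    have h1 := hd.range_le_ker_evTensor_cycInc (f ⊗ₜ g) hw
    rw [LinearMap.mem_ker, map_sub, sub_eq_zero, TensorProduct.map_tmul] at h1
    have h2 := evTensor_map_cycInc (E := E.toLinearMap) hE hev (f ⊗ₜ g) w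
    rw [TensorProduct.map_tmul, TensorProduct.map_tmul, TensorProduct.map_tmul, ← hw'] at h2
    rw [← hc', hev, hc, hcup.mul, LinearMap.comp_apply, h1, h2]
    exact (LinearMap.congr_fun (ev_cupMul H.toGrCoalg _) _).symm
  have hone : E A.one = D.one := by
    obtain ⟨e, he, he'⟩ := hA.one
    refine ev_injective (LinearMap.ext fun x => ?_)
    obtain ⟨z, rfl⟩ := cls_surjective x
    rw [← he', hev, he, hcup.one, ← hHc.counit]
    exact (LinearMap.congr_fun (ev_inc_counit H.toGrCoalg) _).symm
  obtain ⟨T, rfl, hTc, hTε⟩ := D.exists_transport A E hE hE' hmul hone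
  refine ⟨T, hA, ⟨fun z => ?_, fun z => ?_⟩⟩
  · obtain ⟨w, hw⟩ := TensorProduct.map_surjective (cls_surjective (d := codiff d))
      (cls_surjective (d := codiff d)) (T.comul (cls _ z))
    refine ⟨w, hw.symm, fun a b => ?_⟩
    have h := evTensor_map_cycInc (E := E.toLinearMap) hE hev w (a ⊗ₜ b)
    rw [hw, TensorProduct.map_tmul, TensorProduct.map_tmul, hTc] at h
    obtain ⟨c, hc, hc'⟩ := hHm.mul a b
    rw [h, ← hc, ← hev, hc']
    exact LinearMap.congr_fun (evTensor_dualComul hK hfin H.toGrAlg _) _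
  · obtain ⟨e, he, he'⟩ := hHm.one
    rw [← he, ← hev, he', hTε]
    rfl

end Cohomology

end RackCohom

end

theorem mainTheorem6 (X : Type*) [Shelf X] (K : Type*) [CommRing K] :
    ∃ (C : GrCoalg K (Chain K X (Pt X)))
      (cup : GrAlg K (GrDual K (Chain K X (Pt X))))
      (B : GrBialg K (Chain K X (StructMonoid X)))
      (cupM : GrAlg K (GrDual K (Chain K X (StructMonoid X)))),
      -- the structures on chains and cochains
      (IsRackCoalg B C ∧ IsDGCoalg (dPt K X) C) ∧
      (IsCup C cup ∧ IsDGAlg (codiff (dPt K X)) cup) ∧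
      (IsRackBialg B ∧ IsDGBialg (dM K X) B) ∧
      (IsCup B.toGrCoalg cupM ∧ IsDGAlg (codiff (dM K X)) cupM ∧
        IsCompletedDGBialg (dM K X) B cupM) ∧
      -- the induced products on cohomology and homology
      (∃ H, InducesMul (codiff (dPt K X)) cup H) ∧
      (∃ H, InducesMul (codiff (dM K X)) cupM H) ∧
      (∃ H, InducesMul (dM K X) B.toGrAlg H) ∧
      -- the induced coproduct and bialgebra structures over a field
      (IsField K →
        (∃ H, InducesComul (dPt K X) C H) ∧
        (∃ H : GrBialg K (Hlgy (dM K X)),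
          InducesMul (dM K X) B.toGrAlg H.toGrAlg ∧
          InducesComul (dM K X) B.toGrCoalg H.toGrCoalg) ∧
        (Finite X →
          ∃ H : GrBialg K (Hlgy (codiff (dM K X))),
            InducesMul (codiff (dM K X)) cupM H.toGrAlg ∧
            InducesDualComul (dM K X) B.toGrAlg H.toGrCoalg)) := by
  have hPt := lowers_rackD (K := K) (X := X) (Pt X)
  have hM := lowers_rackD (K := K) (X := X) (StructMonoid X)
  have hC : IsDGCoalg (dPt K X) (ptCoalg K X) := isDGCoalg_ptCoalg
  have hB : IsDGBialg (dM K X) (rackBialg K X) := isDGBialg_rackBialg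
  have hcup := isCup_cupAlg (ptCoalg K X)
  have hcupM := isCup_cupAlg (rackBialg K X).toGrCoalg
  refine ⟨ptCoalg K X, cupAlg (ptCoalg K X), rackBialg K X, cupAlg (rackBialg K X).toGrCoalg,
    ⟨isRackCoalg_ptCoalg, hC⟩, ⟨hcup, hPt.isDGAlg_codiff hC hcup⟩,
    ⟨isRackBialg_rackBialg, hB⟩,
    ⟨hcupM, hM.isDGAlg_codiff hB.coalg hcupM, hM.isCompletedDGBialg hB.alg hcupM⟩,
    hPt.isGradedDiff_codiff.exists_inducesMul (hPt.isDGAlg_codiff hC hcup),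
    hM.isGradedDiff_codiff.exists_inducesMul (hM.isDGAlg_codiff hB.coalg hcupM),
    hM.isGradedDiff.exists_inducesMul hB.alg, fun hK => ?_⟩
  obtain ⟨GPt⟩ := hPt.nonempty_contraction hK hC.d_sq
  obtain ⟨GM⟩ := hM.nonempty_contraction hK hB.coalg.d_sq
  refine ⟨⟨_, GPt.inducesComul_homologyCoalg hC⟩, GM.exists_homologyBialg hM hB, fun hX => ?_⟩
  -- The field structure provides the Noetherian hypothesis of `finite_homology`.
  let _ := hK.toField
  exact GM.exists_cohomologyBialg hK hM (fun n => finite_homology n) hB hcupM
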